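/- **Setting.** A function $a:[0,\infty)\to[0,\infty)$ is a *strongly regular scale factor* if $a(0)=0$, $a$ is continuous and strictly increasing on $[0,\infty)$ and $C^2$ on $(0,\infty)$ with $\dot a>0$ there, and there is a constant $K\ge 1$ with $$-K\le \frac{a(t)\ddot a(t)}{\dot a(t)^2}\le 1\qquad\text{for all } t>0 .$$ Extend $a$ evenly to $\mathbb R$. For $\tau>0$ and $-\tau<t_0\le\tau$ put $$\rho(\tau,t_0)=\int_{t_0}^{\tau}\frac{a(t)}{\sqrt{a^2(\tau)-a^2(t)}}\,dt,\qquad \rho_{\mathcal M_\tau}=\rho(\tau,0),$$ and for $0\le\rho<2\rho_{\mathcal M_\tau}$ let $t_0(\tau,\rho)\in(-\tau,\tau]$ be the solution $t_0$ of $\rho=\rho(\tau,t_0)$. Put $$g_{\tau\tau}(\tau,\rho)=-\bigl[1-\dot a(\tau)\,f(\tau,t_0(\tau,\rho))\bigr]^2,$$ where $$f(\tau,t_0)=\int_{t_0}^{\tau}\frac{\ddot a(t)}{\dot a(t)^2}\left(\frac{\sqrt{a^2(\tau)-a^2(t_0)}}{\sqrt{a^2(\tau)-a^2(t)}}-1\right)dt\quad(0\le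 t_0\le\tau),\qquad f(\tau,t_0)=2f(\tau,0)-f(\tau,-t_0)\quad(-\tau<t_0<0).$$ Let $\rho_{\max}(\tau)$ be the infimum of the zeros of $g_{\tau\tau}(\tau,\cdot)$ in $(0,2\rho_{\mathcal M_\tau})$, or $2\rho_{\mathcal M_\tau}$ if there are none. Let $$D_{\mathrm{Fermi}}=\{(\tau,x,y,z):\tau>0,\ \sqrt{x^2+y^2+z^2}<\rho_{\max}(\tau)\},$$ $$D_{\mathrm{polar}}=\{(\tau,\rho,\theta,\phi):\tau>0,\ 0<\rho<\rho_{\max}(\tau),\ \theta\in I_\pi,\ \phi\in I_{2\pi}\},$$ where $I_\pi,I_{2\pi}$ are any open intervals of lengths $\pi$ and $2\pi$. In the spatially flat case $k=0$ put, for $t_0=t_0(\tau,\rho)\ne0$, $$g_{\theta\theta}(\tau,\rho)=a^2(t_0)\,\chi_{|t_0|}(\tau)^2,\qquad \chi_{s}(\tau)=\int_{s}^{\tau}\frac1{a(t)}\frac{a(\tau)}{\sqrt{a^2(\tau)-a^2(t)}}\,dt ;$$ where $t_0(\tau,\rho)=0$ (that is, $\rho=\rho_{\mathcal M_\tau}$),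 $g_{\theta\theta}$ is the limit of $a^2(s)\chi_{|s|}(\tau)^2$ as $s\to0$, $s\neq 0$. Put $g_{\phi\phi}=g_{\theta\theta}\sin^2\theta$ and $$\lambda_0(\tau,\rho)=\frac{g_{\theta\theta}(\tau,\rho)-\rho^2}{\rho^4}\quad(\rho>0),\qquad \lambda_0(\tau,0)=-\frac{\dot a(\tau)^2}{3\,a(\tau)^2}.$$ **Theorem.** Let $a$ be a strongly regular scale factor such that either $\dot a(0^+)=0$ and $\ddot a\ge0$ on $(0,\epsilon)$ for some $\epsilon>0$, or $\dot a(0^+)$ exists with $0<\dot a(0^+)<\infty$. Suppose that $\dddot a$ exists on $(0,\infty)$ and that there is a constant $C>0$ with $$\left|\frac{\dddot a(t)\,a^2(t)}{\dot a^3(t)}\right|\le C\qquad\text{for all } t>0 .$$ Then the following hold. 1. For every $\tau>0$, the map $t_0\mapsto\rho(\tau,t_0)$ is a bijection from $(-\tau,\tau]$ onto $[0,2\rho_{\mathcal M_\tau})$, and $\rho_{\mathcal M_\tau}<\rho_{\max}(\tau)$, so that $D_{\mathrm{Fermi}}$ contains the big bang $\mathcal M^0=\{t_0=0\}$ and points with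 $t_0<0$. 2. $D_{\mathrm{Fermi}}$ is open. On it, with $\rho=\sqrt{x^2+y^2+z^2}$, $g_{\tau\tau}$ is continuously differentiable and $\lambda_0$ is continuous as functions of $(\tau,x,y,z)$. Consequently all coefficients of the extended metric $$\begin{aligned}ds^2={}&g_{\tau\tau}\,d\tau^2+dx^2+dy^2+dz^2+\lambda_0\bigl[(y^2+z^2)dx^2+(x^2+z^2)dy^2+(x^2+y^2)dz^2\\&-xy(dx\,dy+dy\,dx)-xz(dx\,dz+dz\,dx)-yz(dy\,dz+dz\,dy)\bigr]\end{aligned}$$ are continuous on $D_{\mathrm{Fermi}}$, including across $\mathcal M^0$. 3. $D_{\mathrm{polar}}$ is open. On it $g_{\tau\tau}$ is continuously differentiable and $g_{\theta\theta}$ and $g_{\phi\phi}$ are continuous. Consequently all coefficients of $ds^2=g_{\tau\tau}d\tau^2+d\rho^2+g_{\theta\theta}d\theta^2+g_{\phi\phi}d\phi^2$ are continuous on $D_{\mathrm{polar}}$. -/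

import Mathlib

open Set Filter
open scoped Topology

namespace RWFermi

/-- A regular scale factor. Only the values `a t` with `t ≥ 0` matter; `deriv a` and
`deriv (deriv a)` are only used at `t > 0`. Positivity of the derivative is what makes the
quotient in the last field meaningful. -/
structure IsRegular (a : ℝ → ℝ) : Prop where
  map_zero : a 0 = 0
  strictMonoOn : StrictMonoOn a (Ici 0)
  continuousOn : ContinuousOn a (Ici 0)
  contDiffOn : ContDiffOn ℝ 2 a (Ioi 0)
  deriv_pos : ∀ t, 0 < t → 0 < deriv a t
  quotient_le : ∀ t, 0 < t → a t * deriv (deriv a) t / (deriv a t) ^ 2 ≤ 1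

/-- A strongly regular scale factor: the quotient is also bounded below by some `-K ≤ -1`. -/
structure IsStronglyRegular (a : ℝ → ℝ) : Prop extends IsRegular a where
  le_quotient : ∃ K : ℝ, 1 ≤ K ∧
    ∀ t, 0 < t → -K ≤ a t * deriv (deriv a) t / (deriv a t) ^ 2

/-- Behaviour at the big bang: either `a'(0⁺) = 0` and `a'' ≥ 0` on some `(0, ε)`, or `a'(0⁺)`
exists and is finite and positive. -/
def BigBangCondition (a : ℝ → ℝ) : Prop :=
  (Tendsto (deriv a) (𝓝[>] 0) (𝓝 0) ∧
    ∃ ε : ℝ, 0 < ε ∧ ∀ t ∈ Ioo 0 ε, 0 ≤ deriv (deriv a) t) ∨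
  ∃ L : ℝ, 0 < L ∧ Tendsto (deriv a) (𝓝[>] 0) (𝓝 L)

/-- The third derivative of `a` exists on `(0, ∞)` and `|a''' a² / a'³|` is bounded there. -/
def ThirdDerivBound (a : ℝ → ℝ) : Prop :=
  DifferentiableOn ℝ (deriv (deriv a)) (Ioi 0) ∧
  ∃ C : ℝ, 0 < C ∧ ∀ t, 0 < t →
    |deriv (deriv (deriv a)) t * (a t) ^ 2 / (deriv a t) ^ 3| ≤ C

/-- Proper distance `ρ` along the spacelike geodesic from the observer at proper time `τ` to the
point with cosmological time `t₀`, for `-τ < t₀ ≤ τ`. The scale factor is extended evenly, which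
is the `|t|`. -/
noncomputable def properDist (a : ℝ → ℝ) (τ t₀ : ℝ) : ℝ :=
  ∫ t in t₀..τ, a |t| / √((a τ) ^ 2 - (a |t|) ^ 2)

/-- The Fermi radius `ρ_{M_τ}`: proper distance to the big bang. -/
noncomputable def fermiRadius (a : ℝ → ℝ) (τ : ℝ) : ℝ := properDist a τ 0

/-- Cosmological time `t₀(τ, ρ) ∈ (-τ, τ]`, the solution of `ρ = properDist a τ t₀`, for
`0 ≤ ρ < 2 * fermiRadius a τ`. -/
noncomputable def cosmicTime (a : ℝ → ℝ) (τ ρ : ℝ) : ℝ :=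
  Function.invFunOn (properDist a τ) (Ioc (-τ) τ) ρ

/-- `f(τ, t₀)` for `0 ≤ t₀ ≤ τ`. -/
noncomputable def fPos (a : ℝ → ℝ) (τ t₀ : ℝ) : ℝ :=
  ∫ t in t₀..τ, deriv (deriv a) t / (deriv a t) ^ 2 *
    (√((a τ) ^ 2 - (a t₀) ^ 2) / √((a τ) ^ 2 - (a t) ^ 2) - 1)

/-- `f(τ, t₀)` for `-τ < t₀ ≤ τ`. -/
noncomputable def fExt (a : ℝ → ℝ) (τ t₀ : ℝ) : ℝ :=
  if 0 ≤ t₀ then fPos a τ t₀ else 2 * fPos a τ 0 - fPos a τ (-t₀)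

/-- The extended metric coefficient `g_ττ(τ, ρ)`. -/
noncomputable def gTauTau (a : ℝ → ℝ) (τ ρ : ℝ) : ℝ :=
  -(1 - deriv a τ * fExt a τ (cosmicTime a τ ρ)) ^ 2

/-- The zeros of `g_ττ(τ, ·)` in `(0, 2ρ_{M_τ})`. -/
def gTauTauZeros (a : ℝ → ℝ) (τ : ℝ) : Set ℝ :=
  {ρ | 0 < ρ ∧ ρ < 2 * fermiRadius a τ ∧ gTauTau a τ ρ = 0}

open Classical in
/-- `ρ_max(τ)`: the infimum of the zeros of `g_ττ(τ, ·)`, or `2ρ_{M_τ}` if there are none. -/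
noncomputable def rhoMax (a : ℝ → ℝ) (τ : ℝ) : ℝ :=
  if (gTauTauZeros a τ).Nonempty then sInf (gTauTauZeros a τ) else 2 * fermiRadius a τ

/-- `S_k(χ)` for `k = 1, 0, -1`. -/
noncomputable def curvS (k : ℤ) (χ : ℝ) : ℝ :=
  if k = 1 then Real.sin χ else if k = 0 then χ else Real.sinh χ

/-- `χ_{t₀}(τ)` for `0 < t₀ ≤ τ`. -/
noncomputable def chiCoord (a : ℝ → ℝ) (τ t₀ : ℝ) : ℝ :=
  ∫ t in t₀..τ, 1 / a t * (a τ / √((a τ) ^ 2 - (a t) ^ 2))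

/-- `a²(t₀) S_k²(χ_{|t₀|}(τ))`, for `t₀ ≠ 0`. -/
noncomputable def gThetaBar (k : ℤ) (a : ℝ → ℝ) (τ t₀ : ℝ) : ℝ :=
  (a |t₀|) ^ 2 * (curvS k (chiCoord a τ |t₀|)) ^ 2

/-- `g_θθ(τ, ρ)`; where the cosmological time vanishes it is the limiting value as `t₀ → 0`. -/
noncomputable def gThetaTheta (k : ℤ) (a : ℝ → ℝ) (τ ρ : ℝ) : ℝ :=
  if cosmicTime a τ ρ = 0 then limUnder (𝓝[≠] (0 : ℝ)) (gThetaBar k a τ)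
  else gThetaBar k a τ (cosmicTime a τ ρ)

/-- `g_φφ(τ, ρ, θ)`. -/
noncomputable def gPhiPhi (k : ℤ) (a : ℝ → ℝ) (τ ρ θ : ℝ) : ℝ :=
  gThetaTheta k a τ ρ * Real.sin θ ^ 2

/-- `λ_k(τ, ρ)`. On the worldline `ρ = 0` it has its limiting value, which is minus one third of
the curvature `(a'² + k) / a²`. -/
noncomputable def lam (k : ℤ) (a : ℝ → ℝ) (τ ρ : ℝ) : ℝ :=
  if ρ = 0 then -((deriv a τ) ^ 2 + k) / (3 * (a τ) ^ 2)
  else (gThetaTheta k a τ ρ - ρ ^ 2) / ρ ^ 4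

/-- The chart `D_Fermi`, with coordinates `(τ, (x, y, z))` and `ρ = ‖(x, y, z)‖`. -/
def DFermi (a : ℝ → ℝ) : Set (ℝ × EuclideanSpace ℝ (Fin 3)) :=
  {p | 0 < p.1 ∧ ‖p.2‖ < rhoMax a p.1}

/-- The chart `D_polar`, with coordinates `(τ, ρ, θ, φ)`; the angles range over open intervals of
lengths `π` and `2π` starting at `θ₀` and `φ₀`. -/
def DPolar (a : ℝ → ℝ) (θ₀ φ₀ : ℝ) : Set (ℝ × ℝ × ℝ × ℝ) :=
  {p | 0 < p.1 ∧ (0 < p.2.1 ∧ p.2.1 < rhoMax a p.1) ∧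
    p.2.2.1 ∈ Ioo θ₀ (θ₀ + Real.pi) ∧ p.2.2.2 ∈ Ioo φ₀ (φ₀ + 2 * Real.pi)}

/-- The metric in Fermi coordinates, as the matrix of its coefficients in the order
`τ, x, y, z`. -/
noncomputable def fermiMetric (k : ℤ) (a : ℝ → ℝ) (p : ℝ × EuclideanSpace ℝ (Fin 3)) :
    Matrix (Fin 4) (Fin 4) ℝ :=
  let l := lam k a p.1 ‖p.2‖
  let x := p.2 0
  let y := p.2 1
  let z := p.2 2
  !![gTauTau a p.1 ‖p.2‖, 0, 0, 0;
     0, 1 + l * (y ^ 2 + z ^ 2), -(l * (x * y)), -(l * (x * z));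
     0, -(l * (x * y)), 1 + l * (x ^ 2 + z ^ 2), -(l * (y * z));
     0, -(l * (x * z)), -(l * (y * z)), 1 + l * (x ^ 2 + y ^ 2)]

/-- The metric in Fermi polar coordinates, in the order `τ, ρ, θ, φ`. -/
noncomputable def polarMetric (k : ℤ) (a : ℝ → ℝ) (p : ℝ × ℝ × ℝ × ℝ) :
    Matrix (Fin 4) (Fin 4) ℝ :=
  Matrix.diagonal ![gTauTau a p.1 p.2.1, 1, gThetaTheta k a p.1 p.2.1,
    gPhiPhi k a p.1 p.2.1 p.2.2.1]

end RWFermi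

/-! ### The inverse scale factor's derivative and its continuous even extensions. -/

namespace RWFermi

open MeasureTheory Real

/-! The substitution a(t) = A sin x, with A = a(τ), removes the singularity of every integral at t =
τ and expresses all data through one function of u = a(t): the derivative k of the inverse of a,
that is, 1/a' as a function of u. Write H(u) = u k(u) for the Hubble length. Proper distance becomes
`radial`, the integral of H(A sin x) from an angle ψ to π/2; f becomes `shift`; the square root of
g_θθ becomes `areal`. Negative t₀ corresponds to negative ψ, and the big bang to ψ = 0. The
hypotheses on a turn into u k' ≥ -k, bounds of |u k'| and |u² k''| by multiples of k, H → 0 and 1/k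
→ L at 0 (`IsStronglyRegular.isSlowness`). Although k may blow up at 0, the combinations H, u² k'
and 1/k extend continuously and evenly through 0, and the formulas are arranged so that only these
appear there.

The difficulty at the big bang is that the ψ-derivative of `radial` is -H(A sin ψ), which vanishes
at ψ = 0, so the inverse function `angle` is only known to be continuous. But the ψ-derivative of
`shift` is `slope` times that of `radial`, and `slope` is continuous across ψ = 0. Comparing
increments of `shift` with increments of `radial` (`abs_shift_sub_le`) shows that f is
differentiable in the distance with derivative `slope`, and `hasFDerivWithinAt_shiftDist` combines
this with differentiation under the integral in A. The A-derivative contains an integral of k'',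
which is bounded by the hypotheses but not assumed continuous; its joint continuity comes from
integration by parts (`continuousOn_bendDeriv`).

On the worldline the norm is not differentiable, but the full derivative of f vanishes at distance
0, so composing with the norm still gives a C¹ function (`contDiffOn_shiftDist_scaleDist`). For λ₀,
with η = π/2 - ψ, the expansions radial ~ H(A) η and areal - radial ~ -H(A) η³/6, locally uniform in
A, yield the limit -1/(3 H(A)²) (`tendsto_areal_sq_sub`).

Finally 1 - a'f > 0 all the way from the observer to the big bang (`shift_lt`): H is nondecreasing,
u² k' ≥ -H, and 1/(1 + cos x) has integral 1 over [0, π/2]. Compactness of the distance interval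
then puts `rhoMax` strictly beyond the big bang and makes the charts open (`exists_add_le_rhoMax`).
-/

/-- The derivative `k` of the inverse of a scale factor, as a function of the value `u > 0` of the
scale factor, with its first two derivatives and the bounds that strong regularity gives. -/
structure IsSlowness (k k1 k2 : ℝ → ℝ) (K L : ℝ) : Prop where
  pos : ∀ u, 0 < u → 0 < k u
  hasDerivAt : ∀ u, 0 < u → HasDerivAt k (k1 u) u
  hasDerivAt' : ∀ u, 0 < u → HasDerivAt k1 (k2 u) u
  neg_le : ∀ u, 0 < u → -k u ≤ u * k1 u
  abs_le : ∀ u, 0 < u → |u * k1 u| ≤ K * k u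
  abs_le' : ∀ u, 0 < u → |u ^ 2 * k2 u| ≤ K * k u
  tendsto_mul : Tendsto (fun u => u * k u) (𝓝[>] 0) (𝓝 0)
  tendsto_inv : Tendsto (fun u => (k u)⁻¹) (𝓝[>] 0) (𝓝 L)

/-- `u k(u)`, extended evenly: the reciprocal of the Hubble parameter. -/
noncomputable def hubbleLen (k : ℝ → ℝ) (u : ℝ) : ℝ := |u| * k |u|

/-- `u² k'(u)`, extended evenly. -/
noncomputable def sqDeriv (k1 : ℝ → ℝ) (u : ℝ) : ℝ := u ^ 2 * k1 |u|

/-- `1 / k`, extended evenly and with value `L` at `0`. -/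
noncomputable def invSlow (k : ℝ → ℝ) (L u : ℝ) : ℝ := if u = 0 then L else (k |u|)⁻¹

lemma hubbleLen_zero (k : ℝ → ℝ) : hubbleLen k 0 = 0 := by simp [hubbleLen]

lemma hubbleLen_abs (k : ℝ → ℝ) (u : ℝ) : hubbleLen k |u| = hubbleLen k u := by simp [hubbleLen]

lemma hubbleLen_neg (k : ℝ → ℝ) (u : ℝ) : hubbleLen k (-u) = hubbleLen k u := by simp [hubbleLen]

lemma hubbleLen_of_nonneg (k : ℝ → ℝ) {u : ℝ} (hu : 0 ≤ u) : hubbleLen k u = u * k u := by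
  simp [hubbleLen, abs_of_nonneg hu]

lemma sqDeriv_of_nonneg (k1 : ℝ → ℝ) {u : ℝ} (hu : 0 ≤ u) : sqDeriv k1 u = u ^ 2 * k1 u := by
  simp [sqDeriv, abs_of_nonneg hu]

lemma tendsto_abs_nhdsNE_zero : Tendsto (fun u : ℝ => |u|) (𝓝[≠] 0) (𝓝[>] 0) := by
  refine tendsto_nhdsWithin_iff.2 ⟨?_, ?_⟩
  · have : Tendsto (fun u : ℝ => |u|) (𝓝 0) (𝓝 |0|) := continuous_abs.tendsto 0
    rw [abs_zero] at this
    exact this.mono_left nhdsWithin_le_nhds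
  · filter_upwards [self_mem_nhdsWithin] with u hu
    exact abs_pos.2 hu

/-- An even function that is continuous on the positive axis and has its value at `0` as the limit
from the right is continuous. -/
lemma continuous_of_even {f g : ℝ → ℝ} (hfg : ∀ u, u ≠ 0 → f u = g |u|)
    (hg : ContinuousOn g (Ioi 0)) (h0 : Tendsto g (𝓝[>] 0) (𝓝 (f 0))) : Continuous f := by
  rw [continuous_iff_continuousAt]
  intro u
  rcases eq_or_ne u 0 with rfl | hu
  · rw [continuousAt_iff_punctured_nhds]
    refine (h0.comp tendsto_abs_nhdsNE_zero).congr' ?_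
    filter_upwards [self_mem_nhdsWithin] with v hv
    exact (hfg v hv).symm
  · have h1 : ContinuousAt g |u| := hg.continuousAt (Ioi_mem_nhds (abs_pos.2 hu))
    have h2 : ContinuousAt (fun v => g |v|) u :=
      ContinuousAt.comp (f := fun v : ℝ => |v|) h1 continuous_abs.continuousAt
    refine h2.congr ?_
    filter_upwards [isOpen_ne.mem_nhds hu] with v hv
    exact (hfg v hv).symm

namespace IsSlowness

variable {k k1 k2 : ℝ → ℝ} {K L : ℝ}

lemma K_nonneg (hk : IsSlowness k k1 k2 K L) : 0 ≤ K := by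
  have h1 := hk.abs_le 1 one_pos
  have h2 := hk.pos 1 one_pos
  by_contra! h
  nlinarith [abs_nonneg (1 * k1 1)]

lemma continuousOn (hk : IsSlowness k k1 k2 K L) : ContinuousOn k (Ioi 0) :=
  fun u hu => (hk.hasDerivAt u hu).continuousAt.continuousWithinAt

lemma continuousOn' (hk : IsSlowness k k1 k2 K L) : ContinuousOn k1 (Ioi 0) :=
  fun u hu => (hk.hasDerivAt' u hu).continuousAt.continuousWithinAt

lemma continuous_hubbleLen (hk : IsSlowness k k1 k2 K L) : Continuous (hubbleLen k) := by
  refine continuous_of_even (g := fun u => u * k u) (fun u _ => rfl)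
    (continuousOn_id.mul hk.continuousOn) ?_
  rw [hubbleLen_zero]
  exact hk.tendsto_mul

lemma continuous_sqDeriv (hk : IsSlowness k k1 k2 K L) : Continuous (sqDeriv k1) := by
  refine continuous_of_even (g := fun u => u ^ 2 * k1 u) (fun u _ => by simp [sqDeriv])
    ((continuousOn_id.pow 2).mul hk.continuousOn') ?_
  have h0 : sqDeriv k1 0 = 0 := by simp [sqDeriv]
  rw [h0]
  have h1 : Tendsto (fun u => K * (u * k u)) (𝓝[>] 0) (𝓝 0) := by
    simpa using hk.tendsto_mul.const_mul K
  refine squeeze_zero_norm' ?_ h1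
  filter_upwards [self_mem_nhdsWithin] with u hu
  have hu' : (0 : ℝ) < u := hu
  have := hk.abs_le u hu
  rw [Real.norm_eq_abs, show u ^ 2 * k1 u = u * (u * k1 u) by ring, abs_mul, abs_of_pos hu']
  nlinarith

lemma continuous_invSlow (hk : IsSlowness k k1 k2 K L) : Continuous (invSlow k L) := by
  refine continuous_of_even (g := fun u => (k u)⁻¹) (fun u hu => by simp [invSlow, hu])
    (hk.continuousOn.inv₀ fun u hu => (hk.pos u hu).ne') ?_
  simpa [invSlow] using hk.tendsto_inv

lemma hasDerivAt_hubbleLen (hk : IsSlowness k k1 k2 K L) {u : ℝ} (hu : 0 < u) :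
    HasDerivAt (hubbleLen k) (k u + u * k1 u) u := by
  have h1 : HasDerivAt (fun u => u * k u) (1 * k u + u * k1 u) u :=
    (hasDerivAt_id u).mul (hk.hasDerivAt u hu)
  rw [one_mul] at h1
  refine h1.congr_of_eventuallyEq ?_
  filter_upwards [Ioi_mem_nhds hu] with v hv
  exact hubbleLen_of_nonneg k (le_of_lt hv)

lemma hubbleLen_pos (hk : IsSlowness k k1 k2 K L) {u : ℝ} (hu : u ≠ 0) : 0 < hubbleLen k u :=
  mul_pos (abs_pos.2 hu) (hk.pos _ (abs_pos.2 hu))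

lemma hubbleLen_nonneg (hk : IsSlowness k k1 k2 K L) (u : ℝ) : 0 ≤ hubbleLen k u := by
  rcases eq_or_ne u 0 with rfl | hu
  · rw [hubbleLen_zero]
  · exact (hk.hubbleLen_pos hu).le

/-- The derivative k + u k' is nonnegative by `neg_le`, the trace of the bound a a''/a'² ≤ 1. This
monotonicity supplies the dominating functions for the integrals below. -/
lemma monotoneOn_hubbleLen (hk : IsSlowness k k1 k2 K L) : MonotoneOn (hubbleLen k) (Ici 0) := by
  refine monotoneOn_of_deriv_nonneg (convex_Ici 0) hk.continuous_hubbleLen.continuousOn ?_ ?_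
  · intro u hu
    rw [interior_Ici] at hu
    exact (hk.hasDerivAt_hubbleLen hu).differentiableAt.differentiableWithinAt
  · intro u hu
    rw [interior_Ici] at hu
    rw [(hk.hasDerivAt_hubbleLen hu).deriv]
    linarith [hk.neg_le u hu]

lemma hubbleLen_le (hk : IsSlowness k k1 k2 K L) {u v : ℝ} (h : |u| ≤ |v|) :
    hubbleLen k u ≤ hubbleLen k v := by
  rw [← hubbleLen_abs k u, ← hubbleLen_abs k v]
  exact hk.monotoneOn_hubbleLen (abs_nonneg u) (abs_nonneg v) h

lemma hubbleLen_mul_invSlow (hk : IsSlowness k k1 k2 K L) (u : ℝ) :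
    hubbleLen k u * invSlow k L u = |u| := by
  rcases eq_or_ne u 0 with rfl | hu
  · simp [hubbleLen]
  · have := (hk.pos _ (abs_pos.2 hu)).ne'
    simp [hubbleLen, invSlow, hu]
    field_simp

lemma abs_sqDeriv_le (hk : IsSlowness k k1 k2 K L) (u : ℝ) :
    |sqDeriv k1 u| ≤ K * hubbleLen k u := by
  rcases eq_or_ne u 0 with rfl | hu
  · simp [sqDeriv, hubbleLen]
  · have h := hk.abs_le _ (abs_pos.2 hu)
    have h2 : sqDeriv k1 u = |u| * (|u| * k1 |u|) := by
      rw [sqDeriv, ← sq_abs u]; ring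
    rw [h2, abs_mul, abs_abs, hubbleLen]
    nlinarith [abs_nonneg u]

end IsSlowness

end RWFermi

/-! ### The integrals for distance and bending, and their partial derivatives. -/

namespace RWFermi

open MeasureTheory Real

/-- Proper distance as a function of `A = a(τ)` and of the angle `ψ` with
`sin ψ = ± a(t₀) / a(τ)`. -/
noncomputable def radial (k : ℝ → ℝ) (A ψ : ℝ) : ℝ :=
  ∫ x in ψ..π / 2, hubbleLen k (A * sin x)

/-- The derivative of `radial` with respect to `A`. -/
noncomputable def radialDeriv (k k1 : ℝ → ℝ) (A ψ : ℝ) : ℝ :=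
  A⁻¹ * ∫ x in ψ..π / 2, (hubbleLen k (A * sin x) + sqDeriv k1 (A * sin x))

/-- The integral of `k'(A sin x) (1 - cos x)` from `ψ` to `π / 2`. -/
noncomputable def bend (k1 : ℝ → ℝ) (A ψ : ℝ) : ℝ :=
  (A ^ 2)⁻¹ * ∫ x in ψ..π / 2, sqDeriv k1 (A * sin x) / (1 + |cos x|)

/-- The derivative of `bend` with respect to `A`. -/
noncomputable def bendDeriv (k2 : ℝ → ℝ) (A ψ : ℝ) : ℝ :=
  ∫ x in ψ..π / 2, k2 (A * sin x) * (sin x * (1 - cos x))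

lemma continuous_integral_left {X : Type*} [TopologicalSpace X] {f : X → ℝ → ℝ}
    (hf : Continuous (Function.uncurry f)) {s : X → ℝ} (hs : Continuous s) (c : ℝ) :
    Continuous fun q => ∫ x in s q..c, f q x := by
  have h := intervalIntegral.continuous_parametric_intervalIntegral_of_continuous
    (μ := volume) (a₀ := c) hf hs
  refine h.neg.congr fun q => ?_
  exact (intervalIntegral.integral_symm c (s q)).symm

lemma one_sub_cos_eq {x : ℝ} (hx : 0 ≤ cos x) : sin x ^ 2 / (1 + |cos x|) = 1 - cos x := by
  rw [abs_of_nonneg hx, div_eq_iff (by linarith), sin_sq]; ring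

lemma one_add_abs_cos_pos (x : ℝ) : 0 < 1 + |cos x| := by positivity

namespace IsSlowness

variable {k k1 k2 : ℝ → ℝ} {K L : ℝ}

lemma continuous_radial (hk : IsSlowness k k1 k2 K L) :
    Continuous fun q : ℝ × ℝ => radial k q.1 q.2 := by
  refine continuous_integral_left (f := fun (q : ℝ × ℝ) x => hubbleLen k (q.1 * sin x))
    ?_ continuous_snd _
  exact hk.continuous_hubbleLen.comp (by fun_prop)

lemma continuousAt_radialDeriv (hk : IsSlowness k k1 k2 K L) {q : ℝ × ℝ} (hq : 0 < q.1) :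
    ContinuousAt (fun q : ℝ × ℝ => radialDeriv k k1 q.1 q.2) q := by
  have h : Continuous fun q : ℝ × ℝ =>
      ∫ x in q.2..π / 2, (hubbleLen k (q.1 * sin x) + sqDeriv k1 (q.1 * sin x)) := by
    refine continuous_integral_left
      (f := fun (q : ℝ × ℝ) x => hubbleLen k (q.1 * sin x) + sqDeriv k1 (q.1 * sin x))
      ?_ continuous_snd _
    exact (hk.continuous_hubbleLen.comp (by fun_prop)).add
      (hk.continuous_sqDeriv.comp (by fun_prop))
  exact (continuousAt_fst.inv₀ hq.ne').mul h.continuousAt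

lemma continuous_bend_aux (hk : IsSlowness k k1 k2 K L) :
    Continuous fun q : ℝ × ℝ => ∫ x in q.2..π / 2, sqDeriv k1 (q.1 * sin x) / (1 + |cos x|) := by
  refine continuous_integral_left
    (f := fun (q : ℝ × ℝ) x => sqDeriv k1 (q.1 * sin x) / (1 + |cos x|)) ?_ continuous_snd _
  refine Continuous.div (hk.continuous_sqDeriv.comp (by fun_prop)) (by fun_prop) ?_
  exact fun q => (one_add_abs_cos_pos _).ne'

lemma continuousAt_bend (hk : IsSlowness k k1 k2 K L) {q : ℝ × ℝ} (hq : 0 < q.1) :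
    ContinuousAt (fun q : ℝ × ℝ => bend k1 q.1 q.2) q :=
  ((continuousAt_fst.pow 2).inv₀ (pow_ne_zero 2 hq.ne')).mul hk.continuous_bend_aux.continuousAt

lemma hasDerivAt_radial_angle (hk : IsSlowness k k1 k2 K L) (A ψ : ℝ) :
    HasDerivAt (radial k A) (-hubbleLen k (A * sin ψ)) ψ := by
  have hc : Continuous fun x => hubbleLen k (A * sin x) :=
    hk.continuous_hubbleLen.comp (by fun_prop)
  exact intervalIntegral.integral_hasDerivAt_left (hc.intervalIntegrable _ _)
    (hc.stronglyMeasurableAtFilter _ _) hc.continuousAt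

lemma hasDerivAt_bend_angle (hk : IsSlowness k k1 k2 K L) (A ψ : ℝ) :
    HasDerivAt (bend k1 A) (-((A ^ 2)⁻¹ * (sqDeriv k1 (A * sin ψ) / (1 + |cos ψ|)))) ψ := by
  have hc : Continuous fun x => sqDeriv k1 (A * sin x) / (1 + |cos x|) :=
    Continuous.div (hk.continuous_sqDeriv.comp (by fun_prop)) (by fun_prop)
      fun q => (one_add_abs_cos_pos _).ne'
  have := (intervalIntegral.integral_hasDerivAt_left (b := π / 2) (hc.intervalIntegrable ψ _)
    (hc.stronglyMeasurableAtFilter _ _) hc.continuousAt).const_mul ((A ^ 2)⁻¹)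
  rw [mul_neg] at this
  exact this

/-- On this range 1 - cos x = sin² x / (1 + cos x), and the factor sin² x turns k' into u² k'. The
definition of `bend` uses the latter because its integrand is continuous at every angle, including x
= 0. -/
lemma bend_eq (k1 : ℝ → ℝ) {A ψ : ℝ} (hA : 0 < A) (h0 : 0 ≤ ψ) (h1 : ψ ≤ π / 2) :
    bend k1 A ψ = ∫ x in ψ..π / 2, k1 (A * sin x) * (1 - cos x) := by
  rw [bend, ← intervalIntegral.integral_const_mul]
  refine intervalIntegral.integral_congr fun x hx => ?_
  rw [uIcc_of_le h1] at hx
  have hs : 0 ≤ sin x := sin_nonneg_of_nonneg_of_le_pi (h0.trans hx.1) (by linarith [hx.2, pi_pos])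
  have hc : 0 ≤ cos x := cos_nonneg_of_neg_pi_div_two_le_of_le (by linarith [hx.1, pi_pos]) hx.2
  rw [sqDeriv_of_nonneg _ (mul_nonneg hA.le hs), ← one_sub_cos_eq hc]
  field_simp

/-- Differentiation under the integral sign. For B in (A/2, 2A) the derivative of the integrand is
dominated through H(B sin x) ≤ H(2A) and |u² k'| ≤ K H. -/
lemma hasDerivAt_radial (hk : IsSlowness k k1 k2 K L) {A ψ : ℝ} (hA : 0 < A)
    (h0 : -(π / 2) ≤ ψ) (h1 : ψ ≤ π / 2) :
    HasDerivAt (fun A => radial k A ψ) (radialDeriv k k1 A ψ) A := by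
  have hcF : ∀ A, Continuous fun x => hubbleLen k (A * sin x) := fun A =>
    hk.continuous_hubbleLen.comp (by fun_prop)
  have hcG : ∀ A : ℝ, Continuous fun x =>
      A⁻¹ * (hubbleLen k (A * sin x) + sqDeriv k1 (A * sin x)) := fun A =>
    continuous_const.mul ((hcF A).add (hk.continuous_sqDeriv.comp (by fun_prop)))
  have key := intervalIntegral.hasDerivAt_integral_of_dominated_loc_of_deriv_le
    (μ := volume) (𝕜 := ℝ) (a := ψ) (b := π / 2) (x₀ := A) (s := Ioo (A / 2) (2 * A))
    (F := fun A x => hubbleLen k (A * sin x))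
    (F' := fun A x => A⁻¹ * (hubbleLen k (A * sin x) + sqDeriv k1 (A * sin x)))
    (bound := fun _ => (A / 2)⁻¹ * (hubbleLen k (2 * A) + K * hubbleLen k (2 * A)))
    (Ioo_mem_nhds (by linarith) (by linarith))
    (Eventually.of_forall fun A => (hcF A).aestronglyMeasurable)
    ((hcF A).intervalIntegrable _ _) (hcG A).aestronglyMeasurable ?_
    intervalIntegrable_const ?_
  · have h := key.2
    rw [intervalIntegral.integral_const_mul] at h
    exact h
  · refine Eventually.of_forall fun x _ B hB => ?_
    have hB0 : 0 < B := by linarith [hB.1]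
    have hle : hubbleLen k (B * sin x) ≤ hubbleLen k (2 * A) := by
      refine hk.hubbleLen_le ?_
      rw [abs_mul, abs_of_pos hB0, abs_of_pos (by linarith : 0 < 2 * A)]
      nlinarith [abs_sin_le_one x, hB.2, abs_nonneg (sin x)]
    have hK := hk.K_nonneg
    rw [Real.norm_eq_abs, abs_mul, abs_of_pos (inv_pos.2 hB0)]
    refine mul_le_mul (inv_anti₀ (by linarith) hB.1.le) ?_ (abs_nonneg _)
      (inv_nonneg.2 (by linarith))
    refine (abs_add_le _ _).trans (add_le_add ?_ ((hk.abs_sqDeriv_le _).trans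
      (mul_le_mul_of_nonneg_left hle hK)))
    rwa [abs_of_nonneg (hk.hubbleLen_nonneg _)]
  -- The angle 0, where the chain rule through `hubbleLen` is not available, is a null set. At
  -- negative angles evenness replaces sin x by |sin x|.
  · filter_upwards [compl_mem_ae_iff.2 (measure_singleton (0 : ℝ))] with x hx0 hx B hB
    have hB0 : 0 < B := by linarith [hB.1]
    rw [uIoc_of_le h1] at hx
    have hs : sin x ≠ 0 := by
      intro h
      exact hx0 ((sin_eq_zero_iff_of_lt_of_lt (by linarith [hx.1, pi_pos])
        (by linarith [hx.2, pi_pos])).1 h)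
    have hs' := abs_pos.2 hs
    have hu : 0 < B * |sin x| := mul_pos hB0 hs'
    have h2 : HasDerivAt (fun B => hubbleLen k (B * |sin x|))
        ((k (B * |sin x|) + B * |sin x| * k1 (B * |sin x|)) * |sin x|) B :=
      HasDerivAt.comp (h₂ := hubbleLen k) (h := fun B => B * |sin x|) B
        (hk.hasDerivAt_hubbleLen hu) (hasDerivAt_mul_const |sin x|)
    have h3 : ∀ C : ℝ, hubbleLen k (C * |sin x|) = hubbleLen k (C * sin x) := fun C => by
      simp [hubbleLen, abs_mul]
    have h4 : sqDeriv k1 (B * sin x) = (B * |sin x|) ^ 2 * k1 (B * |sin x|) := by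
      rw [sqDeriv, abs_mul, abs_of_pos hB0, mul_pow, mul_pow, sq_abs]
    simp only [h3] at h2
    refine h2.congr_deriv ?_
    rw [h4, ← h3, hubbleLen_of_nonneg k hu.le]
    field_simp

/-- The weight sin x (1 - cos x) equals sin³ x / (1 + cos x), so with u = B sin x the integrand is
B⁻³ u (u² k''(u)) / (1 + cos x), and u |u² k''| ≤ K H(u) ≤ K H(B). -/
lemma abs_deriv_integrand_le (hk : IsSlowness k k1 k2 K L) {B x : ℝ} (hB : 0 < B)
    (hx0 : 0 < x) (hx1 : x ≤ π / 2) :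
    |k2 (B * sin x) * (sin x * (1 - cos x))| ≤ (B ^ 3)⁻¹ * (K * hubbleLen k B) := by
  have hs : 0 < sin x := sin_pos_of_pos_of_lt_pi hx0 (by linarith [hx1, pi_pos])
  have hc : 0 ≤ cos x := cos_nonneg_of_neg_pi_div_two_le_of_le (by linarith [pi_pos]) hx1
  have hu : 0 < B * sin x := mul_pos hB hs
  have h1 := hk.abs_le' _ hu
  have h2 : hubbleLen k (B * sin x) ≤ hubbleLen k B := by
    refine hk.hubbleLen_le ?_
    rw [abs_of_pos hu, abs_of_pos hB]
    nlinarith [sin_le_one x]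
  have h3 : k2 (B * sin x) * (sin x * (1 - cos x)) =
      (B ^ 3)⁻¹ * ((B * sin x) * ((B * sin x) ^ 2 * k2 (B * sin x)) * (1 / (1 + cos x))) := by
    have : 1 - cos x = sin x ^ 2 / (1 + cos x) := by
      rw [eq_div_iff (by linarith), sin_sq]; ring
    rw [this]
    field_simp
  have h4 : 1 / (1 + cos x) ≤ 1 := by rw [div_le_one (by linarith)]; linarith
  have h5 : 0 ≤ 1 / (1 + cos x) := by positivity
  rw [h3, abs_mul, abs_of_pos (by positivity : 0 < (B ^ 3)⁻¹), abs_mul, abs_mul, abs_of_pos hu,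
    abs_of_nonneg h5]
  refine mul_le_mul_of_nonneg_left ?_ (by positivity)
  have h6 : B * sin x * |(B * sin x) ^ 2 * k2 (B * sin x)| ≤ K * hubbleLen k (B * sin x) := by
    rw [hubbleLen_of_nonneg k hu.le]; nlinarith
  have h7 := mul_le_mul_of_nonneg_left h2 hk.K_nonneg
  calc _ ≤ B * sin x * |(B * sin x) ^ 2 * k2 (B * sin x)| * 1 :=
        mul_le_mul_of_nonneg_left h4 (by positivity)
    _ ≤ _ := by linarith

/-- No continuity of k'' is available; measurability comes from its being a derivative. -/
lemma aestronglyMeasurable_deriv_integrand (hk : IsSlowness k k1 k2 K L) {B a b : ℝ} (hB : 0 < B)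
    (h0 : 0 ≤ a) (hab : a ≤ b) (h1 : b ≤ π / 2) :
    AEStronglyMeasurable (fun x => k2 (B * sin x) * (sin x * (1 - cos x)))
      (volume.restrict (uIoc a b)) := by
  have hm : Measurable fun x => deriv k1 (B * sin x) * (sin x * (1 - cos x)) :=
    ((measurable_deriv k1).comp (by fun_prop)).mul (by fun_prop)
  refine hm.aestronglyMeasurable.congr ?_
  rw [uIoc_of_le hab]
  refine (ae_restrict_mem measurableSet_Ioc).mono fun x hx => ?_
  have hs : 0 < sin x :=
    sin_pos_of_pos_of_lt_pi (h0.trans_lt hx.1) (by linarith [hx.2, pi_pos])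
  simp only
  rw [(hk.hasDerivAt' _ (mul_pos hB hs)).deriv]

lemma intervalIntegrable_deriv_integrand (hk : IsSlowness k k1 k2 K L) {B a b : ℝ} (hB : 0 < B)
    (h0 : 0 ≤ a) (hab : a ≤ b) (h1 : b ≤ π / 2) :
    IntervalIntegrable (fun x => k2 (B * sin x) * (sin x * (1 - cos x))) volume a b := by
  refine (intervalIntegrable_const (c := (B ^ 3)⁻¹ * (K * hubbleLen k B))).mono_fun'
    (hk.aestronglyMeasurable_deriv_integrand hB h0 hab h1) ?_
  rw [uIoc_of_le hab]
  refine (ae_restrict_mem measurableSet_Ioc).mono fun x hx => ?_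
  exact hk.abs_deriv_integrand_le hB (h0.trans_lt hx.1) (hx.2.trans h1)

lemma continuous_bend_integrand (hk : IsSlowness k k1 k2 K L) {A a b : ℝ} (hA : 0 < A)
    (h0 : 0 ≤ a) (hab : a ≤ b) (h1 : b ≤ π / 2) :
    ContinuousOn (fun x => k1 (A * sin x) * (1 - cos x)) (Icc a b) := by
  have hc : Continuous fun x => (A ^ 2)⁻¹ * (sqDeriv k1 (A * sin x) / (1 + |cos x|)) :=
    continuous_const.mul (Continuous.div (hk.continuous_sqDeriv.comp (by fun_prop)) (by fun_prop)
      fun q => (one_add_abs_cos_pos _).ne')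
  refine hc.continuousOn.congr fun x hx => ?_
  have hs : 0 ≤ sin x :=
    sin_nonneg_of_nonneg_of_le_pi (h0.trans hx.1) (by linarith [hx.2, pi_pos])
  have hc : 0 ≤ cos x :=
    cos_nonneg_of_neg_pi_div_two_le_of_le (by linarith [hx.1, pi_pos]) (hx.2.trans h1)
  simp only
  rw [sqDeriv_of_nonneg _ (mul_nonneg hA.le hs), ← one_sub_cos_eq hc]
  field_simp

lemma hasDerivAt_bend (hk : IsSlowness k k1 k2 K L) {A ψ : ℝ} (hA : 0 < A)
    (h0 : 0 ≤ ψ) (h1 : ψ ≤ π / 2) :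
    HasDerivAt (fun A => bend k1 A ψ) (bendDeriv k2 A ψ) A := by
  have hint : ∀ B : ℝ, 0 < B →
      IntervalIntegrable (fun x => k1 (B * sin x) * (1 - cos x)) volume ψ (π / 2) := fun B hB =>
    ContinuousOn.intervalIntegrable_of_Icc h1 (hk.continuous_bend_integrand hB h0 h1 le_rfl)
  have key := intervalIntegral.hasDerivAt_integral_of_dominated_loc_of_deriv_le
    (μ := volume) (𝕜 := ℝ) (a := ψ) (b := π / 2) (x₀ := A) (s := Ioo (A / 2) (2 * A))
    (F := fun A x => k1 (A * sin x) * (1 - cos x))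
    (F' := fun A x => k2 (A * sin x) * (sin x * (1 - cos x)))
    (bound := fun _ => ((A / 2) ^ 3)⁻¹ * (K * hubbleLen k (2 * A)))
    (Ioo_mem_nhds (by linarith) (by linarith))
    ((eventually_gt_nhds hA).mono fun B hB => by
      exact (intervalIntegrable_iff.1 (hint B hB)).aestronglyMeasurable)
    (hint A hA) (hk.aestronglyMeasurable_deriv_integrand hA h0 h1 le_rfl) ?_
    intervalIntegrable_const ?_
  · refine key.2.congr_of_eventuallyEq ?_
    filter_upwards [eventually_gt_nhds hA] with B hB
    exact bend_eq k1 hB h0 h1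
  · refine Eventually.of_forall fun x hx B hB => ?_
    rw [uIoc_of_le h1] at hx
    have hB0 : 0 < B := by linarith [hB.1]
    refine (hk.abs_deriv_integrand_le hB0 (h0.trans_lt hx.1) hx.2).trans ?_
    have hle : hubbleLen k B ≤ hubbleLen k (2 * A) := by
      refine hk.hubbleLen_le ?_
      rw [abs_of_pos hB0, abs_of_pos (by linarith : 0 < 2 * A)]
      exact hB.2.le
    have h5 : (A / 2) ^ 3 ≤ B ^ 3 := pow_le_pow_left₀ (by linarith) hB.1.le 3
    exact mul_le_mul (inv_anti₀ (by positivity) h5)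
      (mul_le_mul_of_nonneg_left hle hk.K_nonneg)
      (mul_nonneg hk.K_nonneg (hk.hubbleLen_nonneg _)) (by positivity)
  · refine Eventually.of_forall fun x hx B hB => ?_
    rw [uIoc_of_le h1] at hx
    have hB0 : 0 < B := by linarith [hB.1]
    have hs : 0 < sin x :=
      sin_pos_of_pos_of_lt_pi (h0.trans_lt hx.1) (by linarith [hx.2, pi_pos])
    have h2 : HasDerivAt (fun B => k1 (B * sin x)) (k2 (B * sin x) * sin x) B :=
      HasDerivAt.comp (h₂ := k1) (h := fun B => B * sin x) B
        (hk.hasDerivAt' _ (mul_pos hB0 hs)) (hasDerivAt_mul_const (sin x))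
    exact (h2.mul_const (1 - cos x)).congr_deriv (by ring)

end IsSlowness

end RWFermi

/-! ### Joint continuity of the integral containing the second derivative of k. -/

namespace RWFermi

open MeasureTheory Real

/-- The boundary term in the integration by parts of `bendDeriv`, with the cosine cut off
at `c`. -/
noncomputable def partsBdry (k1 : ℝ → ℝ) (c A x : ℝ) : ℝ :=
  (A ^ 2)⁻¹ * (sqDeriv k1 (A * sin x) *
    (sin x / (max (cos x) c * (1 + max (cos x) c))))

/-- The integrand after the integration by parts of `bendDeriv`, with the cosine cut off
at `c`. -/
noncomputable def partsInt (k1 : ℝ → ℝ) (c A x : ℝ) : ℝ :=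
  (A ^ 2)⁻¹ * (sqDeriv k1 (A * sin x) *
    ((1 + max (cos x) c + max (cos x) c ^ 2) / ((1 + max (cos x) c) * max (cos x) c ^ 2)))

namespace IsSlowness

variable {k k1 k2 : ℝ → ℝ} {K L : ℝ}

lemma continuousAt_partsBdry (hk : IsSlowness k k1 k2 K L) {c : ℝ} (hc : 0 < c) {q : ℝ × ℝ}
    (hq : 0 < q.1) : ContinuousAt (fun q : ℝ × ℝ => partsBdry k1 c q.1 q.2) q := by
  have hm : ∀ x, 0 < max (cos x) c := fun x => lt_max_of_lt_right hc
  have h : Continuous fun q : ℝ × ℝ => sqDeriv k1 (q.1 * sin q.2) *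
      (sin q.2 / (max (cos q.2) c * (1 + max (cos q.2) c))) := by
    refine (hk.continuous_sqDeriv.comp (by fun_prop)).mul (Continuous.div (by fun_prop)
      (by fun_prop) fun q => ?_)
    have := hm q.2
    positivity
  exact ((continuousAt_fst.pow 2).inv₀ (pow_ne_zero 2 hq.ne')).mul h.continuousAt

lemma continuous_partsInt_aux (hk : IsSlowness k k1 k2 K L) {c : ℝ} (hc : 0 < c) :
    Continuous fun q : ℝ × ℝ => sqDeriv k1 (q.1 * sin q.2) *
      ((1 + max (cos q.2) c + max (cos q.2) c ^ 2) /
        ((1 + max (cos q.2) c) * max (cos q.2) c ^ 2)) := by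
  have hm : ∀ x, 0 < max (cos x) c := fun x => lt_max_of_lt_right hc
  refine (hk.continuous_sqDeriv.comp (by fun_prop)).mul (Continuous.div (by fun_prop)
    (by fun_prop) fun q => ?_)
  have := hm q.2
  positivity

lemma continuousAt_integral_partsInt (hk : IsSlowness k k1 k2 K L) {c : ℝ} (hc : 0 < c) (d : ℝ)
    {q : ℝ × ℝ} (hq : 0 < q.1) :
    ContinuousAt (fun q : ℝ × ℝ => ∫ x in q.2..d, partsInt k1 c q.1 x) q := by
  have h := continuous_integral_left (f := fun (q : ℝ × ℝ) x => sqDeriv k1 (q.1 * sin x) *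
      ((1 + max (cos x) c + max (cos x) c ^ 2) / ((1 + max (cos x) c) * max (cos x) c ^ 2)))
    ((hk.continuous_partsInt_aux hc).comp
      (f := fun p : (ℝ × ℝ) × ℝ => (p.1.1, p.2)) (by fun_prop)) continuous_snd d
  simp only [partsInt, intervalIntegral.integral_const_mul]
  exact ((continuousAt_fst.pow 2).inv₀ (pow_ne_zero 2 hq.ne')).mul h.continuousAt

/-- Since k''(A sin x) A cos x is the x-derivative of k'(A sin x), the integrand is A⁻¹ times that
derivative times tan x - sin x. Parts trade k'' for k', which is continuous for u > 0; the price is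
a pole of tan at π/2, hence d < π/2. The cutoff at cos d is inactive on [ψ, d] and makes both terms
continuous for all angles. -/
lemma integral_by_parts (hk : IsSlowness k k1 k2 K L) {A ψ d : ℝ} (hA : 0 < A) (h0 : 0 ≤ ψ)
    (hψ : ψ ≤ d) (hd : d < π / 2) :
    ∫ x in ψ..d, k2 (A * sin x) * (sin x * (1 - cos x)) =
      A⁻¹ * (partsBdry k1 (cos d) A d - partsBdry k1 (cos d) A ψ -
        ∫ x in ψ..d, partsInt k1 (cos d) A x) := by
  have hcd : 0 < cos d := cos_pos_of_mem_Ioo ⟨by linarith [pi_pos], hd⟩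
  have hcont : Continuous (partsInt k1 (cos d) A) :=
    continuous_const.mul ((hk.continuous_partsInt_aux hcd).comp
      (f := fun x : ℝ => (A, x)) (by fun_prop))
  have hint := (hk.intervalIntegrable_deriv_integrand hA h0 hψ hd.le)
  have hmax : ∀ x ∈ Icc ψ d, max (cos x) (cos d) = cos x := fun x hx =>
    max_eq_left (cos_le_cos_of_nonneg_of_le_pi (h0.trans hx.1) (by linarith [pi_pos]) hx.2)
  have key := intervalIntegral.integral_eq_sub_of_hasDerivAt_of_le hψ
    (f := partsBdry k1 (cos d) A)
    (f' := fun x => A * (k2 (A * sin x) * (sin x * (1 - cos x))) + partsInt k1 (cos d) A x)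
    ?_ ?_ ((hint.const_mul A).add (hcont.intervalIntegrable _ _))
  · rw [intervalIntegral.integral_add (hint.const_mul A) (hcont.intervalIntegrable _ _),
      intervalIntegral.integral_const_mul] at key
    rw [eq_inv_mul_iff_mul_eq₀ hA.ne']
    linarith
  · intro x _
    have h1 := hk.continuousAt_partsBdry hcd (q := (A, x)) hA
    exact (ContinuousAt.comp (f := fun x : ℝ => (A, x)) h1
      (by fun_prop : Continuous fun x : ℝ => (A, x)).continuousAt).continuousWithinAt
  · intro x hx
    have hx0 : 0 < x := h0.trans_lt hx.1
    have hs : 0 < sin x := sin_pos_of_pos_of_lt_pi hx0 (by linarith [hx.2, pi_pos])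
    have hc : 0 < cos x := cos_pos_of_mem_Ioo ⟨by linarith [pi_pos], hx.2.trans hd⟩
    have hu : 0 < A * sin x := mul_pos hA hs
    have h1 : HasDerivAt (fun x => k1 (A * sin x)) (k2 (A * sin x) * (A * cos x)) x :=
      HasDerivAt.comp (h₂ := k1) (h := fun x => A * sin x) x (hk.hasDerivAt' _ hu)
        ((hasDerivAt_sin x).const_mul A)
    have h2 : HasDerivAt (fun x => tan x - sin x) (1 / cos x ^ 2 - cos x) x :=
      (hasDerivAt_tan hc.ne').sub (hasDerivAt_sin x)
    have h3 := h1.mul h2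
    have hval : ∀ y ∈ Ioo ψ d, partsBdry k1 (cos d) A y =
        k1 (A * sin y) * (tan y - sin y) := by
      intro y hy
      have hy0 : 0 < y := h0.trans_lt hy.1
      have hys : 0 < sin y := sin_pos_of_pos_of_lt_pi hy0 (by linarith [hy.2, pi_pos])
      have hyc : 0 < cos y := cos_pos_of_mem_Ioo ⟨by linarith [pi_pos], hy.2.trans hd⟩
      rw [partsBdry, hmax y ⟨hy.1.le, hy.2.le⟩, sqDeriv_of_nonneg _ (mul_pos hA hys).le,
        tan_eq_sin_div_cos]
      field_simp
      rw [sin_sq]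
      ring
    refine (h3.congr_deriv ?_).congr_of_eventuallyEq ?_
    · rw [partsInt, hmax x ⟨hx.1.le, hx.2.le⟩, sqDeriv_of_nonneg _ hu.le, tan_eq_sin_div_cos]
      field_simp
      linear_combination (-(k1 (A * sin x) * (1 + cos x + cos x ^ 2))) * sin_sq_add_cos_sq x
    · filter_upwards [Ioo_mem_nhds hx.1 hx.2] with y hy using hval y hy

/-- Locally uniform approximation: the integral up to d is continuous after integration by parts,
and the tail from d to π/2 is uniformly small because its integrand is bounded. -/
lemma continuousOn_bendDeriv (hk : IsSlowness k k1 k2 K L) :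
    ContinuousOn (fun q : ℝ × ℝ => bendDeriv k2 q.1 q.2) (Ioi 0 ×ˢ Icc 0 (π / 2)) := by
  rintro ⟨A, ψ⟩ hq
  have hA : 0 < A := hq.1
  refine continuousWithinAt_of_locally_uniform_approx_of_continuousWithinAt hq fun u hu => ?_
  obtain ⟨ε, hε, hεu⟩ := Metric.mem_uniformity_dist.1 hu
  set R := ((A / 2) ^ 3)⁻¹ * (K * hubbleLen k (2 * A)) with hR
  have hR0 : 0 ≤ R :=
    mul_nonneg (by positivity) (mul_nonneg hk.K_nonneg (hk.hubbleLen_nonneg _))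
  -- A tail of length δ contributes at most R δ. The denominator has R + 1 because R may be 0.
  obtain ⟨δ, hδ0, hδ1, hδε⟩ : ∃ δ, 0 < δ ∧ δ < π / 2 ∧ R * δ < ε := by
    refine ⟨min (π / 4) (ε / (2 * (R + 1))), by positivity, ?_, ?_⟩
    · exact (min_le_left _ _).trans_lt (by linarith [pi_pos])
    · calc R * min (π / 4) (ε / (2 * (R + 1))) ≤ R * (ε / (2 * (R + 1))) :=
            mul_le_mul_of_nonneg_left (min_le_right _ _) hR0
        _ < ε := by
          rw [← mul_div_assoc, div_lt_iff₀ (by positivity)]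
          nlinarith
  set d := π / 2 - δ with hd
  have hcd : 0 < cos d := cos_pos_of_mem_Ioo ⟨by linarith [pi_pos], by linarith⟩
  -- The minimum with d makes the approximant vanish when the angle lies beyond d; then the whole
  -- integral is tail.
  refine ⟨Ioo (A / 2) (2 * A) ×ˢ univ ∩ Ioi 0 ×ˢ Icc 0 (π / 2), ?_, fun q => q.1⁻¹ *
    (partsBdry k1 (cos d) q.1 d - partsBdry k1 (cos d) q.1 (min q.2 d) -
        ∫ x in min q.2 d..d, partsInt k1 (cos d) q.1 x), ?_, ?_⟩
  · rw [inter_comm]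
    exact inter_mem_nhdsWithin _
      (prod_mem_nhds (Ioo_mem_nhds (by linarith) (by linarith)) univ_mem)
  · have hc1 : ContinuousAt (fun q : ℝ × ℝ => (q.1, d)) (A, ψ) :=
      (by fun_prop : Continuous fun q : ℝ × ℝ => (q.1, d)).continuousAt
    have hc2 : ContinuousAt (fun q : ℝ × ℝ => (q.1, min q.2 d)) (A, ψ) :=
      (by fun_prop : Continuous fun q : ℝ × ℝ => (q.1, min q.2 d)).continuousAt
    refine ContinuousAt.continuousWithinAt ((continuousAt_fst.inv₀ hA.ne').mul
      (((ContinuousAt.comp (f := fun q : ℝ × ℝ => (q.1, d))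
        (hk.continuousAt_partsBdry hcd (q := (A, d)) hA) hc1).sub ?_).sub ?_))
    · exact ContinuousAt.comp (f := fun q : ℝ × ℝ => (q.1, min q.2 d))
        (hk.continuousAt_partsBdry hcd (q := (A, min ψ d)) hA) hc2
    · exact ContinuousAt.comp (f := fun q : ℝ × ℝ => (q.1, min q.2 d))
        (hk.continuousAt_integral_partsInt hcd d (q := (A, min ψ d)) hA) hc2
  · rintro ⟨B, x⟩ ⟨⟨hB, -⟩, hB0, hx⟩
    apply hεu
    have hB0' : (0 : ℝ) < B := hB0
    simp only at hx ⊢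
    have hd0 : 0 ≤ d := by linarith
    have hm0 : 0 ≤ min x d := le_min hx.1 hd0
    have hmd : min x d ≤ d := min_le_right _ _
    rw [← hk.integral_by_parts hB0' hm0 hmd (by linarith)]
    have hi1 := hk.intervalIntegrable_deriv_integrand hB0' hm0 hmd (by linarith)
    have hbound : ∀ y ∈ Ioc d (π / 2), ‖k2 (B * sin y) * (sin y * (1 - cos y))‖ ≤ R := by
      intro y hy
      refine (hk.abs_deriv_integrand_le hB0' (hd0.trans_lt hy.1) hy.2).trans ?_
      have hle : hubbleLen k B ≤ hubbleLen k (2 * A) := by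
        refine hk.hubbleLen_le ?_
        rw [abs_of_pos hB0', abs_of_pos (by linarith : 0 < 2 * A)]
        exact hB.2.le
      have h5 : (A / 2) ^ 3 ≤ B ^ 3 := pow_le_pow_left₀ (by linarith) hB.1.le 3
      exact mul_le_mul (inv_anti₀ (by positivity) h5)
        (mul_le_mul_of_nonneg_left hle hk.K_nonneg)
        (mul_nonneg hk.K_nonneg (hk.hubbleLen_nonneg _)) (by positivity)
    rw [Real.dist_eq, bendDeriv]
    refine lt_of_le_of_lt ?_ hδε
    rcases le_total x d with hxd | hxd
    · rw [min_eq_left hxd] at hi1 ⊢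
      have hi2 := hk.intervalIntegrable_deriv_integrand hB0' hd0 (by linarith : d ≤ π / 2) le_rfl
      rw [← intervalIntegral.integral_add_adjacent_intervals hi1 hi2, add_sub_cancel_left]
      have := intervalIntegral.norm_integral_le_of_norm_le_const (a := d) (b := π / 2) (C := R)
        (f := fun y => k2 (B * sin y) * (sin y * (1 - cos y))) (by
          rw [uIoc_of_le (by linarith)]; exact hbound)
      rwa [show π / 2 - d = δ by rw [hd]; ring, abs_of_pos hδ0] at this
    · rw [min_eq_right hxd, intervalIntegral.integral_same, sub_zero]
      have := intervalIntegral.norm_integral_le_of_norm_le_const (a := x) (b := π / 2) (C := R)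
        (f := fun y => k2 (B * sin y) * (sin y * (1 - cos y))) (by
          rw [uIoc_of_le hx.2]; exact fun y hy => hbound y ⟨hxd.trans_lt hy.1, hy.2⟩)
      refine this.trans (mul_le_mul_of_nonneg_left ?_ hR0)
      rw [abs_of_nonneg (by linarith [hx.2])]
      linarith

end IsSlowness

end RWFermi

/-! ### The function f in terms of the angle, and the angle in terms of the distance. -/

namespace RWFermi

open MeasureTheory Real

/-- `f(τ, t₀)` for `t₀ ≥ 0` as a function of `A = a(τ)` and of the angle. -/
noncomputable def shiftPos (k k1 : ℝ → ℝ) (A ψ : ℝ) : ℝ :=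
  -(A * cos ψ * bend k1 A ψ) + (1 - cos ψ) * k A -
    A⁻¹ * (hubbleLen k (A * sin ψ) * (sin ψ / (1 + |cos ψ|)))

/-- The derivative of `shiftPos` with respect to `A`. -/
noncomputable def shiftPosDeriv (k1 k2 : ℝ → ℝ) (A ψ : ℝ) : ℝ :=
  -(cos ψ * bend k1 A ψ + A * cos ψ * bendDeriv k2 A ψ) + (1 - cos ψ) * k1 A -
    (A ^ 2)⁻¹ * (sqDeriv k1 (A * sin ψ) * (sin ψ / (1 + |cos ψ|)))

/-- `f(τ, t₀)`, for `t₀` of either sign, as a function of `A = a(τ)` and of the angle. -/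
noncomputable def shift (k k1 : ℝ → ℝ) (A ψ : ℝ) : ℝ :=
  shiftPos k k1 A (max ψ 0) + shiftPos k k1 A 0 - shiftPos k k1 A (max (-ψ) 0)

/-- The derivative of `shift` with respect to `A`. -/
noncomputable def shiftDeriv (k1 k2 : ℝ → ℝ) (A ψ : ℝ) : ℝ :=
  shiftPosDeriv k1 k2 A (max ψ 0) + shiftPosDeriv k1 k2 A 0 - shiftPosDeriv k1 k2 A (max (-ψ) 0)

/-- The derivative of `shift` with respect to `radial`, at constant `A`. -/
noncomputable def slope (k k1 : ℝ → ℝ) (L A ψ : ℝ) : ℝ :=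
  A⁻¹ - invSlow k L (A * sin ψ) * (A⁻¹ * k A + bend k1 A |ψ|)

/-- The angle as a function of `A = a(τ)` and of the proper distance. -/
noncomputable def angle (k : ℝ → ℝ) (A ρ : ℝ) : ℝ :=
  Function.invFunOn (radial k A) (Ioc (-(π / 2)) (π / 2)) ρ

/-- The pairs of a positive value of the scale factor and an admissible proper distance. -/
def radialDomain (k : ℝ → ℝ) : Set (ℝ × ℝ) := {q | 0 < q.1 ∧ 0 ≤ q.2 ∧ q.2 < 2 * radial k q.1 0}

lemma shift_of_nonneg (k k1 : ℝ → ℝ) (A : ℝ) {ψ : ℝ} (h : 0 ≤ ψ) :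
    shift k k1 A ψ = shiftPos k k1 A ψ := by
  rw [shift, max_eq_left h, max_eq_right (by linarith)]; ring

lemma shift_of_nonpos (k k1 : ℝ → ℝ) (A : ℝ) {ψ : ℝ} (h : ψ ≤ 0) :
    shift k k1 A ψ = 2 * shiftPos k k1 A 0 - shiftPos k k1 A (-ψ) := by
  rw [shift, max_eq_right h, max_eq_left (by linarith)]; ring

lemma bend_pi_div_two (k1 : ℝ → ℝ) (A : ℝ) : bend k1 A (π / 2) = 0 := by simp [bend]

lemma radial_pi_div_two (k : ℝ → ℝ) (A : ℝ) : radial k A (π / 2) = 0 := by simp [radial]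

lemma max_zero_mem {ψ : ℝ} (h : ψ ∈ Icc (-(π / 2)) (π / 2)) :
    max ψ 0 ∈ Icc 0 (π / 2) ∧ max (-ψ) 0 ∈ Icc 0 (π / 2) :=
  ⟨⟨le_max_right _ _, max_le h.2 (by positivity)⟩,
    ⟨le_max_right _ _, max_le (by linarith [h.1]) (by positivity)⟩⟩

namespace IsSlowness

variable {k k1 k2 : ℝ → ℝ} {K L : ℝ}

lemma continuousAt_shiftPos (hk : IsSlowness k k1 k2 K L) {q : ℝ × ℝ} (hq : 0 < q.1) :
    ContinuousAt (fun q : ℝ × ℝ => shiftPos k k1 q.1 q.2) q := by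
  have h1 : ContinuousAt (fun q : ℝ × ℝ => k q.1) q :=
    ContinuousAt.comp (g := k) (f := fun q : ℝ × ℝ => q.1)
      (hk.hasDerivAt _ hq).continuousAt continuousAt_fst
  have h2 : Continuous fun q : ℝ × ℝ =>
      hubbleLen k (q.1 * sin q.2) * (sin q.2 / (1 + |cos q.2|)) :=
    (hk.continuous_hubbleLen.comp (by fun_prop)).mul (Continuous.div (by fun_prop) (by fun_prop)
      fun q => (one_add_abs_cos_pos _).ne')
  have h3 : Continuous fun q : ℝ × ℝ => q.1 * cos q.2 := by fun_prop
  have h4 : Continuous fun q : ℝ × ℝ => 1 - cos q.2 := by fun_prop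
  exact ((h3.continuousAt.mul (hk.continuousAt_bend hq)).neg.add (h4.continuousAt.mul h1)).sub
    ((continuousAt_fst.inv₀ hq.ne').mul h2.continuousAt)

lemma continuousOn_shiftPosDeriv (hk : IsSlowness k k1 k2 K L) :
    ContinuousOn (fun q : ℝ × ℝ => shiftPosDeriv k1 k2 q.1 q.2) (Ioi 0 ×ˢ Icc 0 (π / 2)) := by
  have h1 : ContinuousOn (fun q : ℝ × ℝ => k1 q.1) (Ioi 0 ×ˢ Icc 0 (π / 2)) :=
    hk.continuousOn'.comp continuousOn_fst fun q hq => hq.1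
  have h2 : Continuous fun q : ℝ × ℝ =>
      sqDeriv k1 (q.1 * sin q.2) * (sin q.2 / (1 + |cos q.2|)) :=
    (hk.continuous_sqDeriv.comp (by fun_prop)).mul (Continuous.div (by fun_prop) (by fun_prop)
      fun q => (one_add_abs_cos_pos _).ne')
  have h3 : Continuous fun q : ℝ × ℝ => q.1 * cos q.2 := by fun_prop
  have h4 : Continuous fun q : ℝ × ℝ => 1 - cos q.2 := by fun_prop
  have h5 : Continuous fun q : ℝ × ℝ => cos q.2 := by fun_prop
  have h6 : ContinuousOn (fun q : ℝ × ℝ => bend k1 q.1 q.2) (Ioi 0 ×ˢ Icc 0 (π / 2)) :=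
    fun q hq => (hk.continuousAt_bend hq.1).continuousWithinAt
  have h7 : ContinuousOn (fun q : ℝ × ℝ => (q.1 ^ 2)⁻¹) (Ioi 0 ×ˢ Icc 0 (π / 2)) :=
    (continuousOn_fst.pow 2).inv₀ fun q hq => pow_ne_zero 2 (ne_of_gt hq.1)
  exact (((h5.continuousOn.mul h6).add (h3.continuousOn.mul hk.continuousOn_bendDeriv)).neg.add
    (h4.continuousOn.mul h1)).sub (h7.mul h2.continuousOn)

lemma continuousAt_shift (hk : IsSlowness k k1 k2 K L) {q : ℝ × ℝ} (hq : 0 < q.1) :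
    ContinuousAt (fun q : ℝ × ℝ => shift k k1 q.1 q.2) q := by
  have h : ∀ g : ℝ → ℝ, Continuous g →
      ContinuousAt (fun q : ℝ × ℝ => shiftPos k k1 q.1 (g q.2)) q := fun g hg =>
    ContinuousAt.comp (f := fun q : ℝ × ℝ => (q.1, g q.2))
      (hk.continuousAt_shiftPos (q := (q.1, g q.2)) hq)
      (by fun_prop : Continuous fun q : ℝ × ℝ => (q.1, g q.2)).continuousAt
  exact ((h (fun x => max x 0) (by fun_prop)).add (h (fun _ => 0) (by fun_prop))).sub
    (h (fun x => max (-x) 0) (by fun_prop))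

lemma continuousOn_shiftDeriv (hk : IsSlowness k k1 k2 K L) :
    ContinuousOn (fun q : ℝ × ℝ => shiftDeriv k1 k2 q.1 q.2)
      (Ioi 0 ×ˢ Icc (-(π / 2)) (π / 2)) := by
  have h : ∀ g : ℝ → ℝ, Continuous g → MapsTo g (Icc (-(π / 2)) (π / 2)) (Icc 0 (π / 2)) →
      ContinuousOn (fun q : ℝ × ℝ => shiftPosDeriv k1 k2 q.1 (g q.2))
        (Ioi 0 ×ˢ Icc (-(π / 2)) (π / 2)) := fun g hg hm =>
    ContinuousOn.comp (f := fun q : ℝ × ℝ => (q.1, g q.2)) hk.continuousOn_shiftPosDeriv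
      (by fun_prop : Continuous fun q : ℝ × ℝ => (q.1, g q.2)).continuousOn
      fun q hq => mk_mem_prod hq.1 (hm hq.2)
  have h1 := h (fun x => max x 0) (by fun_prop) fun x hx => (max_zero_mem hx).1
  have h2 := h (fun _ => 0) (by fun_prop) fun _ _ => ⟨le_rfl, by positivity⟩
  have h3 := h (fun x => max (-x) 0) (by fun_prop) fun x hx => (max_zero_mem hx).2
  exact (h1.add h2).sub h3

lemma continuousAt_slope (hk : IsSlowness k k1 k2 K L) {q : ℝ × ℝ} (hq : 0 < q.1) :
    ContinuousAt (fun q : ℝ × ℝ => slope k k1 L q.1 q.2) q := by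
  have h1 : ContinuousAt (fun q : ℝ × ℝ => k q.1) q :=
    ContinuousAt.comp (g := k) (f := fun q : ℝ × ℝ => q.1)
      (hk.hasDerivAt _ hq).continuousAt continuousAt_fst
  have h2 : Continuous fun q : ℝ × ℝ => invSlow k L (q.1 * sin q.2) :=
    hk.continuous_invSlow.comp (by fun_prop)
  have h3 : ContinuousAt (fun q : ℝ × ℝ => bend k1 q.1 |q.2|) q :=
    ContinuousAt.comp (f := fun q : ℝ × ℝ => (q.1, |q.2|))
      (hk.continuousAt_bend (q := (q.1, |q.2|)) hq)
      (by fun_prop : Continuous fun q : ℝ × ℝ => (q.1, |q.2|)).continuousAt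
  have h4 : ContinuousAt (fun q : ℝ × ℝ => q.1⁻¹) q := continuousAt_fst.inv₀ hq.ne'
  exact h4.sub (h2.continuousAt.mul ((h4.mul h1).add h3))

lemma slope_neg (k k1 : ℝ → ℝ) (L A ψ : ℝ) : slope k k1 L A (-ψ) = slope k k1 L A ψ := by
  simp [slope, invSlow]

lemma hasDerivAt_shiftPos (hk : IsSlowness k k1 k2 K L) {A ψ : ℝ} (hA : 0 < A)
    (hψ : ψ ∈ Icc 0 (π / 2)) :
    HasDerivAt (fun A => shiftPos k k1 A ψ) (shiftPosDeriv k1 k2 A ψ) A := by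
  have h1 := hk.hasDerivAt_bend hA hψ.1 hψ.2
  have h2 : HasDerivAt (fun A => A * cos ψ) (cos ψ) A := hasDerivAt_mul_const (cos ψ)
  have h3 : HasDerivAt (fun A => A⁻¹ * (hubbleLen k (A * sin ψ) * (sin ψ / (1 + |cos ψ|))))
      ((A ^ 2)⁻¹ * (sqDeriv k1 (A * sin ψ) * (sin ψ / (1 + |cos ψ|)))) A := by
    -- At ψ = 0 the term is identically 0 in A; otherwise A sin ψ > 0 and k is differentiable there.
    rcases hψ.1.eq_or_lt with h0 | h0
    · subst h0
      simpa using hasDerivAt_const A (0 : ℝ)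
    · have hs : 0 < sin ψ := sin_pos_of_pos_of_lt_pi h0 (by linarith [hψ.2, pi_pos])
      have h4 : HasDerivAt (fun A => k (A * sin ψ)) (k1 (A * sin ψ) * sin ψ) A :=
        HasDerivAt.comp (h₂ := k) (h := fun A => A * sin ψ) A (hk.hasDerivAt _ (mul_pos hA hs))
          (hasDerivAt_mul_const (sin ψ))
      have h5 := h4.mul_const (sin ψ * (sin ψ / (1 + |cos ψ|)))
      refine (h5.congr_deriv ?_).congr_of_eventuallyEq ?_
      · rw [sqDeriv_of_nonneg _ (mul_pos hA hs).le]
        field_simp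
      · filter_upwards [eventually_gt_nhds hA] with B hB
        rw [hubbleLen_of_nonneg _ (mul_pos hB hs).le]
        field_simp
  have h6 := ((h2.mul h1).neg.add ((hk.hasDerivAt A hA).const_mul (1 - cos ψ))).sub h3
  exact h6

lemma hasDerivAt_shift (hk : IsSlowness k k1 k2 K L) {A ψ : ℝ} (hA : 0 < A)
    (hψ : ψ ∈ Icc (-(π / 2)) (π / 2)) :
    HasDerivAt (fun A => shift k k1 A ψ) (shiftDeriv k1 k2 A ψ) A :=
  ((hk.hasDerivAt_shiftPos hA (max_zero_mem hψ).1).add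
    (hk.hasDerivAt_shiftPos hA ⟨le_rfl, by positivity⟩)).sub
    (hk.hasDerivAt_shiftPos hA (max_zero_mem hψ).2)

/-- In -A cos ψ · bend + (1 - cos ψ)(k(A) - k(A sin ψ)) the two contributions of k'(A sin ψ) cancel.
What remains is sin ψ (A · bend + k(A) - k(A sin ψ)), which has the factor H(A sin ψ) once 1/k is
pulled into `slope`. -/
lemma hasDerivAt_shiftPos_angle (hk : IsSlowness k k1 k2 K L) {A ψ : ℝ} (hA : 0 < A)
    (hψ : ψ ∈ Ioo 0 (π / 2)) :
    HasDerivAt (shiftPos k k1 A) (slope k k1 L A ψ * -hubbleLen k (A * sin ψ)) ψ := by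
  have hs : 0 < sin ψ := sin_pos_of_pos_of_lt_pi hψ.1 (by linarith [hψ.2, pi_pos])
  have hc : 0 < cos ψ := cos_pos_of_mem_Ioo ⟨by linarith [pi_pos, hψ.1], hψ.2⟩
  have hu := mul_pos hA hs
  have h1 := ((hasDerivAt_cos ψ).const_mul A).mul (hk.hasDerivAt_bend_angle A ψ)
  have h2 : HasDerivAt (fun ψ => k (A * sin ψ)) (k1 (A * sin ψ) * (A * cos ψ)) ψ :=
    HasDerivAt.comp (h₂ := k) (h := fun x => A * sin x) ψ (hk.hasDerivAt _ hu)
      ((hasDerivAt_sin ψ).const_mul A)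
  have h3 := ((hasDerivAt_cos ψ).const_sub 1).mul (h2.const_sub (k A))
  have h4 := h1.neg.add h3
  refine (h4.congr_deriv ?_).congr_of_eventuallyEq ?_
  · have h5 := hk.hubbleLen_mul_invSlow (A * sin ψ)
    rw [abs_of_pos hu] at h5
    have h6 : slope k k1 L A ψ * -hubbleLen k (A * sin ψ) =
        -(A⁻¹ * hubbleLen k (A * sin ψ)) +
          (hubbleLen k (A * sin ψ) * invSlow k L (A * sin ψ)) * (A⁻¹ * k A + bend k1 A |ψ|) := by
      rw [slope]; ring
    have h7 := one_sub_cos_eq hc.le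
    rw [h6, h5, abs_of_pos hψ.1, hubbleLen_of_nonneg k hu.le, sqDeriv_of_nonneg k1 hu.le, ← h7]
    have := (one_add_abs_cos_pos ψ).ne'
    field_simp
    ring
  · filter_upwards [Ioo_mem_nhds hψ.1 hψ.2] with y hy
    have hys : 0 < sin y := sin_pos_of_pos_of_lt_pi hy.1 (by linarith [hy.2, pi_pos])
    have hyc : 0 < cos y := cos_pos_of_mem_Ioo ⟨by linarith [pi_pos, hy.1], hy.2⟩
    simp only [shiftPos, Pi.add_apply, Pi.neg_apply, Pi.mul_apply]
    rw [hubbleLen_of_nonneg k (mul_pos hA hys).le, ← one_sub_cos_eq hyc.le]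
    have := (one_add_abs_cos_pos y).ne'
    field_simp
    ring

lemma hasDerivAt_shift_angle (hk : IsSlowness k k1 k2 K L) {A ψ : ℝ} (hA : 0 < A)
    (hψ : ψ ∈ Ioo (-(π / 2)) (π / 2)) (h0 : ψ ≠ 0) :
    HasDerivAt (shift k k1 A) (slope k k1 L A ψ * -hubbleLen k (A * sin ψ)) ψ := by
  rcases lt_or_gt_of_ne h0 with h | h
  · have h1 := hk.hasDerivAt_shiftPos_angle hA (ψ := -ψ) ⟨by linarith, by linarith [hψ.1]⟩
    have h2 : HasDerivAt (fun ψ => shiftPos k k1 A (-ψ))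
        (slope k k1 L A (-ψ) * -hubbleLen k (A * sin (-ψ)) * -1) ψ :=
      HasDerivAt.comp (h₂ := shiftPos k k1 A) (h := fun x => -x) ψ h1 (hasDerivAt_neg ψ)
    refine ((h2.const_sub (2 * shiftPos k k1 A 0)).congr_deriv ?_).congr_of_eventuallyEq ?_
    · rw [slope_neg, sin_neg, mul_neg A, hubbleLen_neg]; ring
    · filter_upwards [eventually_lt_nhds h] with y hy using shift_of_nonpos k k1 A hy.le
  · refine (hk.hasDerivAt_shiftPos_angle hA ⟨h, hψ.2⟩).congr_of_eventuallyEq ?_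
    filter_upwards [eventually_gt_nhds h] with y hy using shift_of_nonneg k k1 A hy.le

/-- A monotone form of the mean value inequality for `shift` against `radial`. -/
lemma abs_shift_sub_le (hk : IsSlowness k k1 k2 K L) {A c ε ψ₁ ψ₂ : ℝ} (hA : 0 < A)
    (h₁ : -(π / 2) ≤ ψ₁) (h₁₂ : ψ₁ ≤ ψ₂) (h₂ : ψ₂ ≤ π / 2)
    (hs : ∀ x ∈ Icc ψ₁ ψ₂, |slope k k1 L A x - c| ≤ ε) :
    |shift k k1 A ψ₂ - shift k k1 A ψ₁ - c * (radial k A ψ₂ - radial k A ψ₁)| ≤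
      ε * |radial k A ψ₂ - radial k A ψ₁| := by
  have hcs : Continuous (shift k k1 A) := by
    rw [continuous_iff_continuousAt]
    intro x
    exact ContinuousAt.comp (f := fun x : ℝ => (A, x)) (hk.continuousAt_shift (q := (A, x)) hA)
      (by fun_prop : Continuous fun x : ℝ => (A, x)).continuousAt
  have hcr : Continuous (radial k A) :=
    hk.continuous_radial.comp (f := fun x : ℝ => (A, x)) (by fun_prop)
  -- Only s = ±1 is used. The derivative is -H (ε + s (slope - c)), which is nonpositive since H ≥ 0
  -- and |slope - c| ≤ ε; no division by H, which vanishes at angle 0, is needed.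
  have main : ∀ s : ℝ, |s| ≤ 1 → AntitoneOn
      (fun x => ε * radial k A x + s * (shift k k1 A x - c * radial k A x)) (Icc ψ₁ ψ₂) := by
    intro s hs1
    have sub : ∀ a b : ℝ, ψ₁ ≤ a → b ≤ ψ₂ → (∀ x ∈ Ioo a b, x ≠ 0) → AntitoneOn
        (fun x => ε * radial k A x + s * (shift k k1 A x - c * radial k A x)) (Icc a b) := by
      intro a b ha hb h0
      have hder : ∀ x ∈ Ioo a b, HasDerivAt
          (fun x => ε * radial k A x + s * (shift k k1 A x - c * radial k A x))
          (-(hubbleLen k (A * sin x) * (ε + s * (slope k k1 L A x - c)))) x := by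
        intro x hx
        have h3 := hk.hasDerivAt_radial_angle A x
        have h4 := hk.hasDerivAt_shift_angle hA (ψ := x)
          ⟨by linarith [hx.1], by linarith [hx.2]⟩ (h0 x hx)
        exact ((h3.const_mul ε).add ((h4.sub (h3.const_mul c)).const_mul s)).congr_deriv (by ring)
      refine antitoneOn_of_deriv_nonpos (convex_Icc a b) ?_ ?_ ?_
      · exact Continuous.continuousOn (by fun_prop)
      · intro x hx
        rw [interior_Icc] at hx
        exact (hder x hx).differentiableAt.differentiableWithinAt
      · intro x hx
        rw [interior_Icc] at hx
        rw [(hder x hx).deriv, neg_nonpos]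
        refine mul_nonneg (hk.hubbleLen_nonneg _) ?_
        have h5 := hs x ⟨by linarith [hx.1], by linarith [hx.2]⟩
        have h6 : |s * (slope k k1 L A x - c)| ≤ ε := by
          rw [abs_mul]
          nlinarith [abs_nonneg s, abs_nonneg (slope k k1 L A x - c)]
        linarith [(_root_.abs_le.1 h6).1]
    -- The derivative formula for `shift` is known only off angle 0, so an interval containing 0 is
    -- cut there and the two monotone pieces are glued.
    by_cases h : ψ₁ ≤ 0 ∧ 0 ≤ ψ₂
    · have h3 := (sub ψ₁ 0 le_rfl h.2 fun x hx => hx.2.ne).union_right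
        (sub 0 ψ₂ h.1 le_rfl fun x hx => hx.1.ne') (isGreatest_Icc h.1) (isLeast_Icc h.2)
      rwa [Icc_union_Icc_eq_Icc h.1 h.2] at h3
    · refine sub ψ₁ ψ₂ le_rfl le_rfl fun x hx hx0 => h ?_
      subst hx0
      exact ⟨hx.1.le, hx.2.le⟩
  have hm1 : ψ₁ ∈ Icc ψ₁ ψ₂ := ⟨le_rfl, h₁₂⟩
  have hm2 : ψ₂ ∈ Icc ψ₁ ψ₂ := ⟨h₁₂, le_rfl⟩
  have hp := main 1 (by simp) hm1 hm2 h₁₂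
  have hn := main (-1) (by simp) hm1 hm2 h₁₂
  have hr : radial k A ψ₂ - radial k A ψ₁ ≤ 0 := by
    have : AntitoneOn (radial k A) (Icc ψ₁ ψ₂) := by
      refine antitoneOn_of_deriv_nonpos (convex_Icc _ _) hcr.continuousOn
        (fun x _ => (hk.hasDerivAt_radial_angle A x).differentiableAt.differentiableWithinAt) ?_
      intro x _
      rw [(hk.hasDerivAt_radial_angle A x).deriv]
      linarith [hk.hubbleLen_nonneg (A * sin x)]
    linarith [this hm1 hm2 h₁₂]
  rw [abs_of_nonpos hr, _root_.abs_le]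
  simp only at hp hn
  constructor <;> nlinarith

/-- The integrand H(A sin x) is positive except at x = 0, so a single critical angle does not spoil
strictness. -/
lemma strictAntiOn_radial (hk : IsSlowness k k1 k2 K L) {A : ℝ} (hA : 0 < A) :
    StrictAntiOn (radial k A) (Icc (-(π / 2)) (π / 2)) := by
  intro x hx y hy hxy
  have hc : Continuous fun x => hubbleLen k (A * sin x) :=
    hk.continuous_hubbleLen.comp (by fun_prop)
  have h1 : radial k A x = (∫ z in x..y, hubbleLen k (A * sin z)) + radial k A y :=
    (intervalIntegral.integral_add_adjacent_intervals (hc.intervalIntegrable _ _)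
      (hc.intervalIntegrable _ _)).symm
  have hne : ∀ z ∈ Icc (-(π / 2)) (π / 2), z ≠ 0 → 0 < hubbleLen k (A * sin z) := by
    intro z hz hz0
    refine hk.hubbleLen_pos (mul_ne_zero hA.ne' fun h => hz0 ?_)
    exact (sin_eq_zero_iff_of_lt_of_lt (by linarith [hz.1, pi_pos])
      (by linarith [hz.2, pi_pos])).1 h
  have h2 : 0 < ∫ z in x..y, hubbleLen k (A * sin z) := by
    refine intervalIntegral.integral_pos hxy hc.continuousOn
      (fun z _ => hk.hubbleLen_nonneg _) ?_
    by_cases h0 : x = 0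
    · exact ⟨y, ⟨hxy.le, le_rfl⟩, hne y hy (by rintro rfl; exact hxy.ne h0)⟩
    · exact ⟨x, ⟨le_rfl, hxy.le⟩, hne x hx h0⟩
  linarith

lemma radial_neg (hk : IsSlowness k k1 k2 K L) (A ψ : ℝ) :
    radial k A (-ψ) = 2 * radial k A 0 - radial k A ψ := by
  have hc : Continuous fun x => hubbleLen k (A * sin x) :=
    hk.continuous_hubbleLen.comp (by fun_prop)
  have h1 : radial k A (-ψ) = (∫ z in (-ψ)..0, hubbleLen k (A * sin z)) + radial k A 0 :=
    (intervalIntegral.integral_add_adjacent_intervals (hc.intervalIntegrable _ _)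
      (hc.intervalIntegrable _ _)).symm
  have h2 : radial k A 0 = (∫ z in 0..ψ, hubbleLen k (A * sin z)) + radial k A ψ :=
    (intervalIntegral.integral_add_adjacent_intervals (hc.intervalIntegrable _ _)
      (hc.intervalIntegrable _ _)).symm
  have h3 : ∫ z in (-ψ)..0, hubbleLen k (A * sin z) = ∫ z in 0..ψ, hubbleLen k (A * sin z) := by
    have := intervalIntegral.integral_comp_neg (a := 0) (b := ψ)
      (fun z => hubbleLen k (A * sin z))
    rw [neg_zero] at this
    rw [← this]
    simp [hubbleLen_neg]
  linarith

lemma bijOn_radial (hk : IsSlowness k k1 k2 K L) {A : ℝ} (hA : 0 < A) :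
    BijOn (radial k A) (Ioc (-(π / 2)) (π / 2)) (Ico 0 (2 * radial k A 0)) := by
  have hanti := hk.strictAntiOn_radial hA
  have hcr : Continuous (radial k A) :=
    hk.continuous_radial.comp (f := fun x : ℝ => (A, x)) (by fun_prop)
  have hbot : radial k A (-(π / 2)) = 2 * radial k A 0 := by
    rw [hk.radial_neg, radial_pi_div_two, sub_zero]
  have hle : -(π / 2) ≤ π / 2 := by linarith [pi_pos]
  have hml : -(π / 2) ∈ Icc (-(π / 2)) (π / 2) := ⟨le_rfl, hle⟩
  have hmr : π / 2 ∈ Icc (-(π / 2)) (π / 2) := ⟨hle, le_rfl⟩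
  refine ⟨fun x hx => ⟨?_, ?_⟩, (hanti.injOn).mono Ioc_subset_Icc_self, ?_⟩
  · rw [← radial_pi_div_two k A]
    exact hanti.antitoneOn ⟨hx.1.le, hx.2⟩ hmr hx.2
  · rw [← hbot]
    exact hanti hml ⟨hx.1.le, hx.2⟩ hx.1
  · intro ρ hρ
    have h1 := intermediate_value_Icc' hle (hcr.continuousOn (s := Icc (-(π / 2)) (π / 2)))
    rw [radial_pi_div_two, hbot] at h1
    obtain ⟨x, hx, rfl⟩ := h1 ⟨hρ.1, hρ.2.le⟩
    refine ⟨x, ⟨lt_of_le_of_ne hx.1 ?_, hx.2⟩, rfl⟩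
    rintro rfl
    exact absurd hbot hρ.2.ne

lemma angle_mem (hk : IsSlowness k k1 k2 K L) {q : ℝ × ℝ} (hq : q ∈ radialDomain k) :
    angle k q.1 q.2 ∈ Ioc (-(π / 2)) (π / 2) :=
  Function.invFunOn_mem ((hk.bijOn_radial hq.1).surjOn hq.2)

lemma radial_angle (hk : IsSlowness k k1 k2 K L) {q : ℝ × ℝ} (hq : q ∈ radialDomain k) :
    radial k q.1 (angle k q.1 q.2) = q.2 :=
  Function.invFunOn_eq ((hk.bijOn_radial hq.1).surjOn hq.2)

lemma angle_radial (hk : IsSlowness k k1 k2 K L) {A ψ : ℝ} (hA : 0 < A)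
    (hψ : ψ ∈ Ioc (-(π / 2)) (π / 2)) : angle k A (radial k A ψ) = ψ :=
  (hk.bijOn_radial hA).injOn.leftInvOn_invFunOn hψ

lemma radial_zero_pos (hk : IsSlowness k k1 k2 K L) {A : ℝ} (hA : 0 < A) : 0 < radial k A 0 := by
  have := hk.strictAntiOn_radial hA (a := 0) (b := π / 2) ⟨by linarith [pi_pos], by positivity⟩
    ⟨by linarith [pi_pos], le_rfl⟩ (by positivity)
  rwa [radial_pi_div_two] at this

lemma angle_zero (hk : IsSlowness k k1 k2 K L) {A : ℝ} (hA : 0 < A) : angle k A 0 = π / 2 := by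
  have := hk.angle_radial hA (ψ := π / 2) ⟨by linarith [pi_pos], le_rfl⟩
  rwa [radial_pi_div_two] at this

/-- An implicit function theorem would fail at angle 0, where the derivative of `radial` vanishes.
Order is used instead: strict inequalities between ρ and `radial` at a fixed angle persist for
nearby pairs, and monotonicity converts them into bounds on the angle. -/
lemma continuousOn_angle (hk : IsSlowness k k1 k2 K L) :
    ContinuousOn (fun q : ℝ × ℝ => angle k q.1 q.2) (radialDomain k) := by
  intro q hq
  have hmem := hk.angle_mem hq
  have hrad := hk.radial_angle hq
  have hanti := hk.strictAntiOn_radial hq.1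
  have hcont : ∀ c : ℝ, Continuous fun p : ℝ × ℝ => radial k p.1 c := fun c =>
    hk.continuous_radial.comp (f := fun p : ℝ × ℝ => (p.1, c)) (by fun_prop)
  have hmem' : angle k q.1 q.2 ∈ Icc (-(π / 2)) (π / 2) := ⟨hmem.1.le, hmem.2⟩
  refine tendsto_order.2 ⟨fun a ha => ?_, fun b hb => ?_⟩
  -- The lower bound is raised to -π/2 because strict monotonicity of `radial` is known only on
  -- [-π/2, π/2].
  · set a' := max a (-(π / 2)) with ha'
    have ha1 : a' < angle k q.1 q.2 := max_lt ha hmem.1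
    have ha2 : a' ∈ Icc (-(π / 2)) (π / 2) := ⟨le_max_right _ _, ha1.le.trans hmem.2⟩
    have h1 : q.2 < radial k q.1 a' := by
      have := hanti ha2 hmem' ha1
      rwa [hrad] at this
    have h2 : ∀ᶠ p : ℝ × ℝ in 𝓝[radialDomain k] q, p.2 < radial k p.1 a' :=
      mem_nhdsWithin_of_mem_nhds
        ((isOpen_lt continuous_snd (hcont a')).mem_nhds h1)
    filter_upwards [h2, self_mem_nhdsWithin] with p hp hpS
    have hpm := hk.angle_mem hpS
    refine (le_max_left _ _).trans_lt (?_ : a' < _)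
    by_contra! hcon
    have := (hk.strictAntiOn_radial hpS.1).antitoneOn ⟨hpm.1.le, hpm.2⟩ ha2 hcon
    rw [hk.radial_angle hpS] at this
    linarith
  · rcases lt_or_ge (π / 2) b with hb2 | hb2
    · filter_upwards [self_mem_nhdsWithin] with p hpS
      exact (hk.angle_mem hpS).2.trans_lt hb2
    · have hb3 : b ∈ Icc (-(π / 2)) (π / 2) := ⟨hmem.1.le.trans hb.le, hb2⟩
      have h1 : radial k q.1 b < q.2 := by
        have := hanti hmem' hb3 hb
        rwa [hrad] at this
      have h2 : ∀ᶠ p : ℝ × ℝ in 𝓝[radialDomain k] q, radial k p.1 b < p.2 :=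
        mem_nhdsWithin_of_mem_nhds
          ((isOpen_lt (hcont b) continuous_snd).mem_nhds h1)
      filter_upwards [h2, self_mem_nhdsWithin] with p hp hpS
      have hpm := hk.angle_mem hpS
      by_contra! hcon
      have := (hk.strictAntiOn_radial hpS.1).antitoneOn hb3 ⟨hpm.1.le, hpm.2⟩ hcon
      rw [hk.radial_angle hpS] at this
      linarith

end IsSlowness

end RWFermi

/-! ### Continuous differentiability of f in the pair (A, ρ). -/

namespace RWFermi

open MeasureTheory Real Asymptotics

/-- `f` as a function of `A = a(τ)` and of the proper distance. -/
noncomputable def shiftDist (k k1 : ℝ → ℝ) (A ρ : ℝ) : ℝ := shift k k1 A (angle k A ρ)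

/-- The derivative of `shiftDist`. -/
noncomputable def shiftDistDeriv (k k1 k2 : ℝ → ℝ) (L : ℝ) (q : ℝ × ℝ) : ℝ × ℝ →L[ℝ] ℝ :=
  (shiftDeriv k1 k2 q.1 (angle k q.1 q.2) - slope k k1 L q.1 (angle k q.1 q.2) *
      radialDeriv k k1 q.1 (angle k q.1 q.2)) • ContinuousLinearMap.fst ℝ ℝ ℝ +
    slope k k1 L q.1 (angle k q.1 q.2) • ContinuousLinearMap.snd ℝ ℝ ℝ

/-- The interior of `radialDomain`. -/
def radialDomainPos (k : ℝ → ℝ) : Set (ℝ × ℝ) :=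
  {q | 0 < q.1 ∧ 0 < q.2 ∧ q.2 < 2 * radial k q.1 0}

lemma radialDomainPos_subset (k : ℝ → ℝ) : radialDomainPos k ⊆ radialDomain k :=
  fun _ hq => ⟨hq.1, hq.2.1.le, hq.2.2⟩

namespace IsSlowness

variable {k k1 k2 : ℝ → ℝ} {K L : ℝ}

lemma isOpen_radialDomainPos (hk : IsSlowness k k1 k2 K L) : IsOpen (radialDomainPos k) := by
  have h : Continuous fun p : ℝ × ℝ => radial k p.1 0 :=
    hk.continuous_radial.comp (f := fun p : ℝ × ℝ => (p.1, 0)) (by fun_prop)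
  exact (isOpen_lt continuous_const continuous_fst).inter
    ((isOpen_lt continuous_const continuous_snd).inter
      (isOpen_lt continuous_snd (continuous_const.mul h)))

lemma continuousOn_angle_pair (hk : IsSlowness k k1 k2 K L) :
    ContinuousOn (fun q : ℝ × ℝ => (q.1, angle k q.1 q.2)) (radialDomain k) :=
  continuousOn_fst.prodMk hk.continuousOn_angle

lemma continuousOn_shiftDist (hk : IsSlowness k k1 k2 K L) :
    ContinuousOn (fun q : ℝ × ℝ => shiftDist k k1 q.1 q.2) (radialDomain k) := by
  intro q hq
  exact ContinuousAt.comp_continuousWithinAt (f := fun q : ℝ × ℝ => (q.1, angle k q.1 q.2))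
    (hk.continuousAt_shift (q := (q.1, angle k q.1 q.2)) hq.1) (hk.continuousOn_angle_pair q hq)

lemma continuousOn_slope_angle (hk : IsSlowness k k1 k2 K L) :
    ContinuousOn (fun q : ℝ × ℝ => slope k k1 L q.1 (angle k q.1 q.2)) (radialDomain k) := by
  intro q hq
  exact ContinuousAt.comp_continuousWithinAt (f := fun q : ℝ × ℝ => (q.1, angle k q.1 q.2))
    (hk.continuousAt_slope (q := (q.1, angle k q.1 q.2)) hq.1) (hk.continuousOn_angle_pair q hq)

lemma continuousOn_shiftDistDeriv (hk : IsSlowness k k1 k2 K L) :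
    ContinuousOn (shiftDistDeriv k k1 k2 L) (radialDomain k) := by
  have h1 : ContinuousOn (fun q : ℝ × ℝ => shiftDeriv k1 k2 q.1 (angle k q.1 q.2))
      (radialDomain k) :=
    ContinuousOn.comp (f := fun q : ℝ × ℝ => (q.1, angle k q.1 q.2)) hk.continuousOn_shiftDeriv
      hk.continuousOn_angle_pair
      fun q hq => mk_mem_prod hq.1 (Ioc_subset_Icc_self (hk.angle_mem hq))
  have h2 : ContinuousOn (fun q : ℝ × ℝ => radialDeriv k k1 q.1 (angle k q.1 q.2))
      (radialDomain k) := by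
    intro q hq
    exact ContinuousAt.comp_continuousWithinAt (f := fun q : ℝ × ℝ => (q.1, angle k q.1 q.2))
      (hk.continuousAt_radialDeriv (q := (q.1, angle k q.1 q.2)) hq.1)
      (hk.continuousOn_angle_pair q hq)
  have h3 := hk.continuousOn_slope_angle
  exact ((h1.sub (h3.mul h2)).smul continuousOn_const).add (h3.smul continuousOn_const)

/-- At π/2 the bending integral vanishes and k(A) cancels against 1/k(A). Together with the
vanishing of `shiftDeriv` at π/2 this kills the derivative of f on the worldline. -/
lemma slope_pi_div_two (hk : IsSlowness k k1 k2 K L) {A : ℝ} (hA : 0 < A) :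
    slope k k1 L A (π / 2) = 0 := by
  have := (hk.pos A hA).ne'
  rw [slope, abs_of_pos (by positivity), bend_pi_div_two, sin_pi_div_two, mul_one, invSlow,
    if_neg hA.ne', abs_of_pos hA]
  field_simp
  simp

lemma shift_pi_div_two (k k1 : ℝ → ℝ) {A : ℝ} (hA : 0 < A) : shift k k1 A (π / 2) = 0 := by
  rw [shift_of_nonneg _ _ _ (by positivity), shiftPos, sin_pi_div_two, cos_pi_div_two, mul_one,
    hubbleLen_of_nonneg k hA.le]
  field_simp
  simp

lemma shiftDeriv_pi_div_two (k1 k2 : ℝ → ℝ) {A : ℝ} (hA : 0 < A) :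
    shiftDeriv k1 k2 A (π / 2) = 0 := by
  rw [shiftDeriv, max_eq_left (by positivity), max_eq_right (by linarith [pi_pos]),
    add_sub_cancel_right, shiftPosDeriv, sin_pi_div_two, cos_pi_div_two, mul_one,
    sqDeriv_of_nonneg k1 hA.le]
  field_simp
  simp

lemma shiftDist_zero (hk : IsSlowness k k1 k2 K L) {A : ℝ} (hA : 0 < A) :
    shiftDist k k1 A 0 = 0 := by
  rw [shiftDist, hk.angle_zero hA, shift_pi_div_two _ _ hA]

lemma shiftDistDeriv_zero (hk : IsSlowness k k1 k2 K L) {A : ℝ} (hA : 0 < A) :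
    shiftDistDeriv k k1 k2 L (A, 0) = 0 := by
  simp [shiftDistDeriv, hk.angle_zero hA, hk.slope_pi_div_two hA, shiftDeriv_pi_div_two _ _ hA]

lemma mem_radialDomain_zero (hk : IsSlowness k k1 k2 K L) {A : ℝ} (hA : 0 < A) :
    (A, (0 : ℝ)) ∈ radialDomain k :=
  ⟨hA, le_rfl, by linarith [hk.radial_zero_pos hA]⟩

/-- Valid across the big bang and, one-sidedly, at ρ = 0, although `angle` itself need not be
differentiable. No derivative of `angle` is taken: its continuity and the comparison of increments
suffice. -/
lemma hasFDerivWithinAt_shiftDist (hk : IsSlowness k k1 k2 K L) {q₀ : ℝ × ℝ}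
    (hq₀ : q₀ ∈ radialDomain k) :
    HasFDerivWithinAt (fun q : ℝ × ℝ => shiftDist k k1 q.1 q.2) (shiftDistDeriv k k1 k2 L q₀)
      (radialDomain k) q₀ := by
  obtain ⟨A, ρ⟩ := q₀
  have hA : 0 < A := hq₀.1
  have hψ := hk.angle_mem hq₀
  have hrad := hk.radial_angle hq₀
  simp only at hψ hrad
  set ψ := angle k A ρ with hψdef
  set c := slope k k1 L A ψ with hc
  have hS : HasFDerivAt (fun q : ℝ × ℝ => shift k k1 q.1 ψ)
      (shiftDeriv k1 k2 A ψ • ContinuousLinearMap.fst ℝ ℝ ℝ) (A, ρ) :=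
    HasDerivAt.comp_hasFDerivAt (f := fun q : ℝ × ℝ => q.1) (h₂ := fun A => shift k k1 A ψ) (A, ρ)
      (hk.hasDerivAt_shift hA ⟨hψ.1.le, hψ.2⟩) hasFDerivAt_fst
  have hR : HasFDerivAt (fun q : ℝ × ℝ => radial k q.1 ψ)
      (radialDeriv k k1 A ψ • ContinuousLinearMap.fst ℝ ℝ ℝ) (A, ρ) :=
    HasDerivAt.comp_hasFDerivAt (f := fun q : ℝ × ℝ => q.1) (h₂ := fun A => radial k A ψ) (A, ρ)
      (hk.hasDerivAt_radial hA hψ.1.le hψ.2) hasFDerivAt_fst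
  have hRd : HasFDerivAt (fun q : ℝ × ℝ => q.2 - radial k q.1 ψ)
      (ContinuousLinearMap.snd ℝ ℝ ℝ - radialDeriv k k1 A ψ • ContinuousLinearMap.fst ℝ ℝ ℝ)
      (A, ρ) := hasFDerivAt_snd.sub hR
  -- Both subtracted terms keep the angle frozen at ψ and are differentiable in (A, ρ). Since ρ is
  -- `radial` at the moving angle, E compares the increments of `shift` and `radial` between ψ and
  -- that angle.
  set E : ℝ × ℝ → ℝ := fun q => shiftDist k k1 q.1 q.2 - shift k k1 q.1 ψ -
    c * (q.2 - radial k q.1 ψ) with hEdef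
  have hE0 : E (A, ρ) = 0 := by
    simp [hEdef, shiftDist, ← hψdef, hrad]
  have hlit : E =o[𝓝[radialDomain k] (A, ρ)] fun q => q.2 - radial k q.1 ψ := by
    refine isLittleO_iff.2 fun ε hε => ?_
    have hsc := hk.continuousAt_slope (q := (A, ψ)) hA
    obtain ⟨δ, hδ, hδs⟩ := Metric.continuousAt_iff.1 hsc ε hε
    have hang := Metric.continuousWithinAt_iff.1 (hk.continuousOn_angle (A, ρ) hq₀) δ hδ
    obtain ⟨δ', hδ', hδa⟩ := hang
    filter_upwards [self_mem_nhdsWithin, mem_nhdsWithin_of_mem_nhds (Metric.ball_mem_nhds _ hδ'),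
      mem_nhdsWithin_of_mem_nhds (Metric.ball_mem_nhds _ hδ)] with q hqS hq1 hq2
    have hqA : 0 < q.1 := hqS.1
    have hqm := hk.angle_mem hqS
    have hqr := hk.radial_angle hqS
    have hqa := hδa hqS hq1
    have hd1 : |q.1 - A| < δ := by
      have := (max_lt_iff.1 (Prod.dist_eq.symm.trans_lt (Metric.mem_ball.1 hq2))).1
      rwa [Real.dist_eq] at this
    set χ := angle k q.1 q.2 with hχ
    rw [Real.dist_eq, ← hψdef] at hqa
    have hslope : ∀ x, |x - ψ| ≤ |χ - ψ| → |slope k k1 L q.1 x - c| ≤ ε := by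
      intro x hx
      have := hδs (x := (q.1, x)) (by
        rw [Prod.dist_eq]
        exact max_lt (by rwa [Real.dist_eq]) (by rw [Real.dist_eq]; exact hx.trans_lt hqa))
      rw [Real.dist_eq] at this
      exact this.le
    have hEq : E q = shift k k1 q.1 χ - shift k k1 q.1 ψ -
        c * (radial k q.1 χ - radial k q.1 ψ) := by
      simp only [hEdef, shiftDist, ← hχ, hqr]
    rw [Real.norm_eq_abs, Real.norm_eq_abs, hEq, ← hqr]
    rcases le_total ψ χ with h | h
    · refine hk.abs_shift_sub_le hqA hψ.1.le h hqm.2 fun x hx => hslope x ?_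
      rw [abs_of_nonneg (by linarith [hx.1]), abs_of_nonneg (by linarith)]
      linarith [hx.2]
    · have := hk.abs_shift_sub_le (L := L) (c := c) (ε := ε) hqA hqm.1.le h hψ.2
        fun x hx => hslope x (by
          rw [abs_of_nonpos (by linarith [hx.2]), abs_of_nonpos (by linarith)]
          linarith [hx.1])
      rw [abs_sub_comm (radial k q.1 ψ)] at this
      refine le_of_eq_of_le ?_ this
      rw [← abs_neg]
      congr 1
      ring
  have hE : HasFDerivWithinAt E (0 : ℝ × ℝ →L[ℝ] ℝ) (radialDomain k) (A, ρ) := by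
    rw [hasFDerivWithinAt_iff_isLittleO]
    have h1 := hRd.isBigO_sub.mono (nhdsWithin_le_nhds (s := radialDomain k))
    simp only [hrad, sub_self, sub_zero] at h1
    simpa [hE0] using hlit.trans_isBigO h1
  have htot := (hE.add hS.hasFDerivWithinAt).add (hRd.const_mul c).hasFDerivWithinAt
  refine (htot.congr_fderiv ?_).congr_of_eventuallyEq ?_ ?_
  · rw [shiftDistDeriv, ← hψdef, ← hc]
    ext <;> simp
    ring
  · filter_upwards with q
    simp only [hEdef, Pi.add_apply]
    ring
  · simp only [hEdef, Pi.add_apply]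
    ring

lemma contDiffOn_shiftDist (hk : IsSlowness k k1 k2 K L) :
    ContDiffOn ℝ 1 (fun q : ℝ × ℝ => shiftDist k k1 q.1 q.2) (radialDomainPos k) := by
  have hder : ∀ q ∈ radialDomainPos k, HasFDerivAt (fun q : ℝ × ℝ => shiftDist k k1 q.1 q.2)
      (shiftDistDeriv k k1 k2 L q) q := fun q hq =>
    (hk.hasFDerivWithinAt_shiftDist (radialDomainPos_subset k hq)).hasFDerivAt
      (mem_of_superset (hk.isOpen_radialDomainPos.mem_nhds hq) (radialDomainPos_subset k))
  rw [show (1 : WithTop ℕ∞) = 0 + 1 from (zero_add 1).symm,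
    contDiffOn_succ_iff_fderiv_of_isOpen hk.isOpen_radialDomainPos]
  refine ⟨fun q hq => (hder q hq).differentiableAt.differentiableWithinAt, by simp, ?_⟩
  rw [contDiffOn_zero]
  exact (hk.continuousOn_shiftDistDeriv.mono (radialDomainPos_subset k)).congr
    fun q hq => (hder q hq).fderiv

end IsSlowness

end RWFermi

/-! ### The areal radius: behaviour at the big bang and expansion at the worldline. -/

namespace RWFermi

open MeasureTheory Real

/-- The square root of `a(t₀)² χ²` as a function of `A = a(τ)` and of the angle. -/
noncomputable def areal (k : ℝ → ℝ) (A ψ : ℝ) : ℝ :=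
  sin ψ * ∫ x in ψ..π / 2, hubbleLen k (A * sin x) / sin x ^ 2

lemma hasDerivAt_neg_cot {x : ℝ} (hx : sin x ≠ 0) :
    HasDerivAt (fun x => -(cos x / sin x)) (1 / sin x ^ 2) x := by
  refine (((hasDerivAt_cos x).div (hasDerivAt_sin x) hx).neg).congr_deriv ?_
  field_simp
  linear_combination sin_sq_add_cos_sq x

lemma sin_pos_of_mem {ψ x : ℝ} (h0 : 0 < ψ) (hx : x ∈ Icc ψ (π / 2)) : 0 < sin x :=
  sin_pos_of_pos_of_lt_pi (h0.trans_le hx.1) (by linarith [hx.2, pi_pos])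

lemma integral_inv_sin_sq {ψ : ℝ} (h0 : 0 < ψ) (h1 : ψ ≤ π / 2) :
    IntervalIntegrable (fun x => 1 / sin x ^ 2) volume ψ (π / 2) ∧
      ∫ x in ψ..π / 2, 1 / sin x ^ 2 = cos ψ / sin ψ := by
  have hc : ContinuousOn (fun x => 1 / sin x ^ 2) (Icc ψ (π / 2)) :=
    continuousOn_const.div (continuous_sin.continuousOn.pow 2)
      fun x hx => pow_ne_zero 2 (sin_pos_of_mem h0 hx).ne'
  have hi := hc.intervalIntegrable_of_Icc h1 (μ := volume)
  refine ⟨hi, ?_⟩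
  rw [intervalIntegral.integral_eq_sub_of_hasDerivAt (f := fun x => -(cos x / sin x))
    (fun x hx => ?_) hi]
  · simp
  · rw [uIcc_of_le h1] at hx
    exact hasDerivAt_neg_cot (sin_pos_of_mem h0 hx).ne'

/-- From cos η ≤ sin x ≤ 1 the quotient lies between cos η and 1/cos η, and both are within η² of 1
for η ≤ π/3. -/
lemma abs_sin_div_sub_one_le {η x : ℝ} (h1 : η ≤ π / 3)
    (hx : x ∈ Icc (π / 2 - η) (π / 2)) : |cos η / sin x ^ 2 - 1| ≤ η ^ 2 := by
  have hη : 0 ≤ η := by linarith [hx.1, hx.2]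
  have hs : cos η ≤ sin x := by
    rw [← sin_pi_div_two_sub]
    exact sin_le_sin_of_le_of_le_pi_div_two (by linarith [pi_pos]) hx.2 hx.1
  have hc : 1 / 2 ≤ cos η := by
    rw [← cos_pi_div_three]
    exact cos_le_cos_of_nonneg_of_le_pi hη (by linarith [pi_pos]) h1
  have hc2 := one_sub_sq_div_two_le_cos (x := η)
  have hs1 := sin_le_one x
  have hsq : 0 < sin x ^ 2 := by nlinarith
  rw [abs_le]
  constructor
  · have : cos η ≤ cos η / sin x ^ 2 := by
      rw [le_div_iff₀ hsq]
      exact mul_le_of_le_one_right (by linarith) (by nlinarith)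
    nlinarith [sq_nonneg η]
  · rw [sub_le_iff_le_add, div_le_iff₀ hsq]
    have h2 : 1 ≤ (η ^ 2 + 1) * cos η := by
      -- For η² ≤ 1 the bound cos η ≥ 1 - η²/2 suffices; beyond that cos η ≥ 1/2 does.
      rcases le_total (η ^ 2) 1 with h | h
      · nlinarith [sq_nonneg η]
      · nlinarith
    have h3 : 1 ≤ (η ^ 2 + 1) * sin x :=
      h2.trans (mul_le_mul_of_nonneg_left hs (by positivity))
    nlinarith

namespace IsSlowness

variable {k k1 k2 : ℝ → ℝ} {K L : ℝ}

lemma continuousOn_areal_integrand (hk : IsSlowness k k1 k2 K L) (A : ℝ) {ψ : ℝ} (h0 : 0 < ψ) :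
    ContinuousOn (fun x => hubbleLen k (A * sin x) / sin x ^ 2) (Icc ψ (π / 2)) :=
  ContinuousOn.div (hk.continuous_hubbleLen.comp (by fun_prop)).continuousOn
    (continuous_sin.continuousOn.pow 2) fun x hx => pow_ne_zero 2 (sin_pos_of_mem h0 hx).ne'

lemma areal_nonneg (hk : IsSlowness k k1 k2 K L) (A : ℝ) {ψ : ℝ} (h : ψ ∈ Icc 0 (π / 2)) :
    0 ≤ areal k A ψ := by
  refine mul_nonneg (sin_nonneg_of_nonneg_of_le_pi h.1 (by linarith [h.2, pi_pos])) ?_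
  exact intervalIntegral.integral_nonneg h.2 fun x _ =>
    div_nonneg (hk.hubbleLen_nonneg _) (sq_nonneg _)

/-- The integrand is bounded by H(A sin d)/sin² x where sin x ≤ sin d and by H(A)/sin² d elsewhere;
adding the two bounds avoids cutting the interval. Since sin ψ times the integral of 1/sin² is cos ψ
≤ 1, the first part is small for small d, and the second then for small ψ. -/
lemma areal_le (hk : IsSlowness k k1 k2 K L) (A : ℝ) {ψ d : ℝ} (h : ψ ∈ Icc 0 (π / 2))
    (hd0 : 0 < d) (hd1 : d ≤ π / 2) :
    areal k A ψ ≤ hubbleLen k (A * sin d) +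
      sin ψ * (hubbleLen k A / sin d ^ 2 * (π / 2)) := by
  have hsd : 0 < sin d := sin_pos_of_mem hd0 ⟨le_rfl, hd1⟩
  rcases h.1.eq_or_lt with h0 | h0
  · subst h0
    simpa [areal] using hk.hubbleLen_nonneg _
  have hsψ : 0 < sin ψ := sin_pos_of_mem h0 ⟨le_rfl, h.2⟩
  obtain ⟨hi, hI⟩ := integral_inv_sin_sq h0 h.2
  have h1 : ∫ x in ψ..π / 2, hubbleLen k (A * sin x) / sin x ^ 2 ≤
      ∫ x in ψ..π / 2, (hubbleLen k (A * sin d) * (1 / sin x ^ 2) +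
        hubbleLen k A / sin d ^ 2) := by
    refine intervalIntegral.integral_mono_on h.2
      ((hk.continuousOn_areal_integrand A h0).intervalIntegrable_of_Icc h.2)
      ((hi.const_mul _).add intervalIntegrable_const) fun x hx => ?_
    have hsx := sin_pos_of_mem h0 hx
    rcases le_total (sin x) (sin d) with hle | hle
    · have h2 : hubbleLen k (A * sin x) ≤ hubbleLen k (A * sin d) := by
        refine hk.hubbleLen_le ?_
        rw [abs_mul, abs_mul, abs_of_pos hsx, abs_of_pos hsd]
        exact mul_le_mul_of_nonneg_left hle (abs_nonneg A)
      have h3 : 0 ≤ hubbleLen k A / sin d ^ 2 :=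
        div_nonneg (hk.hubbleLen_nonneg _) (sq_nonneg _)
      have h4 : hubbleLen k (A * sin x) / sin x ^ 2 ≤
          hubbleLen k (A * sin d) * (1 / sin x ^ 2) := by
        rw [mul_one_div]
        exact div_le_div_of_nonneg_right h2 (sq_nonneg _)
      linarith
    · have h2 : hubbleLen k (A * sin x) ≤ hubbleLen k A := by
        refine hk.hubbleLen_le ?_
        rw [abs_mul, abs_of_pos hsx]
        exact mul_le_of_le_one_right (abs_nonneg A) (sin_le_one x)
      have h3 : 0 ≤ hubbleLen k (A * sin d) * (1 / sin x ^ 2) :=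
        mul_nonneg (hk.hubbleLen_nonneg _) (by positivity)
      have h4 : hubbleLen k (A * sin x) / sin x ^ 2 ≤ hubbleLen k A / sin d ^ 2 :=
        div_le_div₀ (hk.hubbleLen_nonneg _) h2 (by positivity)
          (pow_le_pow_left₀ hsd.le hle 2)
      linarith
  rw [intervalIntegral.integral_add (hi.const_mul _) intervalIntegrable_const,
    intervalIntegral.integral_const_mul, hI, intervalIntegral.integral_const, smul_eq_mul] at h1
  have h2 := mul_le_mul_of_nonneg_left h1 hsψ.le
  have h3 : sin ψ * (hubbleLen k (A * sin d) * (cos ψ / sin ψ)) =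
      hubbleLen k (A * sin d) * cos ψ := by field_simp
  have h4 : hubbleLen k (A * sin d) * cos ψ ≤ hubbleLen k (A * sin d) :=
    mul_le_of_le_one_right (hk.hubbleLen_nonneg _) (cos_le_one ψ)
  have h5 : (π / 2 - ψ) * (hubbleLen k A / sin d ^ 2) ≤ hubbleLen k A / sin d ^ 2 * (π / 2) := by
    rw [mul_comm]
    exact mul_le_mul_of_nonneg_left (by linarith)
      (div_nonneg (hk.hubbleLen_nonneg _) (sq_nonneg _))
  have h6 := mul_le_mul_of_nonneg_left h5 hsψ.le
  rw [areal]
  rw [mul_add] at h2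
  linarith

lemma continuousOn_areal (hk : IsSlowness k k1 k2 K L) :
    ContinuousOn (fun q : ℝ × ℝ => areal k q.1 q.2) (univ ×ˢ Icc 0 (π / 2)) := by
  rintro ⟨A, ψ⟩ ⟨-, hψ⟩
  simp only at hψ
  rcases hψ.1.eq_or_lt with h0 | h0
  · subst h0
    have h00 : areal k A 0 = 0 := by simp [areal]
    rw [ContinuousWithinAt, h00]
    refine tendsto_order.2 ⟨fun a ha => ?_, fun b hb => ?_⟩
    · filter_upwards [self_mem_nhdsWithin] with q hq
      exact ha.trans_le (hk.areal_nonneg q.1 hq.2)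
    · have hlim : ContinuousAt (fun d => hubbleLen k (A * sin d)) 0 :=
        (hk.continuous_hubbleLen.comp (by fun_prop)).continuousAt
      have hlt : ∀ᶠ d in 𝓝 (0 : ℝ), hubbleLen k (A * sin d) < b :=
        hlim.eventually_lt continuousAt_const (by simpa [hubbleLen] using hb)
      -- The cutoff d is chosen from the central value A alone; the bound of `areal_le` is then
      -- continuous in (A, ψ) and stays below b nearby.
      obtain ⟨d, hdb, hd0, hd1⟩ : ∃ d, hubbleLen k (A * sin d) < b ∧ 0 < d ∧ d < π / 2 := by
        have h1 : ∀ᶠ d in 𝓝[>] (0 : ℝ), d < π / 2 :=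
          mem_nhdsWithin_of_mem_nhds (Iio_mem_nhds (by positivity))
        have h2 := ((hlt.filter_mono nhdsWithin_le_nhds).and
          (eventually_mem_nhdsWithin.and h1)).exists
        obtain ⟨d, h3, h4, h5⟩ := h2
        exact ⟨d, h3, h4, h5⟩
      have hc : Continuous fun q : ℝ × ℝ => hubbleLen k (q.1 * sin d) +
          sin q.2 * (hubbleLen k q.1 / sin d ^ 2 * (π / 2)) := by
        have h1 : Continuous fun q : ℝ × ℝ => hubbleLen k (q.1 * sin d) :=
          hk.continuous_hubbleLen.comp (by fun_prop)
        have h2 : Continuous fun q : ℝ × ℝ => hubbleLen k q.1 :=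
          hk.continuous_hubbleLen.comp continuous_fst
        fun_prop
      have hev : ∀ᶠ q in 𝓝 (A, (0 : ℝ)), hubbleLen k (q.1 * sin d) +
          sin q.2 * (hubbleLen k q.1 / sin d ^ 2 * (π / 2)) < b :=
        hc.continuousAt.eventually_lt continuousAt_const (by simpa using hdb)
      filter_upwards [self_mem_nhdsWithin, hev.filter_mono nhdsWithin_le_nhds] with q hq hqb
      exact (hk.areal_le q.1 hq.2 hd0 hd1.le).trans_lt hqb
  -- Near ψ > 0 the integration stays above ψ/2, so replacing sin x by its maximum with sin d
  -- changes nothing and gives a globally continuous integrand.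
  · set d := ψ / 2 with hd
    have hd0 : 0 < d := by positivity
    have hsd : 0 < sin d := sin_pos_of_mem hd0 ⟨le_rfl, by linarith [hψ.2, pi_pos]⟩
    have hc : Continuous fun q : ℝ × ℝ =>
        sin q.2 * ∫ x in q.2..π / 2, hubbleLen k (q.1 * sin x) / max (sin x) (sin d) ^ 2 := by
      refine (by fun_prop : Continuous fun q : ℝ × ℝ => sin q.2).mul
        (continuous_integral_left (f := fun (q : ℝ × ℝ) x =>
          hubbleLen k (q.1 * sin x) / max (sin x) (sin d) ^ 2) ?_ continuous_snd _)
      refine Continuous.div (hk.continuous_hubbleLen.comp (by fun_prop)) (by fun_prop)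
        fun q => pow_ne_zero 2 (lt_max_of_lt_right hsd).ne'
    refine hc.continuousWithinAt.congr_of_eventuallyEq ?_ ?_
    · have hnear : ∀ᶠ q : ℝ × ℝ in 𝓝 (A, ψ), d < q.2 :=
        continuousAt_const.eventually_lt continuousAt_snd (by simp only; linarith)
      filter_upwards [self_mem_nhdsWithin, hnear.filter_mono nhdsWithin_le_nhds] with q hq hqd
      rw [areal]
      congr 1
      refine intervalIntegral.integral_congr fun x hx => ?_
      rw [uIcc_of_le hq.2.2] at hx
      rw [max_eq_left (sin_le_sin_of_le_of_le_pi_div_two (by linarith [pi_pos]) hx.2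
        (by linarith [hx.1]))]
    · simp only [areal]
      congr 1
      refine intervalIntegral.integral_congr fun x hx => ?_
      rw [uIcc_of_le hψ.2] at hx
      rw [max_eq_left (sin_le_sin_of_le_of_le_pi_div_two (by linarith [pi_pos]) hx.2
        (by linarith [hx.1]))]

lemma abs_radial_sub_le (hk : IsSlowness k k1 k2 K L) {A h ε η : ℝ} (h0 : 0 ≤ η)
    (hε : ∀ x ∈ Icc (π / 2 - η) (π / 2), |hubbleLen k (A * sin x) - h| ≤ ε) :
    |radial k A (π / 2 - η) - h * η| ≤ ε * η := by
  have hc : Continuous fun x => hubbleLen k (A * sin x) :=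
    hk.continuous_hubbleLen.comp (by fun_prop)
  have h1 := intervalIntegral.norm_integral_le_of_norm_le_const (a := π / 2 - η) (b := π / 2)
    (C := ε) (f := fun x => hubbleLen k (A * sin x) - h) (by
      rw [uIoc_of_le (by linarith)]
      exact fun x hx => hε x ⟨hx.1.le, hx.2⟩)
  rw [intervalIntegral.integral_sub (hc.intervalIntegrable _ _) intervalIntegrable_const,
    intervalIntegral.integral_const, sub_sub_cancel, abs_of_nonneg h0, Real.norm_eq_abs,
    smul_eq_mul, mul_comm η] at h1
  exact h1

/-- With H replaced by a constant h, `areal` would be h sin η and `radial` h η. The remainder is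
exactly the integral of (H - h)(cos η / sin² x - 1), a product of factors bounded by ε and η² on an
interval of length η. Only continuity of H is used, yet the error has the order η³ that λ₀ requires.
-/
lemma abs_areal_sub_le (hk : IsSlowness k k1 k2 K L) {A h ε η : ℝ} (h0 : 0 ≤ η) (h1 : η ≤ π / 3)
    (hε : ∀ x ∈ Icc (π / 2 - η) (π / 2), |hubbleLen k (A * sin x) - h| ≤ ε) :
    |areal k A (π / 2 - η) - radial k A (π / 2 - η) - h * (sin η - η)| ≤ ε * η ^ 2 * η := by
  have hψ : 0 < π / 2 - η := by linarith [pi_pos]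
  have hle : π / 2 - η ≤ π / 2 := by linarith
  have hc : Continuous fun x => hubbleLen k (A * sin x) :=
    hk.continuous_hubbleLen.comp (by fun_prop)
  have hi1 := (hk.continuousOn_areal_integrand A hψ).intervalIntegrable_of_Icc hle (μ := volume)
  obtain ⟨hi2, hI⟩ := integral_inv_sin_sq hψ hle
  rw [cos_pi_div_two_sub, sin_pi_div_two_sub] at hI
  have hcη : 0 < cos η := cos_pos_of_mem_Ioo ⟨by linarith, by linarith [pi_pos]⟩
  have hε0 : 0 ≤ ε := (abs_nonneg _).trans (hε (π / 2) ⟨hle, le_rfl⟩)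
  have hb := intervalIntegral.norm_integral_le_of_norm_le_const (a := π / 2 - η) (b := π / 2)
    (C := ε * η ^ 2)
    (f := fun x => (hubbleLen k (A * sin x) - h) * (cos η / sin x ^ 2 - 1)) (by
      rw [uIoc_of_le hle]
      intro x hx
      rw [norm_mul]
      exact mul_le_mul (hε x ⟨hx.1.le, hx.2⟩) (abs_sin_div_sub_one_le h1 ⟨hx.1.le, hx.2⟩)
        (norm_nonneg _) hε0)
  have hsplit : ∫ x in (π / 2 - η)..π / 2,
      (hubbleLen k (A * sin x) - h) * (cos η / sin x ^ 2 - 1) =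
      areal k A (π / 2 - η) - radial k A (π / 2 - η) - h * (sin η - η) := by
    have e1 : ∀ x, (hubbleLen k (A * sin x) - h) * (cos η / sin x ^ 2 - 1) =
        (cos η * (hubbleLen k (A * sin x) / sin x ^ 2) - hubbleLen k (A * sin x)) -
          (h * cos η * (1 / sin x ^ 2) - h) := fun x => by ring
    simp_rw [e1]
    rw [intervalIntegral.integral_sub ((hi1.const_mul _).sub (hc.intervalIntegrable _ _))
      ((hi2.const_mul _).sub intervalIntegrable_const),
      intervalIntegral.integral_sub (hi1.const_mul _) (hc.intervalIntegrable _ _),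
      intervalIntegral.integral_sub (hi2.const_mul _) intervalIntegrable_const,
      intervalIntegral.integral_const_mul, intervalIntegral.integral_const_mul, hI,
      intervalIntegral.integral_const, areal, radial, sin_pi_div_two_sub, smul_eq_mul]
    field_simp
    ring
  rw [hsplit, sub_sub_cancel, abs_of_nonneg h0, Real.norm_eq_abs] at hb
  exact hb

lemma eventually_hubbleLen_near (hk : IsSlowness k k1 k2 K L) (A : ℝ) {ε : ℝ} (hε : 0 < ε) :
    ∀ᶠ p : ℝ × ℝ in 𝓝 A ×ˢ 𝓝[>] 0, 0 < p.2 ∧ p.2 < 1 ∧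
      ∀ x ∈ Icc (π / 2 - p.2) (π / 2), |hubbleLen k (p.1 * sin x) - hubbleLen k A| ≤ ε := by
  have hc : Continuous fun q : ℝ × ℝ => hubbleLen k (q.1 * sin q.2) :=
    hk.continuous_hubbleLen.comp (by fun_prop)
  obtain ⟨δ, hδ, h⟩ := Metric.continuousAt_iff.1 (hc.continuousAt (x := (A, π / 2))) ε hε
  have h1 : ∀ᶠ a : ℝ in 𝓝 A, dist a A < δ := Metric.ball_mem_nhds A hδ
  have h2 : ∀ᶠ η : ℝ in 𝓝[>] 0, 0 < η ∧ η < min 1 δ :=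
    Ioo_mem_nhdsGT (lt_min one_pos hδ)
  filter_upwards [h1.prod_mk h2] with p hp
  refine ⟨hp.2.1, hp.2.2.trans_le (min_le_left _ _), fun x hx => ?_⟩
  have hd : p.2 < δ := hp.2.2.trans_le (min_le_right _ _)
  have := h (x := (p.1, x)) (by
    rw [Prod.dist_eq]
    refine max_lt hp.1 ?_
    rw [Real.dist_eq, abs_of_nonpos (by simp only; linarith [hx.2])]
    simp only
    linarith [hx.1])
  rw [Real.dist_eq] at this
  simpa using this.le

lemma tendsto_radial_div (hk : IsSlowness k k1 k2 K L) (A : ℝ) :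
    Tendsto (fun p : ℝ × ℝ => radial k p.1 (π / 2 - p.2) / p.2) (𝓝 A ×ˢ 𝓝[>] 0)
      (𝓝 (hubbleLen k A)) := by
  refine Metric.tendsto_nhds.2 fun ε hε => ?_
  filter_upwards [hk.eventually_hubbleLen_near A (half_pos hε)] with p hp
  have h1 := hk.abs_radial_sub_le hp.1.le hp.2.2
  rw [Real.dist_eq, div_sub' hp.1.ne', abs_div, abs_of_pos hp.1, div_lt_iff₀ hp.1,
    mul_comm p.2]
  nlinarith [hp.1]

lemma tendsto_areal_sub_div (hk : IsSlowness k k1 k2 K L) (A : ℝ) :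
    Tendsto (fun p : ℝ × ℝ =>
        (areal k p.1 (π / 2 - p.2) - radial k p.1 (π / 2 - p.2)) / p.2 ^ 3)
      (𝓝 A ×ˢ 𝓝[>] 0) (𝓝 (-hubbleLen k A / 6)) := by
  have hsin : Tendsto (fun η : ℝ => (sin η - η) / η ^ 3) (𝓝[>] 0) (𝓝 (-(1 / 6))) := by
    -- The constant is the one in `Real.sin_bound`.
    have hlin : Tendsto (fun η : ℝ => η ^ 2 * (1 / 100)) (𝓝[>] 0) (𝓝 0) := by
      have : Tendsto (fun η : ℝ => η ^ 2 * (1 / 100)) (𝓝 0) (𝓝 (0 ^ 2 * (1 / 100))) :=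
        ((continuous_pow 2).mul continuous_const).tendsto 0
      rw [zero_pow two_ne_zero, zero_mul] at this
      exact this.mono_left nhdsWithin_le_nhds
    rw [tendsto_iff_norm_sub_tendsto_zero]
    refine squeeze_zero' (Eventually.of_forall fun _ => norm_nonneg _) ?_ hlin
    filter_upwards [Ioo_mem_nhdsGT (one_pos (α := ℝ))] with η hη
    have h1 := Real.sin_bound (x := η) (by rw [abs_of_pos hη.1]; exact hη.2.le)
    have h2 : (sin η - η) / η ^ 3 - -(1 / 6) = (sin η - (η - η ^ 3 / 6)) / η ^ 3 := by
      have := hη.1.ne'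
      field_simp
      ring
    have hp : 0 < η ^ 3 := pow_pos hη.1 3
    rw [Real.norm_eq_abs, h2, abs_div, abs_of_pos hp, div_le_iff₀ hp]
    rw [abs_of_pos hη.1] at h1
    refine h1.trans (le_of_eq ?_)
    ring
  have hmain : Tendsto (fun p : ℝ × ℝ =>
      (areal k p.1 (π / 2 - p.2) - radial k p.1 (π / 2 - p.2)) / p.2 ^ 3 -
        hubbleLen k A * ((sin p.2 - p.2) / p.2 ^ 3)) (𝓝 A ×ˢ 𝓝[>] 0) (𝓝 0) := by
    refine Metric.tendsto_nhds.2 fun ε hε => ?_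
    filter_upwards [hk.eventually_hubbleLen_near A (half_pos hε)] with p hp
    have h1 := hk.abs_areal_sub_le hp.1.le (by linarith [hp.2.1, pi_gt_three]) hp.2.2
    have hp3 : 0 < p.2 ^ 3 := pow_pos hp.1 3
    have h2 : (areal k p.1 (π / 2 - p.2) - radial k p.1 (π / 2 - p.2)) / p.2 ^ 3 -
        hubbleLen k A * ((sin p.2 - p.2) / p.2 ^ 3) =
        (areal k p.1 (π / 2 - p.2) - radial k p.1 (π / 2 - p.2) -
          hubbleLen k A * (sin p.2 - p.2)) / p.2 ^ 3 := by ring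
    rw [Real.dist_eq, sub_zero, h2, abs_div, abs_of_pos hp3, div_lt_iff₀ hp3]
    nlinarith
  have := hmain.add ((hsin.comp tendsto_snd).const_mul (hubbleLen k A))
  refine (this.congr fun p => ?_).trans_eq ?_
  · simp
  · congr 1; ring

/-- Factor X² - R² = (X - R)((X - R) + 2R) and scale by η: X - R by η³, R by η. With h = H(A) the
limit is (-h/6)(2h)/h⁴. -/
lemma tendsto_areal_sq_sub (hk : IsSlowness k k1 k2 K L) {A : ℝ} (hA : A ≠ 0) :
    Tendsto (fun p : ℝ × ℝ =>
        (areal k p.1 (π / 2 - p.2) ^ 2 - radial k p.1 (π / 2 - p.2) ^ 2) /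
          radial k p.1 (π / 2 - p.2) ^ 4)
      (𝓝 A ×ˢ 𝓝[>] 0) (𝓝 (-(1 / (3 * hubbleLen k A ^ 2)))) := by
  have h1 := hk.tendsto_radial_div A
  have h2 := hk.tendsto_areal_sub_div A
  have hη : Tendsto (fun p : ℝ × ℝ => p.2 ^ 2) (𝓝 A ×ˢ 𝓝[>] 0) (𝓝 0) := by
    have : Tendsto (fun η : ℝ => η ^ 2) (𝓝[>] 0) (𝓝 0) := by
      have : Tendsto (fun η : ℝ => η ^ 2) (𝓝 0) (𝓝 (0 ^ 2)) := (continuous_pow 2).tendsto 0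
      simpa using this.mono_left nhdsWithin_le_nhds
    exact this.comp tendsto_snd
  have hpos := hk.hubbleLen_pos hA
  have h3 := (h2.mul ((h2.mul hη).add (h1.const_mul 2))).div (h1.pow 4) (pow_ne_zero 4 hpos.ne')
  have hval : -hubbleLen k A / 6 * (-hubbleLen k A / 6 * 0 + 2 * hubbleLen k A) /
      hubbleLen k A ^ 4 = -(1 / (3 * hubbleLen k A ^ 2)) := by
    field_simp
    ring
  rw [hval] at h3
  refine h3.congr' ?_
  have hev : ∀ᶠ p : ℝ × ℝ in 𝓝 A ×ˢ 𝓝[>] 0, 0 < p.2 :=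
    tendsto_snd.eventually (self_mem_nhdsWithin : Ioi (0 : ℝ) ∈ 𝓝[>] 0)
  filter_upwards [hev] with p hp
  have hp' := hp.ne'
  simp only [Pi.div_apply]
  generalize areal k p.1 (π / 2 - p.2) = X
  generalize radial k p.1 (π / 2 - p.2) = R
  -- For R = 0 both sides are divisions by zero and equal 0.
  rcases eq_or_ne R 0 with rfl | hR
  · simp
  · field_simp
    ring

lemma continuousOn_areal_angle (hk : IsSlowness k k1 k2 K L) :
    ContinuousOn (fun q : ℝ × ℝ => areal k q.1 |angle k q.1 q.2|) (radialDomain k) := by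
  refine ContinuousOn.comp (f := fun q : ℝ × ℝ => (q.1, |angle k q.1 q.2|)) hk.continuousOn_areal
    (continuousOn_fst.prodMk hk.continuousOn_angle.abs) fun q hq => ?_
  have := hk.angle_mem hq
  exact mk_mem_prod (mem_univ _) ⟨abs_nonneg _, _root_.abs_le.2 ⟨this.1.le, this.2⟩⟩

end IsSlowness

end RWFermi

/-! ### Positivity of 1 - a'f up to the big bang, and continuity of λ₀. -/

namespace RWFermi

open MeasureTheory Real

/-- `λ₀` as a function of `A = a(τ)` and of the proper distance. -/
noncomputable def lamDist (k : ℝ → ℝ) (q : ℝ × ℝ) : ℝ :=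
  if q.2 = 0 then -(1 / (3 * hubbleLen k q.1 ^ 2))
  else (areal k q.1 |angle k q.1 q.2| ^ 2 - q.2 ^ 2) / q.2 ^ 4

lemma integral_inv_one_add_cos : ∫ x in 0..π / 2, 1 / (1 + |cos x|) = 1 := by
  have hc : Continuous fun x => 1 / (1 + |cos x|) :=
    Continuous.div continuous_const (by fun_prop) fun x => (one_add_abs_cos_pos x).ne'
  have hpos : (0 : ℝ) ≤ π / 2 := by positivity
  rw [intervalIntegral.integral_eq_sub_of_hasDerivAt_of_le
    (f := fun x => sin x / (1 + cos x)) hpos ?_ ?_ (hc.intervalIntegrable _ _)]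
  · simp
  · refine ContinuousOn.div (by fun_prop) (by fun_prop) fun x hx => ?_
    have := cos_nonneg_of_neg_pi_div_two_le_of_le (by linarith [hx.1]) hx.2
    positivity
  · intro x hx
    have hx0 : 0 < cos x := cos_pos_of_mem_Ioo ⟨by linarith [hx.1], hx.2⟩
    have h1 : 1 + cos x ≠ 0 := by positivity
    refine ((hasDerivAt_sin x).div ((hasDerivAt_cos x).const_add 1) h1).congr_deriv ?_
    rw [abs_of_pos hx0]
    field_simp
    linear_combination sin_sq_add_cos_sq x

namespace IsSlowness

variable {k k1 k2 : ℝ → ℝ} {K L : ℝ}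

lemma neg_hubbleLen_le_sqDeriv (hk : IsSlowness k k1 k2 K L) (u : ℝ) :
    -hubbleLen k u ≤ sqDeriv k1 u := by
  rcases eq_or_ne u 0 with rfl | hu
  · simp [sqDeriv, hubbleLen]
  · have hu' := abs_pos.2 hu
    have h := hk.neg_le _ hu'
    rw [sqDeriv, ← sq_abs u, hubbleLen]
    nlinarith

/-- After multiplication by A, the bending term is at least minus the integral of H(A sin x)/(1 +
cos x), because u² k' ≥ -H. As H(A sin x) ≤ H(A), with strict inequality at x = 0, and the weight
has total mass 1, that integral is below H(A) = A k(A). -/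
lemma add_bend_pos (hk : IsSlowness k k1 k2 K L) {A ψ : ℝ} (hA : 0 < A)
    (hψ : ψ ∈ Icc 0 (π / 2)) : 0 < k A + A * bend k1 A ψ := by
  have hpos : (0 : ℝ) < π / 2 := by positivity
  have hw : Continuous fun x => 1 / (1 + |cos x|) :=
    Continuous.div continuous_const (by fun_prop) fun x => (one_add_abs_cos_pos x).ne'
  have hch : Continuous fun x => hubbleLen k (A * sin x) :=
    hk.continuous_hubbleLen.comp (by fun_prop)
  have hcs : Continuous fun x => sqDeriv k1 (A * sin x) :=
    hk.continuous_sqDeriv.comp (by fun_prop)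
  have hle : ∀ x, hubbleLen k (A * sin x) ≤ hubbleLen k A := fun x => by
    refine hk.hubbleLen_le ?_
    rw [abs_mul]
    exact mul_le_of_le_one_right (abs_nonneg A) (abs_sin_le_one x)
  have hwpos : ∀ x, 0 < 1 / (1 + |cos x|) := fun x => one_div_pos.2 (one_add_abs_cos_pos x)
  have h1 : ∫ x in 0..π / 2, hubbleLen k (A * sin x) * (1 / (1 + |cos x|)) < hubbleLen k A := by
    have h2 := intervalIntegral.integral_lt_integral_of_continuousOn_of_le_of_exists_lt hpos
      (f := fun x => hubbleLen k (A * sin x) * (1 / (1 + |cos x|)))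
      (g := fun x => hubbleLen k A * (1 / (1 + |cos x|)))
      (hch.mul hw).continuousOn (continuous_const.mul hw).continuousOn
      (fun x _ => mul_le_mul_of_nonneg_right (hle x) (hwpos x).le)
      ⟨0, ⟨le_rfl, hpos.le⟩, by
        simpa [hubbleLen_zero] using hk.hubbleLen_pos hA.ne'⟩
    rwa [intervalIntegral.integral_const_mul, integral_inv_one_add_cos, mul_one] at h2
  have h2 : ∫ x in ψ..π / 2, hubbleLen k (A * sin x) * (1 / (1 + |cos x|)) ≤
      ∫ x in 0..π / 2, hubbleLen k (A * sin x) * (1 / (1 + |cos x|)) :=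
    intervalIntegral.integral_mono_interval hψ.1 hψ.2 le_rfl
      (Eventually.of_forall fun x => mul_nonneg (hk.hubbleLen_nonneg _) (hwpos x).le)
      ((hch.mul hw).intervalIntegrable _ _)
  have h3 : -∫ x in ψ..π / 2, hubbleLen k (A * sin x) * (1 / (1 + |cos x|)) ≤
      ∫ x in ψ..π / 2, sqDeriv k1 (A * sin x) / (1 + |cos x|) := by
    rw [← intervalIntegral.integral_neg]
    refine intervalIntegral.integral_mono_on hψ.2 ((hch.mul hw).neg.intervalIntegrable _ _)
      ((hcs.div (by fun_prop) fun x => (one_add_abs_cos_pos x).ne').intervalIntegrable _ _)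
      fun x _ => ?_
    rw [div_eq_mul_one_div (sqDeriv _ _), ← neg_mul]
    exact mul_le_mul_of_nonneg_right (hk.neg_hubbleLen_le_sqDeriv _) (hwpos x).le
  have h4 : k A + A * bend k1 A ψ =
      A⁻¹ * (hubbleLen k A + ∫ x in ψ..π / 2, sqDeriv k1 (A * sin x) / (1 + |cos x|)) := by
    rw [bend, hubbleLen_of_nonneg k hA.le]
    field_simp
  rw [h4]
  exact mul_pos (inv_pos.2 hA) (by linarith)

/-- The difference k(A) - shift is cos ψ (k(A) + A · bend) plus a nonnegative term. As k(A) =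
1/a'(τ), this is 1 - a'f > 0. At ψ = π/2 the cosine vanishes and f = 0 is used directly. -/
lemma shift_lt (hk : IsSlowness k k1 k2 K L) {A ψ : ℝ} (hA : 0 < A)
    (hψ : ψ ∈ Icc 0 (π / 2)) : shift k k1 A ψ < k A := by
  rcases hψ.2.eq_or_lt with rfl | h
  · rw [shift_pi_div_two k k1 hA]
    exact hk.pos A hA
  · have hc : 0 < cos ψ := cos_pos_of_mem_Ioo ⟨by linarith [pi_pos, hψ.1], h⟩
    have hs : 0 ≤ sin ψ := sin_nonneg_of_nonneg_of_le_pi hψ.1 (by linarith [pi_pos])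
    have h1 := mul_pos hc (hk.add_bend_pos hA hψ)
    have h2 : 0 ≤ A⁻¹ * (hubbleLen k (A * sin ψ) * (sin ψ / (1 + |cos ψ|))) :=
      mul_nonneg (inv_nonneg.2 hA.le) (mul_nonneg (hk.hubbleLen_nonneg _) (by positivity))
    rw [shift_of_nonneg _ _ _ hψ.1, shiftPos]
    linarith

lemma shiftDist_lt (hk : IsSlowness k k1 k2 K L) {A ρ : ℝ} (hA : 0 < A) (h0 : 0 ≤ ρ)
    (h1 : ρ ≤ radial k A 0) : shiftDist k k1 A ρ < k A := by
  have hq : (A, ρ) ∈ radialDomain k := ⟨hA, h0, by linarith [hk.radial_zero_pos hA]⟩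
  have hm := hk.angle_mem hq
  have hr := hk.radial_angle hq
  refine hk.shift_lt hA ⟨?_, hm.2⟩
  by_contra! h
  have := hk.strictAntiOn_radial hA (Ioc_subset_Icc_self hm)
    (b := 0) ⟨by linarith [pi_pos], by positivity⟩ h
  simp only at hr this
  linarith

lemma continuousOn_lamDist (hk : IsSlowness k k1 k2 K L) :
    ContinuousOn (lamDist k) (radialDomain k) := by
  intro q hq
  by_cases h0 : q.2 = 0
  · obtain ⟨A, ρ⟩ := q
    simp only at h0
    subst h0
    have hA : 0 < A := hq.1
    -- Near the worldline the two branches of `lamDist` are treated separately, and the expansion in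
    -- η = π/2 - angle handles the pairs with ρ > 0.
    have hsplit : radialDomain k = radialDomain k ∩ {q | q.2 = 0} ∪
        radialDomain k ∩ {q | q.2 ≠ 0} := by
      rw [← inter_union_distrib_left]
      exact (inter_eq_left.2 fun q _ => em (q.2 = 0)).symm
    rw [hsplit, continuousWithinAt_union]
    constructor
    · have hc : ContinuousAt (fun q : ℝ × ℝ => -(1 / (3 * hubbleLen k q.1 ^ 2))) (A, 0) := by
        have h1 : Continuous fun q : ℝ × ℝ => 3 * hubbleLen k q.1 ^ 2 :=
          continuous_const.mul ((hk.continuous_hubbleLen.comp continuous_fst).pow 2)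
        have := (hk.hubbleLen_pos hA.ne').ne'
        exact (continuousAt_const.div h1.continuousAt (by positivity)).neg
      refine hc.continuousWithinAt.congr_of_eventuallyEq ?_ (by simp [lamDist])
      filter_upwards [self_mem_nhdsWithin] with q hq
      exact if_pos hq.2
    · have h1 : Tendsto (fun q : ℝ × ℝ => (q.1, π / 2 - angle k q.1 q.2))
          (𝓝[radialDomain k ∩ {q | q.2 ≠ 0}] (A, 0)) (𝓝 A ×ˢ 𝓝[>] 0) := by
        refine Tendsto.prodMk (continuousAt_fst.tendsto.mono_left nhdsWithin_le_nhds)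
          (tendsto_nhdsWithin_iff.2 ⟨?_, ?_⟩)
        · have h2 : Tendsto (fun q : ℝ × ℝ => angle k q.1 q.2) (𝓝[radialDomain k] (A, 0))
              (𝓝 (angle k A 0)) := hk.continuousOn_angle (A, 0) hq
          rw [hk.angle_zero hA] at h2
          have h3 := h2.const_sub (π / 2)
          rw [sub_self] at h3
          exact h3.mono_left (nhdsWithin_mono _ inter_subset_left)
        · filter_upwards [self_mem_nhdsWithin] with q hq
          have hm := hk.angle_mem hq.1
          refine sub_pos.2 (lt_of_le_of_ne hm.2 fun h => hq.2 ?_)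
          rw [← hk.radial_angle hq.1, h, radial_pi_div_two]
      have h2 := (hk.tendsto_areal_sq_sub hA.ne').comp h1
      have hval : lamDist k (A, 0) = -(1 / (3 * hubbleLen k A ^ 2)) := if_pos rfl
      rw [ContinuousWithinAt, hval]
      refine h2.congr' ?_
      have h3 : ∀ᶠ q : ℝ × ℝ in 𝓝[radialDomain k ∩ {q | q.2 ≠ 0}] (A, 0),
          0 < angle k q.1 q.2 := by
        have h4 := (hk.continuousOn_angle (A, 0) hq).mono_left
          (nhdsWithin_mono _ (inter_subset_left (t := {q | q.2 ≠ 0})))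
        refine h4.eventually (Ioi_mem_nhds ?_)
        simp only
        rw [hk.angle_zero hA]
        positivity
      filter_upwards [self_mem_nhdsWithin, h3] with q hq hpos
      have hr := hk.radial_angle hq.1
      simp only [Function.comp, sub_sub_cancel]
      rw [lamDist, if_neg hq.2, abs_of_pos hpos, hr]
  · have hc : ContinuousWithinAt (fun q : ℝ × ℝ =>
        (areal k q.1 |angle k q.1 q.2| ^ 2 - q.2 ^ 2) / q.2 ^ 4) (radialDomain k) q :=
      (((hk.continuousOn_areal_angle q hq).pow 2).sub (continuousWithinAt_snd.pow 2)).div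
        (continuousWithinAt_snd.pow 4) (pow_ne_zero 4 h0)
    refine hc.congr_of_eventuallyEq ?_ (if_neg h0)
    have : ∀ᶠ p : ℝ × ℝ in 𝓝 q, p.2 ≠ 0 := continuousAt_snd.eventually_ne h0
    filter_upwards [this.filter_mono nhdsWithin_le_nhds] with p hp
    exact if_neg hp

end IsSlowness

end RWFermi

/-! ### From a strongly regular scale factor to the bounds on k. -/

namespace RWFermi

open MeasureTheory Real

/-- The inverse of a scale factor on `[0, ∞)`. -/
noncomputable def invScale (a : ℝ → ℝ) (u : ℝ) : ℝ := Function.invFunOn a (Ici 0) u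

/-- The derivative of `invScale`. -/
noncomputable def slowness (a : ℝ → ℝ) (u : ℝ) : ℝ := (deriv a (invScale a u))⁻¹

/-- The derivative of `slowness`. -/
noncomputable def slownessDeriv (a : ℝ → ℝ) (u : ℝ) : ℝ :=
  -(deriv (deriv a) (invScale a u) / deriv a (invScale a u) ^ 3)

namespace IsRegular

variable {a : ℝ → ℝ}

lemma hasDerivAt (ha : IsRegular a) {t : ℝ} (ht : 0 < t) : HasDerivAt a (deriv a t) t :=
  (((ha.contDiffOn.differentiableOn two_ne_zero) t ht).differentiableAt
    (Ioi_mem_nhds ht)).hasDerivAt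

lemma contDiffOn_deriv (ha : IsRegular a) : ContDiffOn ℝ 1 (deriv a) (Ioi 0) := by
  have h := ha.contDiffOn
  rw [show (2 : WithTop ℕ∞) = 1 + 1 from one_add_one_eq_two.symm,
    contDiffOn_succ_iff_deriv_of_isOpen isOpen_Ioi] at h
  exact h.2.2

lemma hasDerivAt_deriv (ha : IsRegular a) {t : ℝ} (ht : 0 < t) :
    HasDerivAt (deriv a) (deriv (deriv a) t) t :=
  (((ha.contDiffOn_deriv.differentiableOn one_ne_zero) t ht).differentiableAt
    (Ioi_mem_nhds ht)).hasDerivAt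

lemma pos (ha : IsRegular a) {t : ℝ} (ht : 0 < t) : 0 < a t := by
  have h : a 0 < a t := ha.strictMonoOn self_mem_Ici ht.le ht
  rwa [ha.map_zero] at h

lemma nonneg (ha : IsRegular a) {t : ℝ} (ht : 0 ≤ t) : 0 ≤ a t := by
  rcases ht.eq_or_lt with rfl | h
  · exact ha.map_zero.ge
  · exact (ha.pos h).le

end IsRegular

namespace IsStronglyRegular

variable {a : ℝ → ℝ}

/-- For an integer n ≥ K the lower bound on a a''/a'² makes aⁿ a' nondecreasing, so aⁿ⁺¹ grows at
least linearly on [1, ∞). Unboundedness is what makes the inverse of a defined on all of [0, ∞). -/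
lemma exists_ge (ha : IsStronglyRegular a) (y : ℝ) : ∃ t, 0 ≤ t ∧ y ≤ a t := by
  obtain ⟨K, hK1, hK⟩ := ha.le_quotient
  obtain ⟨n, hn⟩ := exists_nat_ge K
  have hra := ha.toIsRegular
  have hn1 : (1 : ℝ) ≤ n := hK1.trans hn
  have hder1 : ∀ t, 0 < t → HasDerivAt (fun t => a t ^ n * deriv a t)
      (n * a t ^ (n - 1) * deriv a t * deriv a t + a t ^ n * deriv (deriv a) t) t :=
    fun t ht => ((hra.hasDerivAt ht).pow n).mul (hra.hasDerivAt_deriv ht)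
  have hmono : MonotoneOn (fun t => a t ^ n * deriv a t) (Ici 1) := by
    have hpos : ∀ t ∈ Ici (1 : ℝ), 0 < t := fun t ht => one_pos.trans_le ht
    refine monotoneOn_of_deriv_nonneg (convex_Ici 1)
      (fun t ht => (hder1 t (hpos t ht)).continuousAt.continuousWithinAt)
      (fun t ht => (hder1 t (hpos t
        (interior_subset ht))).differentiableAt.differentiableWithinAt) ?_
    intro t ht
    have ht0 := hpos t (interior_subset ht)
    rw [(hder1 t ht0).deriv]
    have h1 := hK t ht0
    have h2 := hra.deriv_pos t ht0
    have h3 := hra.pos ht0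
    rw [le_div_iff₀ (by positivity)] at h1
    have h4 : a t ^ n = a t ^ (n - 1) * a t := by
      rw [← pow_succ, Nat.sub_add_cancel (by exact_mod_cast hn1)]
    rw [h4]
    have h5 : 0 < a t ^ (n - 1) := by positivity
    have h6 : 0 ≤ n * deriv a t ^ 2 + a t * deriv (deriv a) t := by
      nlinarith [mul_le_mul_of_nonneg_right hn (sq_nonneg (deriv a t))]
    nlinarith [mul_nonneg h5.le h6]
  set g := a 1 ^ n * deriv a 1 with hg
  have hg0 : 0 < g := mul_pos (pow_pos (hra.pos one_pos) n) (hra.deriv_pos 1 one_pos)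
  have hder2 : ∀ t, 0 < t → HasDerivAt (fun t => a t ^ (n + 1) - g * t)
      ((n + 1 : ℕ) * a t ^ n * deriv a t - g * 1) t := fun t ht =>
    ((hra.hasDerivAt ht).pow (n + 1)).sub ((hasDerivAt_id t).const_mul g)
  have hmono2 : MonotoneOn (fun t => a t ^ (n + 1) - g * t) (Ici 1) := by
    have hpos : ∀ t ∈ Ici (1 : ℝ), 0 < t := fun t ht => one_pos.trans_le ht
    refine monotoneOn_of_deriv_nonneg (convex_Ici 1)
      (fun t ht => (hder2 t (hpos t ht)).continuousAt.continuousWithinAt)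
      (fun t ht => (hder2 t (hpos t
        (interior_subset ht))).differentiableAt.differentiableWithinAt) ?_
    intro t ht
    have ht1 : t ∈ Ici (1 : ℝ) := interior_subset ht
    rw [(hder2 t (hpos t ht1)).deriv]
    have h1 : g ≤ a t ^ n * deriv a t := hmono self_mem_Ici ht1 ht1
    push_cast
    nlinarith
  obtain ⟨t, ht1, hty⟩ : ∃ t, 1 ≤ t ∧ |y| ^ (n + 1) + g ≤ g * t := by
    refine ⟨max 1 ((|y| ^ (n + 1) + g) / g), le_max_left _ _, ?_⟩
    have := mul_le_mul_of_nonneg_left (le_max_right 1 ((|y| ^ (n + 1) + g) / g)) hg0.le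
    rwa [mul_div_cancel₀ _ hg0.ne'] at this
  refine ⟨t, by linarith, ?_⟩
  have h1 := hmono2 self_mem_Ici ht1 ht1
  simp only [mul_one] at h1
  have h2 : 0 ≤ a 1 ^ (n + 1) := pow_nonneg (hra.nonneg zero_le_one) _
  have h3 : |y| ^ (n + 1) ≤ a t ^ (n + 1) := by linarith
  exact (le_abs_self y).trans
    (le_of_pow_le_pow_left₀ (Nat.succ_ne_zero n) (hra.nonneg (by linarith)) h3)

lemma surjOn (ha : IsStronglyRegular a) : SurjOn a (Ici 0) (Ici 0) := by
  intro u hu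
  obtain ⟨t, ht0, ht⟩ := ha.exists_ge u
  have := intermediate_value_Icc ht0 (ha.continuousOn.mono Icc_subset_Ici_self)
  rw [ha.map_zero] at this
  obtain ⟨s, hs, rfl⟩ := this ⟨hu, ht⟩
  exact ⟨s, hs.1, rfl⟩

lemma invScale_nonneg (ha : IsStronglyRegular a) {u : ℝ} (hu : 0 ≤ u) : 0 ≤ invScale a u :=
  Function.invFunOn_mem (ha.surjOn hu)

lemma map_invScale (ha : IsStronglyRegular a) {u : ℝ} (hu : 0 ≤ u) : a (invScale a u) = u :=
  Function.invFunOn_eq (ha.surjOn hu)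

lemma invScale_map (ha : IsStronglyRegular a) {t : ℝ} (ht : 0 ≤ t) : invScale a (a t) = t :=
  ha.strictMonoOn.injOn.leftInvOn_invFunOn ht

lemma invScale_zero (ha : IsStronglyRegular a) : invScale a 0 = 0 := by
  have := ha.invScale_map le_rfl
  rwa [ha.map_zero] at this

lemma strictMonoOn_invScale (ha : IsStronglyRegular a) : StrictMonoOn (invScale a) (Ici 0) := by
  intro u hu v hv huv
  refine (ha.strictMonoOn.lt_iff_lt (ha.invScale_nonneg hu) (ha.invScale_nonneg hv)).1 ?_
  rwa [ha.map_invScale hu, ha.map_invScale hv]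

lemma invScale_pos (ha : IsStronglyRegular a) {u : ℝ} (hu : 0 < u) : 0 < invScale a u := by
  have h : invScale a 0 < invScale a u := ha.strictMonoOn_invScale self_mem_Ici hu.le hu
  rwa [ha.invScale_zero] at h

lemma hasDerivAt_invScale (ha : IsStronglyRegular a) {u : ℝ} (hu : 0 < u) :
    HasDerivAt (invScale a) (slowness a u) u := by
  have hpos := ha.invScale_pos hu
  have himg : invScale a '' Ici 0 = Ici 0 := by
    refine Subset.antisymm ?_ fun t ht => ⟨a t, ha.nonneg ht, ha.invScale_map ht⟩
    rintro _ ⟨v, hv, rfl⟩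
    exact ha.invScale_nonneg hv
  have hcont : ContinuousAt (invScale a) u :=
    ha.strictMonoOn_invScale.continuousAt_of_image_mem_nhds (Ici_mem_nhds hu)
      (by rw [himg]; exact Ici_mem_nhds hpos)
  refine HasDerivAt.of_local_left_inverse hcont (ha.hasDerivAt hpos) (ha.deriv_pos _ hpos).ne' ?_
  filter_upwards [Ioi_mem_nhds hu] with v hv
  exact ha.map_invScale (le_of_lt hv)

lemma tendsto_invScale (ha : IsStronglyRegular a) :
    Tendsto (invScale a) (𝓝[>] 0) (𝓝[>] 0) := by
  refine tendsto_nhdsWithin_iff.2 ⟨tendsto_order.2 ⟨fun c hc => ?_, fun c hc => ?_⟩, ?_⟩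
  · filter_upwards [self_mem_nhdsWithin] with u hu
    exact hc.trans (ha.invScale_pos hu)
  · filter_upwards [Ioo_mem_nhdsGT (ha.pos hc)] with u hu
    have := ha.strictMonoOn_invScale hu.1.le (ha.nonneg hc.le) hu.2
    rwa [ha.invScale_map hc.le] at this
  · filter_upwards [self_mem_nhdsWithin] with u hu
    exact ha.invScale_pos hu

lemma hasDerivAt_slowness (ha : IsStronglyRegular a) {u : ℝ} (hu : 0 < u) :
    HasDerivAt (slowness a) (slownessDeriv a u) u := by
  have hpos := ha.invScale_pos hu
  have hd := (ha.deriv_pos _ hpos).ne'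
  have h1 : HasDerivAt (fun u => deriv a (invScale a u))
      (deriv (deriv a) (invScale a u) * slowness a u) u :=
    HasDerivAt.comp (h₂ := deriv a) (h := invScale a) u (ha.hasDerivAt_deriv hpos)
      (ha.hasDerivAt_invScale hu)
  refine (h1.inv hd).congr_deriv ?_
  rw [slownessDeriv, slowness]
  field_simp

lemma exists_tendsto_deriv (hbb : BigBangCondition a) :
    ∃ L, Tendsto (deriv a) (𝓝[>] 0) (𝓝 L) := by
  rcases hbb with ⟨h, -⟩ | ⟨L, -, h⟩
  · exact ⟨0, h⟩
  · exact ⟨L, h⟩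

/-- If a'' ≥ 0 near 0, the mean value theorem gives a(t) ≤ t a'(t). If a' has a positive limit, the
quotient tends to 0/L. -/
lemma tendsto_div_deriv (ha : IsStronglyRegular a) (hbb : BigBangCondition a) :
    Tendsto (fun t => a t / deriv a t) (𝓝[>] 0) (𝓝 0) := by
  rcases hbb with ⟨-, ε, hε, hconv⟩ | ⟨L, hL, h⟩
  · have hid : Tendsto (fun t : ℝ => t) (𝓝[>] 0) (𝓝 0) := nhdsWithin_le_nhds
    refine squeeze_zero' ?_ ?_ hid
    · filter_upwards [self_mem_nhdsWithin] with t ht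
      exact (div_pos (ha.pos ht) (ha.deriv_pos t ht)).le
    · filter_upwards [Ioo_mem_nhdsGT hε] with t ht
      have hmono : MonotoneOn (deriv a) (Ioo 0 ε) := by
        refine monotoneOn_of_deriv_nonneg (convex_Ioo 0 ε) ?_ ?_ ?_
        · exact fun s hs => (ha.hasDerivAt_deriv hs.1).continuousAt.continuousWithinAt
        · intro s hs
          rw [interior_Ioo] at hs
          exact (ha.hasDerivAt_deriv hs.1).differentiableAt.differentiableWithinAt
        · intro s hs
          rw [interior_Ioo] at hs
          exact hconv s hs
      obtain ⟨s, hs, hs2⟩ := exists_deriv_eq_slope a ht.1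
        (ha.continuousOn.mono Icc_subset_Ici_self)
        fun s hs => (ha.hasDerivAt hs.1).differentiableAt.differentiableWithinAt
      have h1 := hmono ⟨hs.1, hs.2.trans ht.2⟩ ht hs.2.le
      rw [hs2, ha.map_zero, sub_zero, sub_zero, div_le_iff₀ ht.1] at h1
      rw [div_le_iff₀ (ha.deriv_pos t ht.1)]
      linarith
  · have h0 : Tendsto a (𝓝[>] 0) (𝓝 0) := by
      have := (ha.continuousOn 0 self_mem_Ici).mono_left (nhdsWithin_mono 0 Ioi_subset_Ici_self)
      rwa [ha.map_zero] at this
    have h2 := h0.div h hL.ne'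
    rwa [zero_div] at h2

/-- With q = a a''/a'² and r = a''' a²/a'³ at the time when a = u, one has u k' = -q k and u² k'' =
(3q² - r) k. Hence K + C + 3K² serves for both bounds, and L is the limit of a' at 0, possibly 0. -/
lemma isSlowness (ha : IsStronglyRegular a) (hbb : BigBangCondition a) (h3 : ThirdDerivBound a) :
    ∃ K L, IsSlowness (slowness a) (slownessDeriv a) (deriv (slownessDeriv a)) K L := by
  obtain ⟨K, hK1, hK⟩ := ha.le_quotient
  obtain ⟨h3d, C, hC, h3b⟩ := h3
  obtain ⟨L, hL⟩ := exists_tendsto_deriv hbb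
  have hd2 : ∀ u, 0 < u → HasDerivAt (slownessDeriv a)
      (-((deriv (deriv (deriv a)) (invScale a u) / deriv a (invScale a u) ^ 3 -
        3 * deriv (deriv a) (invScale a u) ^ 2 / deriv a (invScale a u) ^ 4) * slowness a u)) u := by
    intro u hu
    have hpos := ha.invScale_pos hu
    have hd := (ha.deriv_pos _ hpos).ne'
    have h1 : HasDerivAt (fun u => deriv a (invScale a u))
        (deriv (deriv a) (invScale a u) * slowness a u) u :=
      HasDerivAt.comp (h₂ := deriv a) (h := invScale a) u (ha.hasDerivAt_deriv hpos)
        (ha.hasDerivAt_invScale hu)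
    have h2 : HasDerivAt (fun u => deriv (deriv a) (invScale a u))
        (deriv (deriv (deriv a)) (invScale a u) * slowness a u) u :=
      HasDerivAt.comp (h₂ := deriv (deriv a)) (h := invScale a) u
        ((h3d _ hpos).differentiableAt (Ioi_mem_nhds hpos)).hasDerivAt
        (ha.hasDerivAt_invScale hu)
    refine ((h2.div (h1.pow 3) (pow_ne_zero 3 hd)).neg).congr_deriv ?_
    simp only [Pi.pow_apply]
    field_simp
    push_cast
    ring
  have hq : ∀ u, 0 < u → u * slownessDeriv a u = -(a (invScale a u) *
      deriv (deriv a) (invScale a u) / deriv a (invScale a u) ^ 2) * slowness a u := by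
    intro u hu
    have hd := (ha.deriv_pos _ (ha.invScale_pos hu)).ne'
    rw [slownessDeriv, slowness, ha.map_invScale hu.le]
    field_simp
  have hspos : ∀ u, 0 < u → 0 < slowness a u := fun u hu =>
    inv_pos.2 (ha.deriv_pos _ (ha.invScale_pos hu))
  refine ⟨K + C + 3 * K ^ 2, L, ⟨hspos, fun u hu => ha.hasDerivAt_slowness hu,
    fun u hu => (hd2 u hu).differentiableAt.hasDerivAt, ?_, ?_, ?_, ?_, ?_⟩⟩
  · intro u hu
    rw [hq u hu]
    have h1 := ha.quotient_le _ (ha.invScale_pos hu)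
    nlinarith [hspos u hu]
  · intro u hu
    rw [hq u hu, abs_mul, abs_neg, abs_of_pos (hspos u hu)]
    have h1 := ha.quotient_le _ (ha.invScale_pos hu)
    have h2 := hK _ (ha.invScale_pos hu)
    refine mul_le_mul_of_nonneg_right (abs_le.2 ⟨?_, ?_⟩) (hspos u hu).le <;>
      nlinarith [sq_nonneg K]
  · intro u hu
    have hpos := ha.invScale_pos hu
    have hd := (ha.deriv_pos _ hpos).ne'
    have h1 := ha.quotient_le _ hpos
    have h2 := hK _ hpos
    have h4 := h3b _ hpos
    rw [(hd2 u hu).deriv]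
    set q := a (invScale a u) * deriv (deriv a) (invScale a u) / deriv a (invScale a u) ^ 2 with hqd
    set r := deriv (deriv (deriv a)) (invScale a u) * a (invScale a u) ^ 2 /
      deriv a (invScale a u) ^ 3 with hr
    have h5 : u ^ 2 * -((deriv (deriv (deriv a)) (invScale a u) / deriv a (invScale a u) ^ 3 -
        3 * deriv (deriv a) (invScale a u) ^ 2 / deriv a (invScale a u) ^ 4) * slowness a u) =
        (3 * q ^ 2 - r) * slowness a u := by
      rw [hqd, hr, ha.map_invScale hu.le]
      field_simp
      ring
    rw [h5, abs_mul, abs_of_pos (hspos u hu)]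
    refine mul_le_mul_of_nonneg_right ?_ (hspos u hu).le
    have h6 : q ^ 2 ≤ K ^ 2 := sq_le_sq' h2 (by linarith)
    have h7 := abs_le.1 h4
    rw [abs_le]
    constructor <;> nlinarith [sq_nonneg q, sq_nonneg K]
  · refine ((ha.tendsto_div_deriv hbb).comp ha.tendsto_invScale).congr' ?_
    filter_upwards [self_mem_nhdsWithin] with u hu
    rw [Function.comp, ha.map_invScale (le_of_lt hu), slowness, div_eq_mul_inv]
  · refine (hL.comp ha.tendsto_invScale).congr fun u => ?_
    simp [slowness]

end IsStronglyRegular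

end RWFermi

/-! ### Change of variables from cosmological time to the angle. -/

namespace RWFermi

open MeasureTheory Real

/-- The cosmological time at angle `ψ`. -/
noncomputable def timeAt (a : ℝ → ℝ) (τ ψ : ℝ) : ℝ :=
  if 0 ≤ ψ then invScale a (a τ * sin ψ) else -invScale a (a τ * sin (-ψ))

lemma timeAt_of_nonneg (a : ℝ → ℝ) (τ : ℝ) {ψ : ℝ} (h : 0 ≤ ψ) :
    timeAt a τ ψ = invScale a (a τ * sin ψ) := if_pos h

lemma timeAt_of_neg (a : ℝ → ℝ) (τ : ℝ) {ψ : ℝ} (h : ψ < 0) :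
    timeAt a τ ψ = -timeAt a τ (-ψ) := by
  rw [timeAt, if_neg (not_le.2 h), timeAt_of_nonneg a τ (by linarith : 0 ≤ -ψ)]

namespace IsStronglyRegular

variable {a : ℝ → ℝ}

lemma timeAt_pos (ha : IsStronglyRegular a) {τ ψ : ℝ} (hτ : 0 < τ) (h0 : 0 < ψ)
    (h1 : ψ ≤ π / 2) : 0 < timeAt a τ ψ := by
  rw [timeAt_of_nonneg a τ h0.le]
  exact ha.invScale_pos (mul_pos (ha.pos hτ) (sin_pos_of_mem h0 ⟨le_rfl, h1⟩))

lemma timeAt_zero (ha : IsStronglyRegular a) (τ : ℝ) : timeAt a τ 0 = 0 := by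
  rw [timeAt_of_nonneg a τ le_rfl, sin_zero, mul_zero, ha.invScale_zero]

lemma timeAt_pi_div_two (ha : IsStronglyRegular a) {τ : ℝ} (hτ : 0 < τ) :
    timeAt a τ (π / 2) = τ := by
  rw [timeAt_of_nonneg a τ (by positivity), sin_pi_div_two, mul_one, ha.invScale_map hτ.le]

lemma strictMonoOn_timeAt (ha : IsStronglyRegular a) {τ : ℝ} (hτ : 0 < τ) :
    StrictMonoOn (timeAt a τ) (Icc 0 (π / 2)) := by
  intro x hx y hy hxy
  have hA := ha.pos hτ
  rw [timeAt_of_nonneg a τ hx.1, timeAt_of_nonneg a τ hy.1]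
  have hsx := sin_nonneg_of_nonneg_of_le_pi hx.1 (by linarith [hx.2, pi_pos])
  have hsy := sin_nonneg_of_nonneg_of_le_pi hy.1 (by linarith [hy.2, pi_pos])
  refine ha.strictMonoOn_invScale (mul_nonneg hA.le hsx) (mul_nonneg hA.le hsy)
    (mul_lt_mul_of_pos_left ?_ hA)
  exact sin_lt_sin_of_lt_of_le_pi_div_two (by linarith [hx.1, pi_pos]) hy.2 hxy

lemma map_timeAt (ha : IsStronglyRegular a) {τ ψ : ℝ} (hτ : 0 < τ) (h : ψ ∈ Icc 0 (π / 2)) :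
    a (timeAt a τ ψ) = a τ * sin ψ := by
  rw [timeAt_of_nonneg a τ h.1, ha.map_invScale (mul_nonneg (ha.pos hτ).le
    (sin_nonneg_of_nonneg_of_le_pi h.1 (by linarith [h.2, pi_pos])))]

lemma exists_timeAt (ha : IsStronglyRegular a) {τ t : ℝ} (hτ : 0 < τ) (ht : t ∈ Icc 0 τ) :
    arcsin (a t / a τ) ∈ Icc 0 (π / 2) ∧ timeAt a τ (arcsin (a t / a τ)) = t := by
  have hA := ha.pos hτ
  have h0 : 0 ≤ a t / a τ := div_nonneg (ha.nonneg ht.1) hA.le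
  have h1 : a t / a τ ≤ 1 := by
    rw [div_le_one hA]
    exact ha.strictMonoOn.monotoneOn ht.1 hτ.le ht.2
  have h2 := arcsin_nonneg.2 h0
  refine ⟨⟨h2, arcsin_le_pi_div_two _⟩, ?_⟩
  rw [timeAt_of_nonneg a τ h2, sin_arcsin (by linarith) h1, mul_div_cancel₀ _ hA.ne',
    ha.invScale_map ht.1]

lemma image_timeAt (ha : IsStronglyRegular a) {τ ψ : ℝ} (hτ : 0 < τ) (h0 : 0 ≤ ψ)
    (h1 : ψ ≤ π / 2) : timeAt a τ '' Ioo ψ (π / 2) = Ioo (timeAt a τ ψ) τ := by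
  have hmono := ha.strictMonoOn_timeAt hτ
  have hr : π / 2 ∈ Icc 0 (π / 2) := ⟨by positivity, le_rfl⟩
  refine Subset.antisymm ?_ fun t ht => ?_
  · rintro _ ⟨x, hx, rfl⟩
    have hxm : x ∈ Icc 0 (π / 2) := ⟨h0.trans hx.1.le, hx.2.le⟩
    refine ⟨hmono ⟨h0, h1⟩ hxm hx.1, ?_⟩
    have := hmono hxm hr hx.2
    rwa [ha.timeAt_pi_div_two hτ] at this
  · have ht0 : 0 ≤ t := by
      have : timeAt a τ 0 ≤ timeAt a τ ψ := hmono.monotoneOn ⟨le_rfl, h0.trans h1⟩ ⟨h0, h1⟩ h0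
      rw [ha.timeAt_zero] at this
      exact this.trans ht.1.le
    obtain ⟨hm, he⟩ := ha.exists_timeAt hτ ⟨ht0, ht.2.le⟩
    refine ⟨_, ⟨?_, ?_⟩, he⟩
    · rw [← hmono.lt_iff_lt ⟨h0, h1⟩ hm, he]
      exact ht.1
    · rw [← hmono.lt_iff_lt hm hr, he, ha.timeAt_pi_div_two hτ]
      exact ht.2

lemma hasDerivAt_timeAt (ha : IsStronglyRegular a) {τ x : ℝ} (hτ : 0 < τ)
    (hx : x ∈ Ioo 0 (π / 2)) :
    HasDerivAt (timeAt a τ) (slowness a (a τ * sin x) * (a τ * cos x)) x := by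
  have hs := sin_pos_of_mem hx.1 ⟨le_rfl, hx.2.le⟩
  have h1 : HasDerivAt (fun x => invScale a (a τ * sin x))
      (slowness a (a τ * sin x) * (a τ * cos x)) x :=
    HasDerivAt.comp (h₂ := invScale a) (h := fun x => a τ * sin x) x
      (ha.hasDerivAt_invScale (mul_pos (ha.pos hτ) hs)) ((hasDerivAt_sin x).const_mul (a τ))
  refine h1.congr_of_eventuallyEq ?_
  filter_upwards [Ioi_mem_nhds hx.1] with y hy
  exact timeAt_of_nonneg a τ (le_of_lt hy)

/-- Substitution of the angle for the cosmological time. -/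
lemma subst_timeAt (ha : IsStronglyRegular a) {τ ψ : ℝ} (hτ : 0 < τ) (h0 : 0 ≤ ψ)
    (h1 : ψ ≤ π / 2) {G g : ℝ → ℝ}
    (hG : ∀ x ∈ Ioo ψ (π / 2),
      slowness a (a τ * sin x) * (a τ * cos x) * G (timeAt a τ x) = g x) :
    ∫ t in timeAt a τ ψ..τ, G t = ∫ x in ψ..π / 2, g x ∧
      (IntervalIntegrable g volume ψ (π / 2) →
        IntervalIntegrable G volume (timeAt a τ ψ) τ) := by
  have hle : timeAt a τ ψ ≤ τ := by
    have hl : ψ ∈ Icc 0 (π / 2) := ⟨h0, h1⟩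
    have hr : π / 2 ∈ Icc 0 (π / 2) := ⟨h0.trans h1, le_rfl⟩
    have hm := (ha.strictMonoOn_timeAt hτ).monotoneOn hl hr h1
    rwa [ha.timeAt_pi_div_two hτ] at hm
  have hder : ∀ x ∈ Ioo ψ (π / 2), HasDerivWithinAt (timeAt a τ)
      (slowness a (a τ * sin x) * (a τ * cos x)) (Ioo ψ (π / 2)) x := fun x hx =>
    (ha.hasDerivAt_timeAt hτ ⟨h0.trans_lt hx.1, hx.2⟩).hasDerivWithinAt
  have hinj : InjOn (timeAt a τ) (Ioo ψ (π / 2)) :=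
    (ha.strictMonoOn_timeAt hτ).injOn.mono
      (Ioo_subset_Icc_self.trans (Icc_subset_Icc_left h0))
  have hpos : ∀ x ∈ Ioo ψ (π / 2), 0 < slowness a (a τ * sin x) * (a τ * cos x) := by
    intro x hx
    have hs := sin_pos_of_mem (h0.trans_lt hx.1) ⟨le_rfl, hx.2.le⟩
    have hc : 0 < cos x := cos_pos_of_mem_Ioo ⟨by linarith [hx.1, pi_pos], hx.2⟩
    have hA := ha.pos hτ
    exact mul_pos (inv_pos.2 (ha.deriv_pos _ (ha.invScale_pos (mul_pos hA hs)))) (mul_pos hA hc)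
  have heq : ∀ x ∈ Ioo ψ (π / 2),
      |slowness a (a τ * sin x) * (a τ * cos x)| • G (timeAt a τ x) = g x := fun x hx => by
    rw [abs_of_pos (hpos x hx), smul_eq_mul, hG x hx]
  constructor
  -- Open intervals are used because `timeAt` is differentiated only inside (0, π/2). The injective
  -- change of variables for Bochner integrals asks for no integrability, so integrability can be
  -- transferred separately.
  · rw [intervalIntegral.integral_of_le hle, intervalIntegral.integral_of_le h1,
      integral_Ioc_eq_integral_Ioo, integral_Ioc_eq_integral_Ioo, ← ha.image_timeAt hτ h0 h1,
      integral_image_eq_integral_abs_deriv_smul measurableSet_Ioo hder hinj]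
    exact setIntegral_congr_fun measurableSet_Ioo heq
  · rw [intervalIntegrable_iff_integrableOn_Ioo_of_le h1,
      intervalIntegrable_iff_integrableOn_Ioo_of_le hle, ← ha.image_timeAt hτ h0 h1,
      integrableOn_image_iff_integrableOn_abs_deriv_smul measurableSet_Ioo hder hinj]
    exact fun h => h.congr_fun (fun x hx => (heq x hx).symm) measurableSet_Ioo

lemma sqrt_sub_eq {A x : ℝ} (hA : 0 ≤ A) (hc : 0 ≤ cos x) :
    √(A ^ 2 - (A * sin x) ^ 2) = A * cos x := by
  have : A ^ 2 - (A * sin x) ^ 2 = (A * cos x) ^ 2 := by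
    linear_combination A ^ 2 * (- sin_sq_add_cos_sq x)
  rw [this, sqrt_sq (mul_nonneg hA hc)]

variable {K L : ℝ}

lemma properDist_timeAt_of_nonneg (ha : IsStronglyRegular a) {τ ψ : ℝ} (hτ : 0 < τ)
    (hk : IsSlowness (slowness a) (slownessDeriv a) (deriv (slownessDeriv a)) K L)
    (h : ψ ∈ Icc 0 (π / 2)) :
    properDist a τ (timeAt a τ ψ) = radial (slowness a) (a τ) ψ ∧
      IntervalIntegrable (fun t => a |t| / √((a τ) ^ 2 - (a |t|) ^ 2)) volume
        (timeAt a τ ψ) τ := by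
  have hA := ha.pos hτ
  have key := ha.subst_timeAt hτ h.1 h.2 (G := fun t => a |t| / √((a τ) ^ 2 - (a |t|) ^ 2))
    (g := fun x => hubbleLen (slowness a) (a τ * sin x)) (by
      intro x hx
      have hx0 := h.1.trans_lt hx.1
      have hs := sin_pos_of_mem hx0 ⟨le_rfl, hx.2.le⟩
      have hc : 0 < cos x := cos_pos_of_mem_Ioo ⟨by linarith [pi_pos], hx.2⟩
      rw [abs_of_pos (ha.timeAt_pos hτ hx0 hx.2.le), ha.map_timeAt hτ ⟨hx0.le, hx.2.le⟩,
        sqrt_sub_eq hA.le hc.le, hubbleLen_of_nonneg _ (mul_pos hA hs).le]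
      field_simp)
  refine ⟨key.1, key.2 ?_⟩
  exact (hk.continuous_hubbleLen.comp (by fun_prop : Continuous fun x => a τ * sin x)
    ).intervalIntegrable _ _

/-- At negative angles both sides satisfy the same reflection rule: twice the value at the big bang
minus the value at the reflected point. -/
lemma properDist_timeAt (ha : IsStronglyRegular a) {τ ψ : ℝ} (hτ : 0 < τ)
    (hk : IsSlowness (slowness a) (slownessDeriv a) (deriv (slownessDeriv a)) K L)
    (h : ψ ∈ Ioc (-(π / 2)) (π / 2)) :
    properDist a τ (timeAt a τ ψ) = radial (slowness a) (a τ) ψ := by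
  rcases le_or_gt 0 ψ with h0 | h0
  · exact (ha.properDist_timeAt_of_nonneg hτ hk ⟨h0, h.2⟩).1
  have hneg : -ψ ∈ Icc 0 (π / 2) := ⟨by linarith, by linarith [h.1]⟩
  obtain ⟨h1, i1⟩ := ha.properDist_timeAt_of_nonneg hτ hk hneg
  obtain ⟨h2, i2⟩ := ha.properDist_timeAt_of_nonneg hτ hk (ψ := 0) ⟨le_rfl, by positivity⟩
  rw [ha.timeAt_zero] at h2 i2
  rw [timeAt_of_neg a τ h0]
  set s := timeAt a τ (-ψ) with hs
  have hs0 : 0 < s := ha.timeAt_pos hτ (by linarith) hneg.2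
  have i3 : IntervalIntegrable (fun t => a |t| / √((a τ) ^ 2 - (a |t|) ^ 2)) volume 0 s :=
    i2.trans i1.symm
  have i4 : IntervalIntegrable (fun t => a |t| / √((a τ) ^ 2 - (a |t|) ^ 2)) volume (-s) 0 := by
    have := IntervalIntegrable.iff_comp_neg (by simp) |>.1 i3
    simp only [abs_neg, neg_zero] at this
    exact this.symm
  have e1 : ∫ t in (-s)..0, a |t| / √((a τ) ^ 2 - (a |t|) ^ 2) =
      ∫ t in 0..s, a |t| / √((a τ) ^ 2 - (a |t|) ^ 2) := by
    have := intervalIntegral.integral_comp_neg (a := 0) (b := s)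
      (fun t => a |t| / √((a τ) ^ 2 - (a |t|) ^ 2))
    simp only [abs_neg, neg_zero] at this
    exact this.symm
  have e2 := intervalIntegral.integral_add_adjacent_intervals i4 i2
  have e3 := intervalIntegral.integral_add_adjacent_intervals i3 i1
  have e4 := hk.radial_neg (a τ) ψ
  simp only [properDist] at h1 h2 ⊢
  linarith

lemma fermiRadius_eq (ha : IsStronglyRegular a) {τ : ℝ} (hτ : 0 < τ)
    (hk : IsSlowness (slowness a) (slownessDeriv a) (deriv (slownessDeriv a)) K L) :
    fermiRadius a τ = radial (slowness a) (a τ) 0 := by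
  rw [fermiRadius, ← ha.properDist_timeAt hτ hk ⟨by linarith [pi_pos], by positivity⟩,
    ha.timeAt_zero]

lemma timeAt_mem (ha : IsStronglyRegular a) {τ ψ : ℝ} (hτ : 0 < τ)
    (h : ψ ∈ Ioc (-(π / 2)) (π / 2)) : timeAt a τ ψ ∈ Ioc (-τ) τ := by
  have hmono := ha.strictMonoOn_timeAt hτ
  have hr : π / 2 ∈ Icc 0 (π / 2) := ⟨by positivity, le_rfl⟩
  have hl : (0 : ℝ) ∈ Icc 0 (π / 2) := ⟨le_rfl, by positivity⟩
  rcases le_or_gt 0 ψ with h0 | h0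
  · have h1 := hmono.monotoneOn ⟨h0, h.2⟩ hr h.2
    have h2 := hmono.monotoneOn hl ⟨h0, h.2⟩ h0
    rw [ha.timeAt_pi_div_two hτ] at h1
    rw [ha.timeAt_zero] at h2
    exact ⟨by linarith, h1⟩
  · have hneg : -ψ ∈ Icc 0 (π / 2) := ⟨by linarith, by linarith [h.1]⟩
    have h1 := hmono hneg hr (by linarith [h.1])
    have h2 := hmono.monotoneOn hl hneg hneg.1
    rw [ha.timeAt_pi_div_two hτ] at h1
    rw [ha.timeAt_zero] at h2
    rw [timeAt_of_neg a τ h0]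
    exact ⟨by linarith, by linarith⟩

lemma surjOn_timeAt (ha : IsStronglyRegular a) {τ : ℝ} (hτ : 0 < τ) :
    SurjOn (timeAt a τ) (Ioc (-(π / 2)) (π / 2)) (Ioc (-τ) τ) := by
  intro t ht
  rcases le_or_gt 0 t with h0 | h0
  · obtain ⟨hm, he⟩ := ha.exists_timeAt hτ ⟨h0, ht.2⟩
    exact ⟨_, ⟨by linarith [hm.1, pi_pos], hm.2⟩, he⟩
  · obtain ⟨hm, he⟩ := ha.exists_timeAt hτ (t := -t) ⟨by linarith, by linarith [ht.1]⟩
    set ψ := arcsin (a (-t) / a τ) with hψ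
    have hψ0 : 0 < ψ := by
      refine lt_of_le_of_ne hm.1 fun h => ?_
      rw [← h, ha.timeAt_zero] at he
      linarith
    have hψ1 : ψ < π / 2 := by
      refine lt_of_le_of_ne hm.2 fun h => ?_
      rw [h, ha.timeAt_pi_div_two hτ] at he
      linarith [ht.1]
    refine ⟨-ψ, ⟨by linarith, by linarith⟩, ?_⟩
    rw [timeAt_of_neg a τ (by linarith), neg_neg, he, neg_neg]

lemma bijOn_properDist (ha : IsStronglyRegular a) {τ : ℝ} (hτ : 0 < τ)
    (hk : IsSlowness (slowness a) (slownessDeriv a) (deriv (slownessDeriv a)) K L) :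
    BijOn (properDist a τ) (Ioc (-τ) τ) (Ico 0 (2 * fermiRadius a τ)) := by
  rw [ha.fermiRadius_eq hτ hk]
  obtain ⟨hm, hi, hs⟩ := hk.bijOn_radial (ha.pos hτ)
  refine ⟨fun t ht => ?_, fun t ht t' ht' htt => ?_, fun ρ hρ => ?_⟩
  · obtain ⟨ψ, hψ, rfl⟩ := ha.surjOn_timeAt hτ ht
    rw [ha.properDist_timeAt hτ hk hψ]
    exact hm hψ
  · obtain ⟨ψ, hψ, rfl⟩ := ha.surjOn_timeAt hτ ht
    obtain ⟨ψ', hψ', rfl⟩ := ha.surjOn_timeAt hτ ht'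
    rw [ha.properDist_timeAt hτ hk hψ, ha.properDist_timeAt hτ hk hψ'] at htt
    rw [hi hψ hψ' htt]
  · obtain ⟨ψ, hψ, rfl⟩ := hs hρ
    exact ⟨timeAt a τ ψ, ha.timeAt_mem hτ hψ, ha.properDist_timeAt hτ hk hψ⟩

lemma cosmicTime_eq (ha : IsStronglyRegular a) {τ ρ : ℝ} (hτ : 0 < τ)
    (hk : IsSlowness (slowness a) (slownessDeriv a) (deriv (slownessDeriv a)) K L)
    (hq : (a τ, ρ) ∈ radialDomain (slowness a)) :
    cosmicTime a τ ρ = timeAt a τ (angle (slowness a) (a τ) ρ) := by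
  have hm := hk.angle_mem hq
  have hr := hk.radial_angle hq
  simp only at hm hr
  have h1 := (ha.bijOn_properDist hτ hk).injOn.leftInvOn_invFunOn (ha.timeAt_mem hτ hm)
  rwa [ha.properDist_timeAt hτ hk hm, hr] at h1

/-- The substitution gives -A k'(A sin x)(cos ψ - cos x). Writing cos ψ - cos x = cos ψ (1 - cos x)
- (1 - cos ψ) cos x, the first part is `bend` and the second an exact derivative of k(A sin x). -/
lemma fPos_timeAt (ha : IsStronglyRegular a) {τ ψ : ℝ} (hτ : 0 < τ)
    (hk : IsSlowness (slowness a) (slownessDeriv a) (deriv (slownessDeriv a)) K L)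
    (h : ψ ∈ Icc 0 (π / 2)) :
    fPos a τ (timeAt a τ ψ) = shiftPos (slowness a) (slownessDeriv a) (a τ) ψ := by
  have hA := ha.pos hτ
  have hcψ : 0 ≤ cos ψ := cos_nonneg_of_neg_pi_div_two_le_of_le (by linarith [h.1, pi_pos]) h.2
  have key := (ha.subst_timeAt hτ h.1 h.2 (G := fun t => deriv (deriv a) t / (deriv a t) ^ 2 *
      (√((a τ) ^ 2 - (a (timeAt a τ ψ)) ^ 2) / √((a τ) ^ 2 - (a t) ^ 2) - 1))
    (g := fun x => -(a τ * (slownessDeriv a (a τ * sin x) * (cos ψ - cos x)))) (by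
      intro x hx
      have hx0 := h.1.trans_lt hx.1
      have hc : 0 < cos x := cos_pos_of_mem_Ioo ⟨by linarith [pi_pos], hx.2⟩
      have hd := (ha.deriv_pos _ (ha.timeAt_pos hτ hx0 hx.2.le)).ne'
      rw [ha.map_timeAt hτ h, ha.map_timeAt hτ ⟨hx0.le, hx.2.le⟩, sqrt_sub_eq hA.le hcψ,
        sqrt_sub_eq hA.le hc.le, slowness, slownessDeriv, ← timeAt_of_nonneg a τ hx0.le]
      field_simp)).1
  rw [fPos, key]
  have e1 : ∀ x, -(a τ * (slownessDeriv a (a τ * sin x) * (cos ψ - cos x))) =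
      -(a τ * cos ψ) * (slownessDeriv a (a τ * sin x) * (1 - cos x)) +
        (1 - cos ψ) * (slownessDeriv a (a τ * sin x) * (a τ * cos x)) := fun x => by ring
  simp_rw [e1]
  have i1 : IntervalIntegrable (fun x => slownessDeriv a (a τ * sin x) * (1 - cos x)) volume
      ψ (π / 2) := (hk.continuous_bend_integrand hA h.1 h.2 le_rfl).intervalIntegrable_of_Icc h.2
  -- At ψ = 0 the exact derivative has coefficient 0 and is dropped beforehand, since k may be
  -- unbounded near 0.
  rcases h.1.eq_or_lt with h0 | h0
  · subst h0
    simp only [cos_zero, sub_self, zero_mul, add_zero]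
    rw [intervalIntegral.integral_const_mul, ← IsSlowness.bend_eq _ hA h.1 h.2, shiftPos]
    simp
  · have hder : ∀ x ∈ Icc ψ (π / 2), HasDerivAt (fun x => slowness a (a τ * sin x))
        (slownessDeriv a (a τ * sin x) * (a τ * cos x)) x := fun x hx =>
      HasDerivAt.comp (h₂ := slowness a) (h := fun x => a τ * sin x) x
        (hk.hasDerivAt _ (mul_pos hA (sin_pos_of_mem h0 hx))) ((hasDerivAt_sin x).const_mul (a τ))
    have i2 : IntervalIntegrable (fun x => slownessDeriv a (a τ * sin x) * (a τ * cos x)) volume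
        ψ (π / 2) := by
      refine ContinuousOn.intervalIntegrable_of_Icc h.2 (ContinuousOn.mul ?_ (by fun_prop))
      exact hk.continuousOn'.comp (by fun_prop) fun x hx => mul_pos hA (sin_pos_of_mem h0 hx)
    have e2 := intervalIntegral.integral_eq_sub_of_hasDerivAt
      (fun x hx => hder x (by rwa [uIcc_of_le h.2] at hx)) i2
    rw [intervalIntegral.integral_add (i1.const_mul _) (i2.const_mul _),
      intervalIntegral.integral_const_mul, intervalIntegral.integral_const_mul, e2,
      ← IsSlowness.bend_eq _ hA h.1 h.2, shiftPos, sin_pi_div_two, mul_one,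
      hubbleLen_of_nonneg _ (mul_pos hA (sin_pos_of_mem h0 ⟨le_rfl, h.2⟩)).le,
      ← one_sub_cos_eq hcψ]
    have := (one_add_abs_cos_pos ψ).ne'
    field_simp
    ring

lemma fExt_timeAt (ha : IsStronglyRegular a) {τ ψ : ℝ} (hτ : 0 < τ)
    (hk : IsSlowness (slowness a) (slownessDeriv a) (deriv (slownessDeriv a)) K L)
    (h : ψ ∈ Ioc (-(π / 2)) (π / 2)) :
    fExt a τ (timeAt a τ ψ) = shift (slowness a) (slownessDeriv a) (a τ) ψ := by
  have hmono := ha.strictMonoOn_timeAt hτ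
  have hl : (0 : ℝ) ∈ Icc 0 (π / 2) := ⟨le_rfl, by positivity⟩
  rcases le_or_gt 0 ψ with h0 | h0
  · have h2 := hmono.monotoneOn hl ⟨h0, h.2⟩ h0
    rw [ha.timeAt_zero] at h2
    rw [fExt, if_pos h2, ha.fPos_timeAt hτ hk ⟨h0, h.2⟩, shift_of_nonneg _ _ _ h0]
  · have hneg : -ψ ∈ Icc 0 (π / 2) := ⟨by linarith, by linarith [h.1]⟩
    have h2 := ha.timeAt_pos hτ (by linarith : 0 < -ψ) hneg.2
    have h3 := ha.fPos_timeAt hτ hk hl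
    rw [ha.timeAt_zero] at h3
    rw [timeAt_of_neg a τ h0, fExt, if_neg (by linarith), neg_neg, h3,
      ha.fPos_timeAt hτ hk hneg, shift_of_nonpos _ _ _ h0.le]

lemma gTauTau_eq (ha : IsStronglyRegular a) {τ ρ : ℝ} (hτ : 0 < τ)
    (hk : IsSlowness (slowness a) (slownessDeriv a) (deriv (slownessDeriv a)) K L)
    (hq : (a τ, ρ) ∈ radialDomain (slowness a)) :
    gTauTau a τ ρ =
      -(1 - deriv a τ * shiftDist (slowness a) (slownessDeriv a) (a τ) ρ) ^ 2 := by
  rw [gTauTau, ha.cosmicTime_eq hτ hk hq, ha.fExt_timeAt hτ hk (hk.angle_mem hq), shiftDist]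

lemma gThetaBar_timeAt (ha : IsStronglyRegular a) {τ ψ : ℝ} (hτ : 0 < τ)
    (h : ψ ∈ Ioc 0 (π / 2)) :
    gThetaBar 0 a τ (timeAt a τ ψ) = areal (slowness a) (a τ) ψ ^ 2 := by
  have hA := ha.pos hτ
  have hpos := ha.timeAt_pos hτ h.1 h.2
  have key := (ha.subst_timeAt hτ h.1.le h.2
    (G := fun t => 1 / a t * (a τ / √((a τ) ^ 2 - (a t) ^ 2)))
    (g := fun x => (a τ)⁻¹ * (hubbleLen (slowness a) (a τ * sin x) / sin x ^ 2)) (by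
      intro x hx
      have hx0 := h.1.trans hx.1
      have hs := sin_pos_of_mem hx0 ⟨le_rfl, hx.2.le⟩
      have hc : 0 < cos x := cos_pos_of_mem_Ioo ⟨by linarith [pi_pos], hx.2⟩
      rw [ha.map_timeAt hτ ⟨hx0.le, hx.2.le⟩, sqrt_sub_eq hA.le hc.le,
        hubbleLen_of_nonneg _ (mul_pos hA hs).le]
      field_simp)).1
  rw [intervalIntegral.integral_const_mul] at key
  rw [gThetaBar, abs_of_pos hpos, ha.map_timeAt hτ ⟨h.1.le, h.2⟩, chiCoord, key, curvS,
    if_neg (by norm_num), if_pos rfl, areal]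
  field_simp

lemma gThetaBar_abs (k : ℤ) (a : ℝ → ℝ) (τ t : ℝ) : gThetaBar k a τ |t| = gThetaBar k a τ t := by
  simp [gThetaBar]

/-- The square of `areal`, which is continuous with value 0 at angle 0. Thus the limit used to
define g_θθ at the big bang exists and is 0. -/
lemma tendsto_gThetaBar (ha : IsStronglyRegular a) {τ : ℝ} (hτ : 0 < τ)
    (hk : IsSlowness (slowness a) (slownessDeriv a) (deriv (slownessDeriv a)) K L) :
    Tendsto (gThetaBar 0 a τ) (𝓝[≠] 0) (𝓝 0) := by
  have hA := ha.pos hτ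
  have h1 : Tendsto (fun t => arcsin (a t / a τ)) (𝓝[>] 0) (𝓝[Icc 0 (π / 2)] 0) := by
    refine tendsto_nhdsWithin_iff.2 ⟨?_, ?_⟩
    · have h0 : Tendsto a (𝓝[>] 0) (𝓝 0) := by
        have := (ha.continuousOn 0 self_mem_Ici).mono_left (nhdsWithin_mono 0 Ioi_subset_Ici_self)
        rwa [ha.map_zero] at this
      have h2 := (continuous_arcsin.tendsto _).comp (h0.div_const (a τ))
      rwa [zero_div, arcsin_zero] at h2
    · filter_upwards [Ioo_mem_nhdsGT hτ] with t ht
      exact (ha.exists_timeAt hτ ⟨ht.1.le, ht.2.le⟩).1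
  have h2 : Tendsto (fun ψ => areal (slowness a) (a τ) ψ ^ 2) (𝓝[Icc 0 (π / 2)] 0) (𝓝 0) := by
    have h3 : ContinuousOn (fun ψ => areal (slowness a) (a τ) ψ) (Icc 0 (π / 2)) :=
      ContinuousOn.comp (f := fun ψ : ℝ => (a τ, ψ)) hk.continuousOn_areal (by fun_prop)
        fun ψ hψ => mk_mem_prod (mem_univ _) hψ
    have h4 := (h3 0 ⟨le_rfl, by positivity⟩).tendsto.pow 2
    simpa [areal] using h4
  refine ((h2.comp h1).comp tendsto_abs_nhdsNE_zero).congr' ?_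
  have h5 : ∀ᶠ t : ℝ in 𝓝[≠] 0, |t| ∈ Ioo 0 τ :=
    tendsto_abs_nhdsNE_zero.eventually (Ioo_mem_nhdsGT hτ)
  filter_upwards [h5] with t ht
  obtain ⟨hm, he⟩ := ha.exists_timeAt hτ (t := |t|) ⟨ht.1.le, ht.2.le⟩
  have hpos : 0 < arcsin (a |t| / a τ) := arcsin_pos.2 (div_pos (ha.pos ht.1) hA)
  have h6 := ha.gThetaBar_timeAt hτ ⟨hpos, hm.2⟩
  rw [he, gThetaBar_abs] at h6
  simp only [Function.comp]
  rw [h6]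

lemma gThetaTheta_eq (ha : IsStronglyRegular a) {τ ρ : ℝ} (hτ : 0 < τ)
    (hk : IsSlowness (slowness a) (slownessDeriv a) (deriv (slownessDeriv a)) K L)
    (hq : (a τ, ρ) ∈ radialDomain (slowness a)) :
    gThetaTheta 0 a τ ρ =
      areal (slowness a) (a τ) |angle (slowness a) (a τ) ρ| ^ 2 := by
  have hm := hk.angle_mem hq
  simp only at hm
  rw [gThetaTheta, ha.cosmicTime_eq hτ hk hq]
  set ψ := angle (slowness a) (a τ) ρ with hψ
  rcases lt_trichotomy ψ 0 with h | h | h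
  · have h1 := ha.timeAt_pos hτ (by linarith : 0 < -ψ) (by linarith [hm.1])
    rw [timeAt_of_neg a τ h, if_neg (by linarith), abs_of_neg h, ← gThetaBar_abs, abs_neg,
      gThetaBar_abs, ha.gThetaBar_timeAt hτ ⟨by linarith, by linarith [hm.1]⟩]
  · rw [h, if_pos (ha.timeAt_zero τ), (ha.tendsto_gThetaBar hτ hk).limUnder_eq]
    simp [areal]
  · have h1 := ha.timeAt_pos hτ h hm.2
    rw [if_neg h1.ne', abs_of_pos h, ha.gThetaBar_timeAt hτ ⟨h, hm.2⟩]

lemma lam_eq (ha : IsStronglyRegular a) {τ ρ : ℝ} (hτ : 0 < τ)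
    (hk : IsSlowness (slowness a) (slownessDeriv a) (deriv (slownessDeriv a)) K L)
    (hq : (a τ, ρ) ∈ radialDomain (slowness a)) :
    lam 0 a τ ρ = lamDist (slowness a) (a τ, ρ) := by
  rw [lam, lamDist, ha.gThetaTheta_eq hτ hk hq]
  simp only
  split_ifs
  · have hA := ha.pos hτ
    have hd := (ha.deriv_pos τ hτ).ne'
    rw [hubbleLen_of_nonneg _ hA.le, slowness, ha.invScale_map hτ.le]
    field_simp
    simp
  · rfl

end IsStronglyRegular

end RWFermi

/-! ### The radius `rhoMax`, openness of the charts, continuity of the coefficients. -/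

namespace RWFermi

open MeasureTheory Real

lemma gTauTauZeros_bddBelow (a : ℝ → ℝ) (τ : ℝ) : BddBelow (gTauTauZeros a τ) :=
  ⟨0, fun _ hρ => hρ.1.le⟩

lemma rhoMax_le (a : ℝ → ℝ) (τ : ℝ) : rhoMax a τ ≤ 2 * fermiRadius a τ := by
  rw [rhoMax]
  split_ifs with h
  · obtain ⟨ρ, hρ⟩ := h
    exact (csInf_le (gTauTauZeros_bddBelow a τ) hρ).trans hρ.2.1.le
  · exact le_rfl

lemma le_rhoMax {a : ℝ → ℝ} {τ c : ℝ} (hc : c ≤ 2 * fermiRadius a τ)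
    (h : ∀ ρ, 0 < ρ → ρ < c → gTauTau a τ ρ ≠ 0) : c ≤ rhoMax a τ := by
  rw [rhoMax]
  split_ifs with hne
  · refine le_csInf hne fun ρ hρ => ?_
    by_contra! hlt
    exact h ρ hρ.1 hlt hρ.2.2
  · exact hc

lemma gTauTau_ne_zero_of_lt_rhoMax {a : ℝ → ℝ} {τ ρ : ℝ} (h0 : 0 < ρ) (h1 : ρ < rhoMax a τ) :
    gTauTau a τ ρ ≠ 0 := by
  intro h
  have hmem : ρ ∈ gTauTauZeros a τ := ⟨h0, h1.trans_le (rhoMax_le a τ), h⟩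
  rw [rhoMax, if_pos ⟨ρ, hmem⟩] at h1
  exact (csInf_le (gTauTauZeros_bddBelow a τ) hmem).not_gt h1

/-- The points at positive time whose distance from the observer is smaller than twice the Fermi
radius. -/
def doubleFermi (a : ℝ → ℝ) (V : Type*) [NormedAddCommGroup V] : Set (ℝ × V) :=
  {p | 0 < p.1 ∧ ‖p.2‖ < 2 * fermiRadius a p.1}

/-- The value of the scale factor and the distance from the observer. -/
noncomputable def scaleDist (a : ℝ → ℝ) {V : Type*} [NormedAddCommGroup V] (p : ℝ × V) : ℝ × ℝ :=
  (a p.1, ‖p.2‖)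

namespace IsStronglyRegular

variable {a : ℝ → ℝ} {K L : ℝ} {V : Type*} [NormedAddCommGroup V]

lemma continuousAt_scaleDist (ha : IsStronglyRegular a) {p : ℝ × V} (hp : 0 < p.1) :
    ContinuousAt (scaleDist a) p :=
  (ContinuousAt.comp (g := a) (f := fun p : ℝ × V => p.1) (ha.hasDerivAt hp).continuousAt
    continuousAt_fst).prodMk continuousAt_snd.norm

lemma scaleDist_mem (ha : IsStronglyRegular a)
    (hk : IsSlowness (slowness a) (slownessDeriv a) (deriv (slownessDeriv a)) K L) {p : ℝ × V}
    (hp : p ∈ doubleFermi a V) : scaleDist a p ∈ radialDomain (slowness a) := by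
  refine ⟨ha.pos hp.1, norm_nonneg _, ?_⟩
  rw [scaleDist, ← ha.fermiRadius_eq hp.1 hk]
  exact hp.2

lemma isOpen_doubleFermi (ha : IsStronglyRegular a)
    (hk : IsSlowness (slowness a) (slownessDeriv a) (deriv (slownessDeriv a)) K L) :
    IsOpen (doubleFermi a V) := by
  rw [isOpen_iff_mem_nhds]
  intro p hp
  have h1 : ContinuousAt (fun p : ℝ × V => 2 * radial (slowness a) (a p.1) 0) p :=
    continuousAt_const.mul (ContinuousAt.comp (g := fun q : ℝ × ℝ => radial (slowness a) q.1 0)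
      (hk.continuous_radial.comp
        (by fun_prop : Continuous fun q : ℝ × ℝ => (q.1, (0 : ℝ)))).continuousAt
      (ha.continuousAt_scaleDist hp.1))
  have h2 : ‖p.2‖ < 2 * radial (slowness a) (a p.1) 0 := by
    rw [← ha.fermiRadius_eq hp.1 hk]
    exact hp.2
  have h3 : ∀ᶠ q : ℝ × V in 𝓝 p, 0 < q.1 := continuousAt_const.eventually_lt continuousAt_fst hp.1
  filter_upwards [h3, continuousAt_snd.norm.eventually_lt h1 h2] with q hq1 hq2
  refine ⟨hq1, ?_⟩
  rw [ha.fermiRadius_eq hq1 hk]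
  exact hq2

lemma continuousOn_scaleDist (ha : IsStronglyRegular a) :
    ContinuousOn (scaleDist a) (doubleFermi a V) := fun _ hp =>
  (ha.continuousAt_scaleDist hp.1).continuousWithinAt

lemma continuousOn_gTauTau (ha : IsStronglyRegular a)
    (hk : IsSlowness (slowness a) (slownessDeriv a) (deriv (slownessDeriv a)) K L) :
    ContinuousOn (fun p : ℝ × V => gTauTau a p.1 ‖p.2‖) (doubleFermi a V) := by
  have h1 : ContinuousOn (fun p : ℝ × V => deriv a p.1) (doubleFermi a V) :=
    ha.contDiffOn_deriv.continuousOn.comp continuousOn_fst fun p hp => hp.1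
  have h2 := hk.continuousOn_shiftDist.comp (ha.continuousOn_scaleDist (V := V))
    fun p hp => ha.scaleDist_mem hk hp
  exact ((continuousOn_const.sub (h1.mul h2)).pow 2).neg.congr
    fun p hp => ha.gTauTau_eq hp.1 hk (ha.scaleDist_mem hk hp)

lemma gTauTau_ne_zero (ha : IsStronglyRegular a)
    (hk : IsSlowness (slowness a) (slownessDeriv a) (deriv (slownessDeriv a)) K L) {τ ρ : ℝ}
    (hτ : 0 < τ) (h0 : 0 ≤ ρ) (h1 : ρ ≤ fermiRadius a τ) : gTauTau a τ ρ ≠ 0 := by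
  have hA := ha.pos hτ
  rw [ha.fermiRadius_eq hτ hk] at h1
  have hq : (a τ, ρ) ∈ radialDomain (slowness a) :=
    ⟨hA, h0, by simp only; linarith [hk.radial_zero_pos hA]⟩
  rw [ha.gTauTau_eq hτ hk hq, neg_ne_zero]
  have h2 := hk.shiftDist_lt hA h0 h1
  have hd := ha.deriv_pos τ hτ
  rw [slowness, ha.invScale_map hτ.le] at h2
  have h3 := mul_lt_mul_of_pos_left h2 hd
  rw [mul_inv_cancel₀ hd.ne'] at h3
  exact pow_ne_zero 2 (by linarith)

lemma fermiRadius_pos (ha : IsStronglyRegular a)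
    (hk : IsSlowness (slowness a) (slownessDeriv a) (deriv (slownessDeriv a)) K L) {τ : ℝ}
    (hτ : 0 < τ) : 0 < fermiRadius a τ := by
  rw [ha.fermiRadius_eq hτ hk]
  exact hk.radial_zero_pos (ha.pos hτ)

/-- If `g_ττ(τ₀, ·)` has no zeros in `[0, ρ₀]`, then `ρ_max` is larger than a constant above `ρ₀`
near `τ₀`. -/
lemma exists_add_le_rhoMax (ha : IsStronglyRegular a)
    (hk : IsSlowness (slowness a) (slownessDeriv a) (deriv (slownessDeriv a)) K L) {τ₀ ρ₀ : ℝ}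
    (hτ : 0 < τ₀) (hρ₀ : 0 ≤ ρ₀) (hρ : ρ₀ < 2 * fermiRadius a τ₀)
    (h : ∀ ρ ∈ Icc 0 ρ₀, gTauTau a τ₀ ρ ≠ 0) :
    ∃ δ > 0, ∀ᶠ τ in 𝓝 τ₀, 0 < τ ∧ ρ₀ + δ ≤ rhoMax a τ := by
  have hopen := ha.isOpen_doubleFermi (V := ℝ) hk
  have hN : IsOpen (doubleFermi a ℝ ∩ (fun p : ℝ × ℝ => gTauTau a p.1 ‖p.2‖) ⁻¹' {0}ᶜ) :=
    (ha.continuousOn_gTauTau hk).isOpen_inter_preimage hopen isOpen_compl_singleton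
  have hsub : ({τ₀} : Set ℝ) ×ˢ Icc 0 ρ₀ ⊆
      doubleFermi a ℝ ∩ (fun p : ℝ × ℝ => gTauTau a p.1 ‖p.2‖) ⁻¹' {0}ᶜ := by
    rintro ⟨τ, ρ⟩ ⟨h1, h2⟩
    simp only [mem_singleton_iff] at h1 h2
    subst h1
    have hn : ‖ρ‖ = ρ := Real.norm_of_nonneg h2.1
    refine ⟨⟨hτ, by simp only [hn]; exact h2.2.trans_lt hρ⟩, ?_⟩
    simp only [mem_preimage, hn, mem_compl_iff, mem_singleton_iff]
    exact h ρ h2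
  -- The tube lemma on {τ₀} × [0, ρ₀] gives zero-free rectangles; the ball around ρ₀ inside v'
  -- provides the margin beyond ρ₀.
  obtain ⟨u', v', hu', hv', hu0', hv0', huv'⟩ :=
    generalized_tube_lemma isCompact_singleton isCompact_Icc hN hsub
  obtain ⟨δ, hδ, hball⟩ := Metric.isOpen_iff.1 hv' ρ₀ (hv0' ⟨hρ₀, le_rfl⟩)
  refine ⟨δ / 2, half_pos hδ, ?_⟩
  filter_upwards [hu'.mem_nhds (hu0' rfl)] with τ hτu
  have hmem : ∀ ρ, 0 ≤ ρ → ρ ≤ ρ₀ + δ / 2 →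
      ρ < 2 * fermiRadius a τ ∧ gTauTau a τ ρ ≠ 0 ∧ 0 < τ := by
    intro ρ h0 h1
    have hρv : ρ ∈ v' := by
      rcases le_total ρ ρ₀ with h2 | h2
      · exact hv0' ⟨h0, h2⟩
      · refine hball ?_
        rw [Metric.mem_ball, Real.dist_eq, abs_of_nonneg (by linarith)]
        linarith
    have h3 := huv' (mk_mem_prod hτu hρv)
    have hn : ‖ρ‖ = ρ := Real.norm_of_nonneg h0
    have h4 := h3.1.2
    have h5 := h3.2
    simp only [mem_preimage, mem_compl_iff, mem_singleton_iff, hn] at h4 h5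
    exact ⟨h4, h5, h3.1.1⟩
  have hend := hmem (ρ₀ + δ / 2) (by linarith) le_rfl
  exact ⟨hend.2.2, le_rhoMax hend.1.le fun ρ h0 h1 => (hmem ρ h0.le h1.le).2.1⟩

lemma fermiRadius_lt_rhoMax (ha : IsStronglyRegular a)
    (hk : IsSlowness (slowness a) (slownessDeriv a) (deriv (slownessDeriv a)) K L) {τ : ℝ}
    (hτ : 0 < τ) : fermiRadius a τ < rhoMax a τ := by
  have hR := ha.fermiRadius_pos hk hτ
  obtain ⟨δ, hδ, h⟩ := ha.exists_add_le_rhoMax hk hτ hR.le (by linarith)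
    fun ρ hρ => ha.gTauTau_ne_zero hk hτ hρ.1 hρ.2
  linarith [h.self_of_nhds.2]

lemma isOpen_lt_rhoMax (ha : IsStronglyRegular a)
    (hk : IsSlowness (slowness a) (slownessDeriv a) (deriv (slownessDeriv a)) K L) :
    IsOpen {p : ℝ × ℝ | 0 < p.1 ∧ p.2 < rhoMax a p.1} := by
  rw [isOpen_iff_mem_nhds]
  intro p hp
  have hR := ha.fermiRadius_pos hk hp.1
  -- The second coordinate is unrestricted from below, so it is replaced by its positive part to fit
  -- an interval starting at 0.
  have hlt : max p.2 0 < rhoMax a p.1 :=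
    max_lt hp.2 (hR.trans (ha.fermiRadius_lt_rhoMax hk hp.1))
  obtain ⟨δ, hδ, h⟩ := ha.exists_add_le_rhoMax hk hp.1 (le_max_right p.2 0)
    (hlt.trans_le (rhoMax_le a p.1)) (by
      intro ρ hρ
      rcases hρ.1.eq_or_lt with rfl | h0
      · exact ha.gTauTau_ne_zero hk hp.1 le_rfl hR.le
      · exact gTauTau_ne_zero_of_lt_rhoMax h0 (hρ.2.trans_lt hlt))
  have h2 : ∀ᶠ q : ℝ × ℝ in 𝓝 p, q.2 < max p.2 0 + δ :=
    continuousAt_snd.eventually_lt continuousAt_const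
      (by linarith [le_max_left p.2 0])
  filter_upwards [continuousAt_fst.eventually h, h2] with q hq1 hq2
  exact ⟨hq1.1, hq2.trans_le hq1.2⟩

lemma isOpen_DFermi (ha : IsStronglyRegular a)
    (hk : IsSlowness (slowness a) (slownessDeriv a) (deriv (slownessDeriv a)) K L) :
    IsOpen (DFermi a) :=
  (ha.isOpen_lt_rhoMax hk).preimage
    (by fun_prop : Continuous fun p : ℝ × EuclideanSpace ℝ (Fin 3) => (p.1, ‖p.2‖))

lemma isOpen_DPolar (ha : IsStronglyRegular a)
    (hk : IsSlowness (slowness a) (slownessDeriv a) (deriv (slownessDeriv a)) K L) (θ₀ φ₀ : ℝ) :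
    IsOpen (DPolar a θ₀ φ₀) := by
  have h1 := (ha.isOpen_lt_rhoMax hk).preimage
    (by fun_prop : Continuous fun p : ℝ × ℝ × ℝ × ℝ => (p.1, p.2.1))
  have h2 : IsOpen {p : ℝ × ℝ × ℝ × ℝ | 0 < p.2.1} := isOpen_lt (by fun_prop) (by fun_prop)
  have h3 := (isOpen_Ioo (a := θ₀) (b := θ₀ + Real.pi)).preimage
    (by fun_prop : Continuous fun p : ℝ × ℝ × ℝ × ℝ => p.2.2.1)
  have h4 := (isOpen_Ioo (a := φ₀) (b := φ₀ + 2 * Real.pi)).preimage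
    (by fun_prop : Continuous fun p : ℝ × ℝ × ℝ × ℝ => p.2.2.2)
  convert h1.inter (h2.inter (h3.inter h4)) using 1
  ext p
  simp only [DPolar, mem_ofPred_eq, mem_inter_iff, mem_preimage]
  tauto

lemma DFermi_subset (a : ℝ → ℝ) : DFermi a ⊆ doubleFermi a (EuclideanSpace ℝ (Fin 3)) :=
  fun p hp => ⟨hp.1, hp.2.trans_le (rhoMax_le a p.1)⟩

lemma scaleDist_polar_mem (ha : IsStronglyRegular a)
    (hk : IsSlowness (slowness a) (slownessDeriv a) (deriv (slownessDeriv a)) K L)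
    {θ₀ φ₀ : ℝ} {p : ℝ × ℝ × ℝ × ℝ} (hp : p ∈ DPolar a θ₀ φ₀) :
    (a p.1, p.2.1) ∈ radialDomainPos (slowness a) := by
  refine ⟨ha.pos hp.1, hp.2.1.1, ?_⟩
  simp only
  rw [← ha.fermiRadius_eq hp.1 hk]
  exact hp.2.1.2.trans_le (rhoMax_le a p.1)

lemma contDiffOn_gTauTau_polar (ha : IsStronglyRegular a)
    (hk : IsSlowness (slowness a) (slownessDeriv a) (deriv (slownessDeriv a)) K L) (θ₀ φ₀ : ℝ) :
    ContDiffOn ℝ 1 (fun p : ℝ × ℝ × ℝ × ℝ => gTauTau a p.1 p.2.1) (DPolar a θ₀ φ₀) := by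
  have h1 : ContDiffOn ℝ 1 (fun p : ℝ × ℝ × ℝ × ℝ => a p.1) (DPolar a θ₀ φ₀) :=
    (ha.contDiffOn.of_le one_le_two).comp contDiff_fst.contDiffOn fun p hp => hp.1
  have h2 : ContDiffOn ℝ 1 (fun p : ℝ × ℝ × ℝ × ℝ => deriv a p.1) (DPolar a θ₀ φ₀) :=
    ha.contDiffOn_deriv.comp contDiff_fst.contDiffOn fun p hp => hp.1
  have h3 : ContDiffOn ℝ 1 (fun p : ℝ × ℝ × ℝ × ℝ => (a p.1, p.2.1)) (DPolar a θ₀ φ₀) :=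
    h1.prodMk (by fun_prop)
  have h4 := hk.contDiffOn_shiftDist.comp h3 fun p hp => ha.scaleDist_polar_mem hk hp
  exact ((contDiffOn_const.sub (h2.mul h4)).pow 2).neg.congr fun p hp =>
    ha.gTauTau_eq hp.1 hk (radialDomainPos_subset _ (ha.scaleDist_polar_mem hk hp))

lemma continuousOn_gThetaTheta_polar (ha : IsStronglyRegular a)
    (hk : IsSlowness (slowness a) (slownessDeriv a) (deriv (slownessDeriv a)) K L) (θ₀ φ₀ : ℝ) :
    ContinuousOn (fun p : ℝ × ℝ × ℝ × ℝ => gThetaTheta 0 a p.1 p.2.1) (DPolar a θ₀ φ₀) := by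
  have h1 : ContinuousOn (fun p : ℝ × ℝ × ℝ × ℝ => (a p.1, p.2.1)) (DPolar a θ₀ φ₀) :=
    (ha.contDiffOn.continuousOn.comp continuousOn_fst fun p hp => hp.1).prodMk (by fun_prop)
  have hmem : ∀ p ∈ DPolar a θ₀ φ₀, (a p.1, p.2.1) ∈ radialDomain (slowness a) :=
    fun p hp => radialDomainPos_subset _ (ha.scaleDist_polar_mem hk hp)
  exact ((hk.continuousOn_areal_angle.comp h1 hmem).pow 2).congr
    fun p hp => ha.gThetaTheta_eq hp.1 hk (hmem p hp)

lemma continuousOn_lam (ha : IsStronglyRegular a)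
    (hk : IsSlowness (slowness a) (slownessDeriv a) (deriv (slownessDeriv a)) K L) :
    ContinuousOn (fun p : ℝ × V => lam 0 a p.1 ‖p.2‖) (doubleFermi a V) :=
  (hk.continuousOn_lamDist.comp ha.continuousOn_scaleDist
    fun _ hp => ha.scaleDist_mem hk hp).congr
    fun _ hp => ha.lam_eq hp.1 hk (ha.scaleDist_mem hk hp)

end IsStronglyRegular

end RWFermi

/-! ### Continuous differentiability across the worldline, and the metric matrices. -/

namespace RWFermi

open MeasureTheory Real Asymptotics

namespace IsStronglyRegular

variable {a : ℝ → ℝ} {K L : ℝ} {V : Type*} [NormedAddCommGroup V] [InnerProductSpace ℝ V]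

/-- The outer derivative vanishes at distance 0, so the inner map need not be differentiable: it is
enough that (a(τ), ‖x‖) moves by O of the displacement. -/
lemma hasFDerivAt_shiftDist_scaleDist_zero (ha : IsStronglyRegular a)
    (hk : IsSlowness (slowness a) (slownessDeriv a) (deriv (slownessDeriv a)) K L) {τ : ℝ}
    (hτ : 0 < τ) :
    HasFDerivAt (fun p : ℝ × V => shiftDist (slowness a) (slownessDeriv a) (a p.1) ‖p.2‖)
      (0 : ℝ × V →L[ℝ] ℝ) (τ, 0) := by
  have hA := ha.pos hτ
  have hmem : (τ, (0 : V)) ∈ doubleFermi a V :=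
    ⟨hτ, by simpa using ha.fermiRadius_pos hk hτ⟩
  have h1 := hk.hasFDerivWithinAt_shiftDist (hk.mem_radialDomain_zero hA)
  rw [hk.shiftDistDeriv_zero hA, hasFDerivWithinAt_iff_isLittleO] at h1
  have h2 : Tendsto (scaleDist a) (𝓝 (τ, (0 : V))) (𝓝[radialDomain (slowness a)] (a τ, 0)) := by
    refine tendsto_nhdsWithin_iff.2 ⟨?_, ?_⟩
    · have := (ha.continuousAt_scaleDist (V := V) (p := (τ, 0)) hτ).tendsto
      simpa [scaleDist] using this
    · filter_upwards [(ha.isOpen_doubleFermi hk).mem_nhds hmem] with p hp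
      exact ha.scaleDist_mem hk hp
  have h3 := h1.comp_tendsto h2
  have h4 : (fun p : ℝ × V => scaleDist a p - (a τ, 0)) =O[𝓝 (τ, 0)]
      fun p => p - (τ, (0 : V)) := by
    have h5 : (fun p : ℝ × V => a p.1 - a τ) =O[𝓝 (τ, 0)] fun p => p - (τ, (0 : V)) := by
      have : HasFDerivAt (fun p : ℝ × V => a p.1)
          (deriv a τ • ContinuousLinearMap.fst ℝ ℝ V) (τ, 0) :=
        HasDerivAt.comp_hasFDerivAt (f := fun p : ℝ × V => p.1) (h₂ := a) (τ, (0 : V))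
          (ha.hasDerivAt hτ) hasFDerivAt_fst
      exact this.isBigO_sub
    have h6 : (fun p : ℝ × V => ‖p.2‖ - 0) =O[𝓝 (τ, 0)] fun p => p - (τ, (0 : V)) := by
      refine IsBigO.of_bound 1 (Eventually.of_forall fun p => ?_)
      rw [sub_zero, norm_norm, one_mul]
      simpa using norm_snd_le (p - (τ, (0 : V)))
    exact h5.prod_left h6
  rw [hasFDerivAt_iff_isLittleO]
  refine (h3.trans_isBigO h4).congr_left fun p => ?_
  simp [scaleDist, hk.shiftDist_zero hA]

lemma hasFDerivAt_shiftDist_scaleDist (ha : IsStronglyRegular a)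
    (hk : IsSlowness (slowness a) (slownessDeriv a) (deriv (slownessDeriv a)) K L) {p : ℝ × V}
    (hp : p ∈ doubleFermi a V) (h0 : p.2 ≠ 0) :
    HasFDerivAt (fun p : ℝ × V => shiftDist (slowness a) (slownessDeriv a) (a p.1) ‖p.2‖)
      ((shiftDistDeriv (slowness a) (slownessDeriv a) (deriv (slownessDeriv a)) L
        (scaleDist a p)).comp ((deriv a p.1 • ContinuousLinearMap.fst ℝ ℝ V).prod
          ((fderiv ℝ norm p.2).comp (ContinuousLinearMap.snd ℝ ℝ V)))) p := by
  have hmem := ha.scaleDist_mem hk hp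
  have hpos : scaleDist a p ∈ radialDomainPos (slowness a) :=
    ⟨hmem.1, norm_pos_iff.2 h0, hmem.2.2⟩
  have h1 := (hk.hasFDerivWithinAt_shiftDist hmem).hasFDerivAt
    (mem_of_superset (hk.isOpen_radialDomainPos.mem_nhds hpos) (radialDomainPos_subset _))
  have h2 : HasFDerivAt (fun p : ℝ × V => a p.1)
      (deriv a p.1 • ContinuousLinearMap.fst ℝ ℝ V) p :=
    HasDerivAt.comp_hasFDerivAt (f := fun p : ℝ × V => p.1) (h₂ := a) p
      (ha.hasDerivAt hp.1) hasFDerivAt_fst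
  have h3 : HasFDerivAt (norm : V → ℝ) (fderiv ℝ norm p.2) p.2 :=
    ((contDiffAt_norm ℝ h0 (n := 1)).differentiableAt one_ne_zero).hasFDerivAt
  have h4 : HasFDerivAt (fun p : ℝ × V => ‖p.2‖)
      ((fderiv ℝ norm p.2).comp (ContinuousLinearMap.snd ℝ ℝ V)) p :=
    HasFDerivAt.comp (g := (norm : V → ℝ)) (f := fun p : ℝ × V => p.2) p h3 hasFDerivAt_snd
  exact HasFDerivAt.comp (f := scaleDist a) p h1 (h2.prodMk h4)

lemma contDiffOn_shiftDist_scaleDist (ha : IsStronglyRegular a)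
    (hk : IsSlowness (slowness a) (slownessDeriv a) (deriv (slownessDeriv a)) K L) :
    ContDiffOn ℝ 1 (fun p : ℝ × V => shiftDist (slowness a) (slownessDeriv a) (a p.1) ‖p.2‖)
      (doubleFermi a V) := by
  have hopen := ha.isOpen_doubleFermi (V := V) hk
  rw [show (1 : WithTop ℕ∞) = 0 + 1 from (zero_add 1).symm,
    contDiffOn_succ_iff_fderiv_of_isOpen hopen]
  refine ⟨?_, by simp, ?_⟩
  · intro p hp
    refine DifferentiableAt.differentiableWithinAt ?_
    by_cases h0 : p.2 = 0
    · obtain ⟨τ, x⟩ := p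
      simp only at h0
      subst h0
      exact (ha.hasFDerivAt_shiftDist_scaleDist_zero hk hp.1).differentiableAt
    · exact (ha.hasFDerivAt_shiftDist_scaleDist hk hp h0).differentiableAt
  · rw [contDiffOn_zero]
    intro p hp
    refine ContinuousAt.continuousWithinAt ?_
    by_cases h0 : p.2 = 0
    · obtain ⟨τ, x⟩ := p
      simp only at h0
      subst h0
      have hτ : 0 < τ := hp.1
      have hzero := (ha.hasFDerivAt_shiftDist_scaleDist_zero (V := V) hk hτ).fderiv
      have hlim : Tendsto (fun p : ℝ × V => ‖shiftDistDeriv (slowness a) (slownessDeriv a)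
          (deriv (slownessDeriv a)) L (scaleDist a p)‖ * (|deriv a p.1| + 1)) (𝓝 (τ, 0))
          (𝓝 0) := by
        have h1 : ContinuousWithinAt (fun p : ℝ × V => shiftDistDeriv (slowness a)
            (slownessDeriv a) (deriv (slownessDeriv a)) L (scaleDist a p)) (doubleFermi a V)
            (τ, 0) :=
          (hk.continuousOn_shiftDistDeriv.comp ha.continuousOn_scaleDist
            fun _ hp => ha.scaleDist_mem hk hp) (τ, 0) hp
        have h2 := (h1.continuousAt (hopen.mem_nhds hp)).tendsto.norm
        have h3 : scaleDist a (τ, (0 : V)) = (a τ, 0) := by simp [scaleDist]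
        rw [h3, hk.shiftDistDeriv_zero (ha.pos hτ), norm_zero] at h2
        have h4 : ContinuousAt (fun p : ℝ × V => deriv a p.1) (τ, 0) :=
          ContinuousAt.comp (g := deriv a) (f := fun p : ℝ × V => p.1)
            (ha.hasDerivAt_deriv hτ).continuousAt continuousAt_fst
        have h5 := h2.mul (h4.tendsto.abs.add_const 1)
        rwa [zero_mul] at h5
      rw [ContinuousAt, hzero]
      -- Off the worldline the chain rule bounds the derivative by the norm of `shiftDistDeriv`
      -- times |a'| + 1, as the norm is 1-Lipschitz; the first factor tends to 0.
      refine squeeze_zero_norm' ?_ hlim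
      filter_upwards [hopen.mem_nhds hp] with q hq
      by_cases hq0 : q.2 = 0
      · obtain ⟨σ, x⟩ := q
        simp only at hq0
        subst hq0
        rw [(ha.hasFDerivAt_shiftDist_scaleDist_zero (V := V) hk hq.1).fderiv, norm_zero]
        positivity
      · rw [(ha.hasFDerivAt_shiftDist_scaleDist hk hq hq0).fderiv]
        refine (ContinuousLinearMap.opNorm_comp_le _ _).trans
          (mul_le_mul_of_nonneg_left ?_ (norm_nonneg _))
        rw [ContinuousLinearMap.opNorm_prod, Prod.norm_def]
        refine max_le ?_ ?_
        · rw [norm_smul, Real.norm_eq_abs]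
          have := mul_le_mul_of_nonneg_left (ContinuousLinearMap.norm_fst_le ℝ ℝ V)
            (abs_nonneg (deriv a q.1))
          linarith
        · have h1 := norm_fderiv_le_of_lipschitz ℝ (x₀ := q.2) (lipschitzWith_one_norm (E := V))
          have h2 := ContinuousLinearMap.opNorm_comp_le (fderiv ℝ norm q.2)
            (ContinuousLinearMap.snd ℝ ℝ V)
          have h3 := mul_le_mul h1 (ContinuousLinearMap.norm_snd_le ℝ ℝ V)
            (ContinuousLinearMap.opNorm_nonneg _) zero_le_one
          rw [NNReal.coe_one, mul_one] at h3
          linarith [abs_nonneg (deriv a q.1)]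
    · have hopen' : IsOpen (doubleFermi a V ∩ {p | p.2 ≠ 0}) :=
        hopen.inter (isOpen_ne_fun continuous_snd continuous_const)
      have h1 : ContDiffOn ℝ 1
          (fun p : ℝ × V => shiftDist (slowness a) (slownessDeriv a) (a p.1) ‖p.2‖)
          (doubleFermi a V ∩ {p | p.2 ≠ 0}) := by
        have h2 : ContDiffOn ℝ 1 (fun p : ℝ × V => a p.1) (doubleFermi a V ∩ {p | p.2 ≠ 0}) :=
          (ha.contDiffOn.of_le one_le_two).comp contDiff_fst.contDiffOn fun p hp => hp.1.1
        have h3 : ContDiffOn ℝ 1 (fun p : ℝ × V => ‖p.2‖) (doubleFermi a V ∩ {p | p.2 ≠ 0}) :=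
          contDiff_snd.contDiffOn.norm ℝ fun p hp => hp.2
        refine hk.contDiffOn_shiftDist.comp (h2.prodMk h3) fun p hp => ?_
        have hmem := ha.scaleDist_mem hk hp.1
        exact ⟨hmem.1, norm_pos_iff.2 hp.2, hmem.2.2⟩
      exact (h1.continuousOn_fderiv_of_isOpen hopen' le_rfl).continuousAt
        (hopen'.mem_nhds ⟨hp, h0⟩)

lemma contDiffOn_gTauTau (ha : IsStronglyRegular a)
    (hk : IsSlowness (slowness a) (slownessDeriv a) (deriv (slownessDeriv a)) K L) :
    ContDiffOn ℝ 1 (fun p : ℝ × V => gTauTau a p.1 ‖p.2‖) (doubleFermi a V) := by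
  have h2 : ContDiffOn ℝ 1 (fun p : ℝ × V => deriv a p.1) (doubleFermi a V) :=
    ha.contDiffOn_deriv.comp contDiff_fst.contDiffOn fun p hp => hp.1
  exact ((contDiffOn_const.sub (h2.mul (ha.contDiffOn_shiftDist_scaleDist hk))).pow 2).neg.congr
    fun p hp => ha.gTauTau_eq hp.1 hk (ha.scaleDist_mem hk hp)

end IsStronglyRegular

lemma continuousOn_fermiMetric {k : ℤ} {a : ℝ → ℝ} {s : Set (ℝ × EuclideanSpace ℝ (Fin 3))}
    (hg : ContinuousOn (fun p : ℝ × EuclideanSpace ℝ (Fin 3) => gTauTau a p.1 ‖p.2‖) s)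
    (hl : ContinuousOn (fun p : ℝ × EuclideanSpace ℝ (Fin 3) => lam k a p.1 ‖p.2‖) s) :
    ContinuousOn (fermiMetric k a) s := by
  have hc : ∀ i, ContinuousOn (fun p : ℝ × EuclideanSpace ℝ (Fin 3) => p.2 i) s := fun i =>
    Continuous.continuousOn (by fun_prop)
  refine continuousOn_pi.2 fun i => continuousOn_pi.2 fun j => ?_
  fin_cases i <;> fin_cases j <;> simp [fermiMetric] <;> fun_prop

lemma continuousOn_polarMetric {k : ℤ} {a : ℝ → ℝ} {s : Set (ℝ × ℝ × ℝ × ℝ)}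
    (hg : ContinuousOn (fun p : ℝ × ℝ × ℝ × ℝ => gTauTau a p.1 p.2.1) s)
    (hθ : ContinuousOn (fun p : ℝ × ℝ × ℝ × ℝ => gThetaTheta k a p.1 p.2.1) s)
    (hφ : ContinuousOn (fun p : ℝ × ℝ × ℝ × ℝ => gPhiPhi k a p.1 p.2.1 p.2.2.1) s) :
    ContinuousOn (polarMetric k a) s := by
  refine continuousOn_pi.2 fun i => continuousOn_pi.2 fun j => ?_
  fin_cases i <;> fin_cases j <;> simp [polarMetric] <;> fun_prop

end RWFermi

theorem theorem7p7 (a : ℝ → ℝ) (ha : RWFermi.IsStronglyRegular a)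
    (hbb : RWFermi.BigBangCondition a) (h3 : RWFermi.ThirdDerivBound a) :
    -- cosmological time is well defined, and the charts reach beyond the big bang
    (∀ τ : ℝ, 0 < τ →
      Set.BijOn (RWFermi.properDist a τ) (Set.Ioc (-τ) τ)
        (Set.Ico 0 (2 * RWFermi.fermiRadius a τ)) ∧
      RWFermi.fermiRadius a τ < RWFermi.rhoMax a τ) ∧
    -- Fermi coordinates
    (IsOpen (RWFermi.DFermi a) ∧
      ContDiffOn ℝ 1 (fun p : ℝ × EuclideanSpace ℝ (Fin 3) => RWFermi.gTauTau a p.1 ‖p.2‖)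
        (RWFermi.DFermi a) ∧
      ContinuousOn (fun p : ℝ × EuclideanSpace ℝ (Fin 3) => RWFermi.lam 0 a p.1 ‖p.2‖)
        (RWFermi.DFermi a) ∧
      ContinuousOn (RWFermi.fermiMetric 0 a) (RWFermi.DFermi a)) ∧
    -- Fermi polar coordinates
    (∀ θ₀ φ₀ : ℝ,
      IsOpen (RWFermi.DPolar a θ₀ φ₀) ∧
      ContDiffOn ℝ 1 (fun p : ℝ × ℝ × ℝ × ℝ => RWFermi.gTauTau a p.1 p.2.1)
        (RWFermi.DPolar a θ₀ φ₀) ∧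
      ContinuousOn (fun p : ℝ × ℝ × ℝ × ℝ => RWFermi.gThetaTheta 0 a p.1 p.2.1)
        (RWFermi.DPolar a θ₀ φ₀) ∧
      ContinuousOn (fun p : ℝ × ℝ × ℝ × ℝ => RWFermi.gPhiPhi 0 a p.1 p.2.1 p.2.2.1)
        (RWFermi.DPolar a θ₀ φ₀) ∧
      ContinuousOn (RWFermi.polarMetric 0 a) (RWFermi.DPolar a θ₀ φ₀)) := by
  obtain ⟨K, L, hk⟩ := ha.isSlowness hbb h3
  have hsub := RWFermi.IsStronglyRegular.DFermi_subset a
  have hg := (ha.contDiffOn_gTauTau (V := EuclideanSpace ℝ (Fin 3)) hk).mono hsub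
  have hl := (ha.continuousOn_lam (V := EuclideanSpace ℝ (Fin 3)) hk).mono hsub
  refine ⟨fun τ hτ => ⟨ha.bijOn_properDist hτ hk, ha.fermiRadius_lt_rhoMax hk hτ⟩,
    ⟨ha.isOpen_DFermi hk, hg, hl, RWFermi.continuousOn_fermiMetric hg.continuousOn hl⟩,
    fun θ₀ φ₀ => ?_⟩
  have hgp := ha.contDiffOn_gTauTau_polar hk θ₀ φ₀
  have hθ := ha.continuousOn_gThetaTheta_polar hk θ₀ φ₀
  have hφ : ContinuousOn (fun p : ℝ × ℝ × ℝ × ℝ => RWFermi.gPhiPhi 0 a p.1 p.2.1 p.2.2.1)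
      (RWFermi.DPolar a θ₀ φ₀) :=
    hθ.mul (Continuous.continuousOn (by fun_prop))
  exact ⟨ha.isOpen_DPolar hk θ₀ φ₀, hgp, hθ, hφ,
    RWFermi.continuousOn_polarMetric hgp.continuousOn hθ hφ⟩
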